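/- Assume the generalized Riemann hypothesis: for every Dirichlet character $\psi$, all zeros of $L(s,\psi)$ with $0<\Re s<1$ satisfy $\Re s=\tfrac12$. For a Dirichlet character $\chi$ (primitive or not) of conductor $q>1$, call a zero $\rho=\beta+i\gamma$ of $L(s,\chi)$ with $0<\beta<1$ a non-trivial zero, and $|\gamma|$ its height. Then: (1) There is an absolute constant $K$ such that for every Dirichlet character $\chi$ of conductor $q>1$, $L(s,\chi)$ has a non-trivial zero of least height $|\gamma_\chi|=\min\{|\gamma| : L(\beta+i\gamma,\chi)=0,\ 0<\beta<1\}$, and $$|\gamma_\chi|\le \frac{\pi}{2\log\log q}+\frac{\pi(\log 4+1)}{2(\log\log q)^2}+\frac{K}{(\log\log q)^3}.$$ (2) For every constant $C>\log 4+1$ and every $\varepsilon>0$ there is $q_0$, depending only on $C$ and $\varepsilon$, such that for every Dirichlet character $\chi$ of conductor $q>1$ with $q\ge q_0$, the number of non-trivial zeros of $L(s,\chi)$, counted with multiplicity, of height at most $\frac{\pi}{2\log\log q}+\frac{\pi C}{2(\log\log q)^2}$ is at least $$\left(\frac{\pi^2}{8}(C-\log 4-1)-\varepsilon\right)\frac{\log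 q}{(\log\log q)^2}.$$ -/

import Mathlib

namespace LowZeros

/-- The non-trivial zeros of `L(s, χ)`: its zeros in the open strip `0 < Re s < 1`. -/
def nontrivialZeros {N : ℕ} [NeZero N] (χ : DirichletCharacter ℂ N) : Set ℂ :=
  {ρ : ℂ | 0 < ρ.re ∧ ρ.re < 1 ∧ DirichletCharacter.LFunction χ ρ = 0}

/-- The generalized Riemann hypothesis: for every Dirichlet character, all the non-trivial zeros
of its `L`-function lie on the critical line. -/
def GRH : Prop :=
  ∀ (N : ℕ) [NeZero N] (χ : DirichletCharacter ℂ N), ∀ ρ ∈ nontrivialZeros χ, ρ.re = 1 / 2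

/-- The heights `|γ|` of the non-trivial zeros `ρ = β + iγ` of `L(s, χ)`. -/
def zeroHeights {N : ℕ} [NeZero N] (χ : DirichletCharacter ℂ N) : Set ℝ :=
  (fun ρ : ℂ => |ρ.im|) '' nontrivialZeros χ

/-- The height `|γ_χ|` of the lowest non-trivial zero of `L(s, χ)`. -/
noncomputable def lowestHeight {N : ℕ} [NeZero N] (χ : DirichletCharacter ℂ N) : ℝ :=
  sInf (zeroHeights χ)

/-- The number of non-trivial zeros of `L(s, χ)` of height at most `t`, counted with
multiplicity. -/
noncomputable def zeroCount {N : ℕ} [NeZero N] (χ : DirichletCharacter ℂ N) (t : ℝ) : ℕ :=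
  ∑ᶠ ρ ∈ {ρ ∈ nontrivialZeros χ | |ρ.im| ≤ t},
    analyticOrderNatAt (DirichletCharacter.LFunction χ) ρ

/-- `log log q`, where `q` is the conductor of `χ`; positive as soon as `q > 1`, because
then `q ≥ 3`. -/
noncomputable def logLogConductor {N : ℕ} (χ : DirichletCharacter ℂ N) : ℝ :=
  Real.log (Real.log (χ.conductor : ℝ))

end LowZeros

/-! The proof is Weil's explicit formula tested against one well-chosen function, with the primes
removed by comparison with `riemannZeta`. Let `g ≥ 0` be a test function on `[0, T]` with `g T = 0`,
and write `ĝ(x) = ∫₀ᵀ g(u) cos(xu) du`. Sums below run over zeros `1/2 + iγ`, with multiplicity.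

Subtract the explicit formula of `ζ` from that of a primitive `χ` mod `q`. The prime terms combine
to `Λ(n)(1 - Re χ(n))` with nonnegative weights, and the difference of the Gamma factors also has a
sign, so both can be dropped. What remains is `explicit_inequality`: `∑_χ ĝ(γ) ≥ g(0) (log q)/2 +
∑_ζ ĝ(γ) - ∫₀ᵀ g(u)(e^{u/2} + e^{-u/2}) du`, the last integral coming from the pole of `ζ` and its
reflection.

The test function `testFn` has `T = π/a` and `ĝ(x) = (a²(1+δ) - x²) E(x)²/(2a)` with `E` real. Zeros
of height at least `a√(1+δ)` contribute at most zero and lower ones at most `2(1+δ)/a` each, so the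
inequality bounds the number of low zeros from below. The zeros of `ζ` cost only `O(a + 1/a)`. This
is `exists_forall_log_le_zeroCount`.

Put `L = log log q`, `m = L - log 4` and `a = π/(2m)`. The pole term is then at most `(1+δ)(π/(2m))
log q`, against a main term `(πδ/4) log q`. The main term wins once `δ` slightly exceeds `2/m`,
which gives the height `(π/(2m))(1 + 1/m + ...)`, that is `π/(2L) + π(log 4 + 1)/(2L²) + O(L⁻³)`. A
larger `δ`, with `a√(1+δ) = π/(2L) + πC/(2L²)`, leaves a surplus that counts zeros.

The explicit formula is obtained by integrating real parts of logarithmic derivatives along a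
vertical line in the half-plane of absolute convergence. The zeros enter through
`hasSum_re_logDeriv`, a partial fraction expansion in which reflection symmetry makes Hadamard's
linear factor unnecessary. Imprimitive characters have the same zeros in the open strip as the
primitive characters inducing them. -/

section

open Complex Metric Filter Topology

namespace LowZeros

/-! ### Partial fractions of the logarithmic derivative of an entire function -/

/-- An entire function that is not identically zero has finite order of vanishing everywhere. -/
lemma analyticOrderAt_ne_top_of_entire {f : ℂ → ℂ} (hf : Differentiable ℂ f) {z₀ : ℂ}
    (h₀ : f z₀ ≠ 0) (z : ℂ) : analyticOrderAt f z ≠ ⊤ := by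
  have han : AnalyticOnNhd ℂ f Set.univ := fun w _ => hf.analyticAt w
  refine han.analyticOrderAt_ne_top_of_isPreconnected isPreconnected_univ (Set.mem_univ z₀)
    (Set.mem_univ z) ?_
  rw [((hf.analyticAt z₀).analyticOrderAt_eq_zero).2 h₀]
  simp

lemma finite_zeros_inter_of_isCompact {f : ℂ → ℂ} (hf : Differentiable ℂ f) {z₀ : ℂ}
    (h₀ : f z₀ ≠ 0) {S : Set ℂ} (hS : IsCompact S) : (S ∩ {z | f z = 0}).Finite := by
  have han : AnalyticOnNhd ℂ f Set.univ := fun w _ => hf.analyticAt w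
  have hcod := mem_codiscrete'.mp (han.preimage_zero_mem_codiscrete h₀)
  have hset : (f ⁻¹' {0}ᶜ)ᶜ = {z | f z = 0} := by ext; simp
  rw [hset] at hcod
  have hcl : IsClosed {z | f z = 0} := isClosed_eq hf.continuous continuous_const
  exact (hS.inter_right hcl).finite (hcod.2.mono Set.inter_subset_right)

lemma countable_zeros {f : ℂ → ℂ} (hf : Differentiable ℂ f) {z₀ : ℂ}
    (h₀ : f z₀ ≠ 0) : {z | f z = 0}.Countable := by
  have : {z | f z = 0} = ⋃ n : ℕ, (closedBall (0 : ℂ) n ∩ {z | f z = 0}) := by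
    ext z
    simp only [Set.mem_iUnion, Set.mem_inter_iff, mem_closedBall_zero_iff]
    obtain ⟨n, hn⟩ := exists_nat_ge ‖z‖
    exact ⟨fun h => ⟨n, hn, h⟩, fun ⟨_, _, h⟩ => h⟩
  rw [this]
  exact Set.countable_iUnion fun n =>
    (finite_zeros_inter_of_isCompact hf h₀ (isCompact_closedBall 0 n)).countable

/-- Division of an entire function by the power of `z - a` dictated by its order at `a`. -/
lemma exists_entire_factor {f : ℂ → ℂ} (hf : Differentiable ℂ f) {a : ℂ}
    (ha : analyticOrderAt f a ≠ ⊤) :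
    ∃ g : ℂ → ℂ, Differentiable ℂ g ∧ g a ≠ 0 ∧
      ∀ z, f z = (z - a) ^ analyticOrderNatAt f a * g z := by
  obtain ⟨h, hh, hha, heq⟩ := ((hf.analyticAt a).analyticOrderAt_ne_top).1 ha
  set n := analyticOrderNatAt f a with hn
  set g : ℂ → ℂ := Function.update (fun z => f z / (z - a) ^ n) a (h a) with hg
  have hga : g a = h a := by simp [hg]
  have hgz : ∀ z, z ≠ a → g z = f z / (z - a) ^ n := fun z hz => by simp [hg, hz]
  have hgh : g =ᶠ[𝓝 a] h := by
    filter_upwards [heq] with z hz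
    by_cases hza : z = a
    · rw [hza, hga]
    · have : (z - a) ^ n ≠ 0 := pow_ne_zero _ (sub_ne_zero.2 hza)
      rw [hgz z hza, hz, smul_eq_mul]
      field_simp
  refine ⟨g, fun z => ?_, hga ▸ hha, fun z => ?_⟩
  · by_cases hza : z = a
    · rw [hza]
      exact hgh.differentiableAt_iff.2 hh.differentiableAt
    · have hev : g =ᶠ[𝓝 z] fun w => f w / (w - a) ^ n := by
        filter_upwards [isOpen_ne.mem_nhds hza] with w hw using hgz w hw
      refine hev.differentiableAt_iff.2 ?_
      exact (hf z).div (by fun_prop) (pow_ne_zero _ (sub_ne_zero.2 hza))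
  · by_cases hza : z = a
    · rw [hza, hga]
      simpa using heq.self_of_nhds
    · have : (z - a) ^ n ≠ 0 := pow_ne_zero _ (sub_ne_zero.2 hza)
      rw [hgz z hza]
      field_simp

/-- Division of an entire function by the polynomial carrying a finite set of its zeros. -/
lemma exists_entire_factor_finset {f : ℂ → ℂ} (hf : Differentiable ℂ f)
    (hord : ∀ z, analyticOrderAt f z ≠ ⊤) (Z : Finset ℂ) :
    ∃ g : ℂ → ℂ, Differentiable ℂ g ∧ (∀ ρ ∈ Z, g ρ ≠ 0) ∧
      ∀ z, f z = (∏ ρ ∈ Z, (z - ρ) ^ analyticOrderNatAt f ρ) * g z := by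
  classical
  induction Z using Finset.induction_on with
  | empty => exact ⟨f, hf, by simp, by simp⟩
  | insert a Z ha ih =>
    obtain ⟨g, hg, hgZ, hfg⟩ := ih
    set P : ℂ → ℂ := fun z => ∏ ρ ∈ Z, (z - ρ) ^ analyticOrderNatAt f ρ with hP
    have hPa : P a ≠ 0 := Finset.prod_ne_zero_iff.2 fun ρ hρ =>
      pow_ne_zero _ (sub_ne_zero.2 fun h => ha (h ▸ hρ))
    have hPd : Differentiable ℂ P := by
      intro z; simp only [hP]; fun_prop
    -- The factors already removed do not vanish at `a`, so dividing by them leaves the order there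
    -- unchanged.
    have hordeq : analyticOrderAt f a = analyticOrderAt g a := by
      have : f = P * g := funext hfg
      rw [this, analyticOrderAt_mul (hPd.analyticAt a) (hg.analyticAt a),
        ((hPd.analyticAt a).analyticOrderAt_eq_zero).2 hPa, zero_add]
    obtain ⟨k, hk, hka, hgk⟩ := exists_entire_factor hg (a := a) (hordeq ▸ hord a)
    have hnat : analyticOrderNatAt g a = analyticOrderNatAt f a := by
      simp [analyticOrderNatAt, hordeq]
    rw [hnat] at hgk
    refine ⟨k, hk, fun ρ hρ => ?_, fun z => ?_⟩
    · rcases Finset.mem_insert.1 hρ with rfl | hρ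
      · exact hka
      · intro h
        exact hgZ ρ hρ (by rw [hgk, h, mul_zero])
    · rw [Finset.prod_insert ha, hfg z, hgk z]
      ring

/-- A quantitative form of the partial fraction expansion: the zeros in a disc of radius `R`
account for the real part of the logarithmic derivative up to `O(B / R ^ 2)`, where `exp B` bounds
the growth of the function in the disc of radius `2 * R`. -/
lemma abs_re_logDeriv_sub_sum_le {f : ℂ → ℂ} (hf : Differentiable ℂ f) (h1 : f 1 ≠ 0)
    (hzero : ∀ z, f z = 0 → z.re = 0)
    (hsymm : ∀ z, ‖f (-(starRingEnd ℂ) z)‖ = ‖f z‖)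
    {R B : ℝ} (hR : 0 < R) (hB : 0 < B)
    (hbound : ∀ z ∈ sphere (1 : ℂ) (2 * R), ‖f z‖ ≤ Real.exp B * ‖f 1‖)
    {Z : Finset ℂ} (hZ : ∀ z, z ∈ Z ↔ z ∈ closedBall (1 : ℂ) R ∧ f z = 0)
    {s : ℂ} (hs : 0 < s.re) (hsR : ‖s - 1‖ < R / 6) (hsR' : ‖s.im * I - 1‖ < R / 6) :
    |(logDeriv f s).re - ∑ ρ ∈ Z, analyticOrderNatAt f ρ * (1 / (s - ρ)).re|
      ≤ 72 * B / R ^ 2 * s.re := by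
  obtain ⟨g, hg, hgZ, hfg⟩ :=
    exists_entire_factor_finset hf (analyticOrderAt_ne_top_of_entire hf h1) Z
  set P : ℂ → ℂ := fun z => ∏ ρ ∈ Z, (z - ρ) ^ analyticOrderNatAt f ρ with hP
  have hPd : Differentiable ℂ P := by
    intro z; simp only [hP]; fun_prop
  set n : ℕ := ∑ ρ ∈ Z, analyticOrderNatAt f ρ with hn
  -- The polynomial is at most `R ^ n` at the centre and at least `R ^ n` on the sphere of radius
  -- `2R`. Hence the bound for `f` relative to its value at `1` passes to `g = f / P` with the same
  -- `B`, however many zeros there are.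
  have hP1 : ‖P 1‖ ≤ R ^ n := by
    simp only [hP, norm_prod, norm_pow]
    rw [hn, ← Finset.prod_pow_eq_pow_sum]
    refine Finset.prod_le_prod (fun _ _ => by positivity) fun ρ hρ => ?_
    have := ((hZ ρ).1 hρ).1
    rw [mem_closedBall, dist_comm, dist_eq_norm] at this
    gcongr
  have hPs : ∀ z ∈ sphere (1 : ℂ) (2 * R), R ^ n ≤ ‖P z‖ := by
    intro z hz
    simp only [hP, norm_prod, norm_pow]
    rw [hn, ← Finset.prod_pow_eq_pow_sum]
    refine Finset.prod_le_prod (fun _ _ => by positivity) fun ρ hρ => ?_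
    have h2 := ((hZ ρ).1 hρ).1
    rw [mem_closedBall] at h2
    rw [mem_sphere] at hz
    have : R ≤ ‖z - ρ‖ := by
      have := dist_triangle z ρ 1
      rw [← dist_eq_norm]; linarith
    gcongr
  have hg1 : g 1 ≠ 0 := fun h => h1 (by rw [hfg, h, mul_zero])
  have hgs : ∀ z ∈ closedBall (1 : ℂ) (2 * R), ‖g z‖ ≤ Real.exp B * ‖g 1‖ := by
    intro z hz
    refine norm_le_of_forall_mem_frontier_norm_le (U := ball (1 : ℂ) (2 * R)) isBounded_ball
      hg.diffContOnCl (fun w hw => ?_) ?_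
    · rw [frontier_ball _ (by positivity)] at hw
      have h3 := hbound w hw
      rw [hfg w, hfg 1, norm_mul, norm_mul] at h3
      have hRn : 0 < R ^ n := by positivity
      have h4 : R ^ n * ‖g w‖ ≤ R ^ n * (Real.exp B * ‖g 1‖) := by
        calc R ^ n * ‖g w‖ ≤ ‖P w‖ * ‖g w‖ := by gcongr; exact hPs w hw
          _ ≤ Real.exp B * (‖P 1‖ * ‖g 1‖) := h3
          _ ≤ Real.exp B * (R ^ n * ‖g 1‖) := by gcongr
          _ = _ := by ring
      exact le_of_mul_le_mul_left h4 hRn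
    · rwa [closure_ball _ (by positivity)]
  have hgne : ∀ z ∈ ball (1 : ℂ) R, g z ≠ 0 := by
    intro z hz h
    exact hgZ z ((hZ z).2 ⟨ball_subset_closedBall hz, by rw [hfg, h, mul_zero]⟩) h
  -- On the disc of radius `R` the quotient `g` has no zeros, hence a logarithm `h` with `h 1 = 0`
  -- and real part at most `B`. Borel–Carathéodory bounds `h` on radius `R/2`; two Cauchy estimates
  -- on circles of radius `R/6` then bound `h'` on radius `R/3` and `h''` on radius `R/6`.
  have hφ : DifferentiableOn ℂ (logDeriv g) (ball 1 R) := by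
    intro z hz
    refine DifferentiableAt.differentiableWithinAt ?_
    exact ((hg.analyticAt z).deriv.differentiableAt).div (hg z) (hgne z hz)
  obtain ⟨h, hh1, hh⟩ := hφ.isExactOn_ball.with_val_at 1 0
  have hexp : ∀ z ∈ ball (1 : ℂ) R, g z = g 1 * exp (h z) := by
    intro z hz
    have hd : ∀ w ∈ ball (1 : ℂ) R, HasDerivAt (fun w => g w * exp (-h w)) 0 w := by
      intro w hw
      have e1 : HasDerivAt (fun w => g w * exp (-h w))
          (deriv g w * exp (-h w) + g w * (exp (-h w) * -logDeriv g w)) w :=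
        (hg w).hasDerivAt.mul ((hh w hw).neg.cexp)
      have e2 : deriv g w * exp (-h w) + g w * (exp (-h w) * -logDeriv g w) = 0 := by
        have := hgne w hw
        rw [logDeriv_apply]
        field_simp
        ring
      rwa [e2] at e1
    have hc := (convex_ball (1 : ℂ) R).is_const_of_fderivWithin_eq_zero (𝕜 := ℂ)
      (f := fun w => g w * exp (-h w))
      (fun w hw => (hd w hw).differentiableAt.differentiableWithinAt)
      (fun w hw => by
        have h5 := (hd w hw).hasFDerivAt.hasFDerivWithinAt (s := ball (1 : ℂ) R)
        rw [h5.fderivWithin (isOpen_ball.uniqueDiffWithinAt hw)]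
        ext; simp) hz (mem_ball_self hR)
    simp only [hh1, neg_zero, exp_zero, mul_one] at hc
    rw [← hc, mul_assoc, ← exp_add]
    simp
  have hre : ∀ z ∈ ball (1 : ℂ) R, (h z).re = Real.log (‖g z‖ / ‖g 1‖) := by
    intro z hz
    rw [hexp z hz, norm_mul, mul_div_cancel_left₀ _ (norm_ne_zero_iff.2 hg1), norm_exp,
      Real.log_exp]
  have hhle : ∀ z ∈ ball (1 : ℂ) R, (h z).re ≤ B := by
    intro z hz
    have h6 := hgs z (ball_subset_closedBall (ball_subset_ball (by linarith) hz))
    rw [hexp z hz, norm_mul, norm_exp, mul_comm] at h6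
    exact Real.exp_le_exp.1 (le_of_mul_le_mul_right h6 (norm_pos_iff.2 hg1))
  have hhd : DifferentiableOn ℂ h (ball 1 R) := fun z hz =>
    (hh z hz).differentiableAt.differentiableWithinAt
  have hhb : ∀ z ∈ closedBall (1 : ℂ) (R / 2), ‖h z‖ ≤ 2 * B := by
    intro z hz
    rw [mem_closedBall, dist_eq_norm] at hz
    have h7 := borelCaratheodory_zero (f := fun w => h (1 + w)) (M := B) (R := R) (z := z - 1) hB
      (fun w hw => by
        have : (1 + w) ∈ ball (1 : ℂ) R := by simpa using hw
        exact ((hh _ this).differentiableAt.comp w (by fun_prop)).differentiableWithinAt)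
      (fun w hw => hhle _ (by simpa using hw)) hR
      (by rw [mem_ball_zero_iff]; linarith) (by simpa using hh1)
    simp only [add_sub_cancel] at h7
    refine h7.trans ?_
    rw [div_le_iff₀ (by linarith)]
    nlinarith
  have hd1 : ∀ z ∈ closedBall (1 : ℂ) (R / 3), ‖logDeriv g z‖ ≤ 12 * B / R := by
    intro z hz
    rw [mem_closedBall] at hz
    have hsub : closedBall z (R / 6) ⊆ closedBall (1 : ℂ) (R / 2) :=
      closedBall_subset_closedBall' (by linarith)
    have h8 := norm_deriv_le_of_forall_mem_sphere_norm_le (f := h) (c := z) (R := R / 6)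
      (C := 2 * B) (by positivity)
      ((hhd.mono (hsub.trans (closedBall_subset_ball (by linarith)))).diffContOnCl_ball le_rfl)
      (fun w hw => hhb w (hsub (sphere_subset_closedBall hw)))
    rw [(hh z (by rw [mem_ball]; linarith)).deriv] at h8
    refine h8.trans (le_of_eq ?_)
    field_simp
    ring
  have hd2 : ∀ z ∈ ball (1 : ℂ) (R / 6), ‖deriv (logDeriv g) z‖ ≤ 72 * B / R ^ 2 := by
    intro z hz
    rw [mem_ball] at hz
    have hsub : closedBall z (R / 6) ⊆ closedBall (1 : ℂ) (R / 3) :=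
      closedBall_subset_closedBall' (by linarith)
    have h8 := norm_deriv_le_of_forall_mem_sphere_norm_le (f := logDeriv g) (c := z) (R := R / 6)
      (C := 12 * B / R) (by positivity)
      ((hφ.mono (hsub.trans (closedBall_subset_ball (by linarith)))).diffContOnCl_ball le_rfl)
      (fun w hw => hd1 w (hsub (sphere_subset_closedBall hw)))
    refine h8.trans (le_of_eq ?_)
    field_simp
    ring
  -- The zeros are purely imaginary, so reflection in the imaginary axis preserves each distance `‖z
  -- - ρ‖`.
  have hPsymm : ∀ z, ‖P (-(starRingEnd ℂ) z)‖ = ‖P z‖ := by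
    intro z
    simp only [hP, norm_prod, norm_pow]
    refine Finset.prod_congr rfl fun ρ hρ => ?_
    congr 1
    have h9 : ρ.re = 0 := hzero ρ ((hZ ρ).1 hρ).2
    have : -(starRingEnd ℂ) z - ρ = -(starRingEnd ℂ) (z - ρ) := by
      apply Complex.ext <;> simp [h9]
      ring
    rw [this, norm_neg, norm_conj]
  have hgsymm : ∀ z, 0 < z.re → ‖g (-(starRingEnd ℂ) z)‖ = ‖g z‖ := by
    intro z hz
    have hPz : P z ≠ 0 := Finset.prod_ne_zero_iff.2 fun ρ hρ => pow_ne_zero _ (sub_ne_zero.2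
      fun hzρ => by have := hzero ρ ((hZ ρ).1 hρ).2; rw [← hzρ] at this; linarith)
    have h10 := hsymm z
    rw [hfg, hfg z, norm_mul, norm_mul] at h10
    change ‖P _‖ * _ = ‖P z‖ * _ at h10
    rw [hPsymm] at h10
    exact mul_left_cancel₀ (norm_ne_zero_iff.2 hPz) h10
  -- The real part of `logDeriv g` is the horizontal derivative of `log ‖g‖`. This function is even
  -- across the imaginary axis, so the derivative vanishes there.
  have haxis : (logDeriv g (s.im * I)).re = 0 := by
    have hmem : (s.im * I : ℂ) ∈ ball (1 : ℂ) R := by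
      rw [mem_ball, dist_eq_norm]; linarith
    set F : ℝ → ℝ := fun σ => (h (s.im * I + σ)).re with hF
    have hFd : HasDerivAt F (logDeriv g (s.im * I)).re 0 := by
      have e1 : HasDerivAt (fun z : ℂ => h (s.im * I + z)) (logDeriv g (s.im * I)) ((0 : ℝ) : ℂ) := by
        have := (hh _ hmem)
        have e2 : HasDerivAt h (logDeriv g (s.im * I)) (s.im * I + ((0 : ℝ) : ℂ)) := by simpa using this
        simpa using HasDerivAt.comp_const_add (s.im * I) ((0 : ℝ) : ℂ) e2
      exact e1.real_of_complex
    have hev : (fun σ => F (-σ)) =ᶠ[𝓝 0] F := by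
      have hc : ∀ ε : ℝ, ContinuousAt (fun σ : ℝ => (s.im * I + (ε * σ : ℝ) : ℂ)) 0 := by
        intro ε; fun_prop
      have hb1 := (hc 1).preimage_mem_nhds (t := ball 1 R) (isOpen_ball.mem_nhds (by simpa using hmem))
      have hb2 := (hc (-1)).preimage_mem_nhds (t := ball 1 R)
        (isOpen_ball.mem_nhds (by simpa using hmem))
      filter_upwards [hb1, hb2] with σ m1 m2
      simp only [Set.mem_preimage, one_mul, neg_mul] at m1 m2
      simp only [hF]
      rw [hre _ m2, hre _ m1]
      congr 2
      have hconj : ∀ τ : ℝ, (s.im * I + ((-τ : ℝ) : ℂ) : ℂ) =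
          -(starRingEnd ℂ) (s.im * I + (τ : ℂ)) := by
        intro τ; apply Complex.ext <;> simp
      rcases lt_trichotomy 0 σ with hσ | hσ | hσ
      · rw [hconj, hgsymm _ (by simpa using hσ)]
      · simp [← hσ]
      · have := hconj (-σ)
        rw [neg_neg] at this
        rw [this, hgsymm _ (by simpa using hσ)]
    have hFd' : HasDerivAt F (-(logDeriv g (s.im * I)).re) 0 := by
      have e3 : HasDerivAt (fun σ => F (-σ)) (-(logDeriv g (s.im * I)).re) 0 := by
        have e4 : HasDerivAt F (logDeriv g (s.im * I)).re (-0) := by simpa using hFd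
        have e5 : HasDerivAt (fun σ => F (-σ)) ((logDeriv g (s.im * I)).re * -1) 0 :=
          HasDerivAt.comp (0 : ℝ) e4 (hasDerivAt_neg (0 : ℝ))
        rwa [mul_neg_one] at e5
      exact e3.congr_of_eventuallyEq hev.symm
    linarith [hFd.unique hFd']
  -- Comparison with the foot of the perpendicular on the axis, at distance `s.re`, where the real
  -- part is zero. The bound on the second derivative of `h` thus yields a decay of `B / R ^ 2`.
  have hmv : ‖logDeriv g s - logDeriv g (s.im * I)‖ ≤ 72 * B / R ^ 2 * ‖s - s.im * I‖ := by
    refine (convex_ball (1 : ℂ) (R / 6)).norm_image_sub_le_of_norm_deriv_le (𝕜 := ℂ)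
      (fun z hz => ?_) hd2 (by rwa [mem_ball, dist_eq_norm]) (by rwa [mem_ball, dist_eq_norm])
    exact hφ.differentiableAt (isOpen_ball.mem_nhds (ball_subset_ball (by linarith) hz))
  have hss : ‖s - s.im * I‖ = s.re := by
    have : s - s.im * I = (s.re : ℂ) := by apply Complex.ext <;> simp
    rw [this, norm_real, Real.norm_of_nonneg hs.le]
  have hlog : logDeriv f s = (∑ ρ ∈ Z, analyticOrderNatAt f ρ * (1 / (s - ρ))) + logDeriv g s := by
    have hsρ : ∀ ρ ∈ Z, s - ρ ≠ 0 := fun ρ hρ => sub_ne_zero.2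
      fun hzρ => by have := hzero ρ ((hZ ρ).1 hρ).2; rw [← hzρ] at this; linarith
    have hf' : f = fun z => P z * g z := funext hfg
    have hPs0 : P s ≠ 0 := Finset.prod_ne_zero_iff.2 fun ρ hρ => pow_ne_zero _ (hsρ ρ hρ)
    have hgs0 : g s ≠ 0 := hgne s (by rw [mem_ball, dist_eq_norm]; linarith)
    have hmul : logDeriv f s = logDeriv P s + logDeriv g s := by
      conv_lhs => rw [hf']
      exact logDeriv_mul s hPs0 hgs0 (hPd s) (hg s)
    rw [hmul]
    congr 1
    simp only [hP]
    rw [logDeriv_prod (f := fun ρ z => (z - ρ) ^ analyticOrderNatAt f ρ)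
      (fun ρ hρ => pow_ne_zero _ (hsρ ρ hρ)) (fun ρ _ => by fun_prop)]
    refine Finset.sum_congr rfl fun ρ _ => ?_
    rw [logDeriv_fun_pow (by fun_prop)]
    simp [logDeriv_apply]
  have hfinal : (logDeriv f s).re - ∑ ρ ∈ Z, analyticOrderNatAt f ρ * (1 / (s - ρ)).re
      = (logDeriv g s - logDeriv g (s.im * I)).re := by
    rw [hlog, sub_re, haxis, add_re, re_sum]
    simp [mul_re]
  rw [hfinal]
  rw [hss] at hmv
  exact (abs_re_le_norm _).trans hmv

/-- The partial fraction expansion of the real part of the logarithmic derivative of an entire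
function of order at most `3 / 2`, all of whose zeros are purely imaginary, and whose modulus is
symmetric about the imaginary axis. -/
theorem hasSum_re_logDeriv {f : ℂ → ℂ} (hf : Differentiable ℂ f) (h1 : f 1 ≠ 0)
    (hzero : ∀ z, f z = 0 → z.re = 0)
    (hsymm : ∀ z, ‖f (-(starRingEnd ℂ) z)‖ = ‖f z‖)
    {C : ℝ} (hgrowth : ∀ z, ‖f z‖ ≤ Real.exp (C * (1 + ‖z‖) ^ (3 / 2 : ℝ)))
    {s : ℂ} (hs : 0 < s.re) :
    HasSum (fun ρ : ℂ => analyticOrderNatAt f ρ * (1 / (s - ρ)).re) (logDeriv f s).re := by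
  classical
  have hfin : ∀ R : ℝ, (closedBall (1 : ℂ) R ∩ {z | f z = 0}).Finite := fun R =>
    finite_zeros_inter_of_isCompact hf h1 (isCompact_closedBall 1 R)
  set Z : ℝ → Finset ℂ := fun R => (hfin R).toFinset with hZdef
  have hZ : ∀ R z, z ∈ Z R ↔ z ∈ closedBall (1 : ℂ) R ∧ f z = 0 := by
    intro R z; simp [hZdef]
  set t : ℂ → ℝ := fun ρ => analyticOrderNatAt f ρ * (1 / (s - ρ)).re with ht
  have hord0 : ∀ ρ, f ρ ≠ 0 → t ρ = 0 := by
    intro ρ hρ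
    have : analyticOrderNatAt f ρ = 0 := by
      by_contra h
      exact hρ (apply_eq_zero_of_analyticOrderNatAt_ne_zero h)
    simp [ht, this]
  have htnn : ∀ ρ, 0 ≤ t ρ := by
    intro ρ
    by_cases hρ : f ρ = 0
    · refine mul_nonneg (Nat.cast_nonneg _) ?_
      have h2 : 0 ≤ (s - ρ).re := by rw [sub_re, hzero ρ hρ]; linarith
      rw [one_div, inv_re]
      exact div_nonneg h2 (normSq_nonneg _)
    · rw [hord0 ρ hρ]
  set a := (logDeriv f s).re with ha
  set D : ℝ := |C| + |Real.log ‖f 1‖| + 1 with hD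
  have hDpos : 0 < D := by positivity
  have hlim : Tendsto (fun R : ℝ => ∑ ρ ∈ Z R, t ρ) atTop (𝓝 a) := by
    -- On the sphere of radius `2R` about `1` one has `1 + ‖z‖ ≤ 4R`, and `4^{3/2} = 8`, so `B` is a
    -- multiple of `R^{3/2}` and the error `B/R²` is `O(R^{-1/2})`. Any growth order below `2` would
    -- do.
    have hbd : ∀ᶠ R : ℝ in atTop,
        |a - ∑ ρ ∈ Z R, t ρ| ≤ 72 * (D * 8 * s.re) * R ^ (-(1 / 2) : ℝ) := by
      filter_upwards [eventually_gt_atTop (6 * ‖s - 1‖), eventually_gt_atTop (6 * ‖s.im * I - 1‖),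
        eventually_ge_atTop 2] with R e1 e2 e3
      have hRpos : 0 < R := by linarith
      set B : ℝ := D * (8 * R ^ (3 / 2 : ℝ)) with hB
      have hR32 : 1 ≤ R ^ (3 / 2 : ℝ) := Real.one_le_rpow (by linarith) (by norm_num)
      have hBpos : 0 < B := by positivity
      have key := abs_re_logDeriv_sub_sum_le hf h1 hzero hsymm hRpos hBpos (fun z hz => ?_)
        (hZ R) hs (by linarith) (by linarith)
      · refine key.trans (le_of_eq ?_)
        have : R ^ (-(1 / 2) : ℝ) = R ^ (3 / 2 : ℝ) / R ^ 2 := by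
          rw [← Real.rpow_natCast, ← Real.rpow_sub hRpos]; norm_num
        rw [this, hB]
        ring
      · refine (hgrowth z).trans ?_
        have h3 : ‖f 1‖ = Real.exp (Real.log ‖f 1‖) := (Real.exp_log (norm_pos_iff.2 h1)).symm
        rw [h3, ← Real.exp_add]
        apply Real.exp_le_exp.2
        have hz' : 1 + ‖z‖ ≤ 4 * R := by
          rw [mem_sphere, dist_eq_norm] at hz
          have : ‖z‖ ≤ ‖z - 1‖ + ‖(1 : ℂ)‖ := by simpa using norm_add_le (z - 1) 1
          rw [norm_one] at this
          linarith
        have h4 : (1 + ‖z‖) ^ (3 / 2 : ℝ) ≤ 8 * R ^ (3 / 2 : ℝ) := by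
          calc (1 + ‖z‖) ^ (3 / 2 : ℝ) ≤ (4 * R) ^ (3 / 2 : ℝ) :=
                Real.rpow_le_rpow (by positivity) hz' (by norm_num)
            _ = 8 * R ^ (3 / 2 : ℝ) := by
                rw [Real.mul_rpow (by norm_num) hRpos.le]
                congr 1
                rw [show (4 : ℝ) = 2 ^ (2 : ℝ) by norm_num, ← Real.rpow_mul (by norm_num)]
                norm_num
        have h5 : C * (1 + ‖z‖) ^ (3 / 2 : ℝ) ≤ |C| * (8 * R ^ (3 / 2 : ℝ)) :=
          mul_le_mul (le_abs_self C) h4 (by positivity) (abs_nonneg C)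
        have h6 : -Real.log ‖f 1‖ ≤ |Real.log ‖f 1‖| * (8 * R ^ (3 / 2 : ℝ)) := by
          have := neg_le_abs (Real.log ‖f 1‖)
          nlinarith [abs_nonneg (Real.log ‖f 1‖)]
        rw [hB, hD]
        nlinarith
    rw [tendsto_iff_norm_sub_tendsto_zero]
    have hz0 : Tendsto (fun R : ℝ => 72 * (D * 8 * s.re) * R ^ (-(1 / 2) : ℝ)) atTop (𝓝 0) := by
      have h8 : (0 : ℝ) < 1 / 2 := by norm_num
      simpa using Tendsto.const_mul (72 * (D * 8 * s.re)) (tendsto_rpow_neg_atTop h8)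
    refine squeeze_zero' (Eventually.of_forall fun _ => norm_nonneg _)
      (hbd.mono fun R hR => ?_) hz0
    rwa [Real.norm_eq_abs, abs_sub_comm]
  -- All terms are nonnegative because `Re s > 0 = Re ρ`. Convergence along discs therefore upgrades
  -- to unconditional summation.
  have hmono : ∀ R, ∀ R' ≥ R, ∑ ρ ∈ Z R, t ρ ≤ ∑ ρ ∈ Z R', t ρ := by
    intro R R' h
    refine Finset.sum_le_sum_of_subset_of_nonneg (fun z hz => ?_) fun ρ _ _ => htnn ρ
    rw [hZ] at hz ⊢
    exact ⟨closedBall_subset_closedBall h hz.1, hz.2⟩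
  refine hasSum_of_isLUB_of_nonneg a htnn ⟨?_, fun b hb => ?_⟩
  · rintro _ ⟨S, rfl⟩
    obtain ⟨R, hR⟩ : ∃ R : ℝ, ∀ z ∈ S, z ∈ closedBall (1 : ℂ) R := by
      obtain ⟨R, hR⟩ := (isBounded_iff_subset_closedBall (1 : ℂ)).1 S.finite_toSet.isBounded
      exact ⟨R, fun z hz => hR hz⟩
    have h7 : ∑ ρ ∈ S, t ρ ≤ ∑ ρ ∈ Z R, t ρ := by
      rw [← Finset.sum_filter_add_sum_filter_not S (fun ρ => f ρ = 0)]
      rw [Finset.sum_eq_zero (s := S.filter fun ρ => ¬ f ρ = 0)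
        (fun ρ hρ => hord0 ρ (Finset.mem_filter.1 hρ).2), add_zero]
      refine Finset.sum_le_sum_of_subset_of_nonneg (fun z hz => ?_) fun ρ _ _ => htnn ρ
      rw [Finset.mem_filter] at hz
      exact (hZ R z).2 ⟨hR z hz.1, hz.2⟩
    exact h7.trans (ge_of_tendsto hlim
      ((eventually_ge_atTop R).mono fun R' h => hmono R R' h))
  · exact le_of_tendsto hlim (Eventually.of_forall fun R => hb ⟨Z R, rfl⟩)

end LowZeros

end

section

open Complex Metric Filter Topology MeasureTheory
open scoped FourierTransform

namespace LowZeros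

/-! ### Truncated exponentials and their Fourier transforms -/

/-- The even function supported on `[-T, T]` that agrees with `p` on `[0, T]`
(when `p T = 0`). -/
noncomputable def evenCutoff (p : ℝ → ℝ) (T : ℝ) (u : ℝ) : ℝ := p (min |u| T)

/-- The Fourier transform of `evenCutoff p T`. -/
noncomputable def cosineTransform (p : ℝ → ℝ) (T : ℝ) (w : ℝ) : ℝ :=
  2 * ∫ u in (0 : ℝ)..T, p u * Real.cos (2 * Real.pi * w * u)

section

variable {p p' p'' : ℝ → ℝ} {T : ℝ}

lemma evenCutoff_of_nonneg {u : ℝ} (hu : 0 ≤ u) (huT : u ≤ T) : evenCutoff p T u = p u := by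
  rw [evenCutoff, abs_of_nonneg hu, min_eq_left huT]

lemma evenCutoff_of_le_abs (hpT : p T = 0) {u : ℝ} (huT : T ≤ |u|) : evenCutoff p T u = 0 := by
  rw [evenCutoff, min_eq_right huT, hpT]

lemma evenCutoff_neg (u : ℝ) : evenCutoff p T (-u) = evenCutoff p T u := by
  simp [evenCutoff]

lemma continuous_evenCutoff (hp : Continuous p) : Continuous (evenCutoff p T) := by
  unfold evenCutoff; fun_prop

lemma hasCompactSupport_evenCutoff (hpT : p T = 0) : HasCompactSupport (evenCutoff p T) := by
  refine HasCompactSupport.intro (isCompact_Icc (a := -T) (b := T)) fun u hu => ?_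
  refine evenCutoff_of_le_abs hpT ?_
  by_contra h
  push Not at h
  exact hu (abs_le.1 h.le)

lemma integrable_evenCutoff (hp : Continuous p) (hpT : p T = 0) :
    Integrable fun u => (evenCutoff p T u : ℂ) :=
  ((continuous_evenCutoff hp).integrable_of_hasCompactSupport
    (hasCompactSupport_evenCutoff hpT)).ofReal

lemma continuous_cosineTransform (hp : Continuous p) : Continuous (cosineTransform p T) := by
  unfold cosineTransform
  refine continuous_const.mul ?_
  exact intervalIntegral.continuous_parametric_intervalIntegral_of_continuous'
    (by fun_prop) 0 T

lemma setIntegral_Ioi_evenCutoff_mul (hT : 0 ≤ T) (hpT : p T = 0) {E : Type*}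
    [NormedAddCommGroup E] [NormedSpace ℝ E] (k : ℝ → E) :
    ∫ u in Set.Ioi (0 : ℝ), evenCutoff p T u • k u = ∫ u in (0 : ℝ)..T, p u • k u := by
  rw [intervalIntegral.integral_of_le hT,
    setIntegral_eq_of_subset_of_forall_sdiff_eq_zero measurableSet_Ioi
      (Set.Ioc_subset_Ioi_self : Set.Ioc 0 T ⊆ Set.Ioi 0)]
  · refine setIntegral_congr_fun measurableSet_Ioc fun u hu => ?_
    simp only [evenCutoff_of_nonneg hu.1.le hu.2]
  · intro u hu
    have h1 : 0 < u := hu.1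
    have h2 : T ≤ |u| := by
      rw [abs_of_pos h1]
      by_contra h
      push Not at h
      exact hu.2 ⟨h1, h.le⟩
    rw [evenCutoff_of_le_abs hpT h2, zero_smul]

lemma fourier_evenCutoff (hT : 0 ≤ T) (hp : Continuous p) (hpT : p T = 0) (w : ℝ) :
    𝓕 (fun u => (evenCutoff p T u : ℂ)) w = (cosineTransform p T w : ℂ) := by
  have hψ := integrable_evenCutoff hp hpT
  set h : ℝ → ℂ := fun u => exp (↑(-2 * Real.pi * u * w) * I) * (evenCutoff p T u : ℂ) with hh
  have hint : Integrable h := by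
    refine hψ.bdd_mul (c := 1) (by fun_prop) (Eventually.of_forall fun u => ?_)
    rw [norm_exp_ofReal_mul_I]
  have h0 : 𝓕 (fun u => (evenCutoff p T u : ℂ)) w = ∫ u, h u := by
    rw [Real.fourier_real_eq_integral_exp_smul]; rfl
  have h1 : ∫ u, h u = ∫ u, h (-u) := (integral_neg_eq_self h volume).symm
  -- Averaging over `u` and `-u` turns the exponential into a cosine and leaves a function of `|u|`
  -- alone.
  have h2 : (2 : ℂ) * ∫ u, h u
      = ∫ u, ((2 * (evenCutoff p T |u| * Real.cos (2 * Real.pi * w * |u|)) : ℝ) : ℂ) := by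
    rw [two_mul]
    nth_rewrite 2 [h1]
    rw [← integral_add hint hint.comp_neg]
    congr 1
    ext u
    have e1 : evenCutoff p T |u| = evenCutoff p T u := by simp [evenCutoff]
    have e2 : Real.cos (2 * Real.pi * w * |u|) = Real.cos (2 * Real.pi * w * u) := by
      rcases abs_cases u with ⟨h, _⟩ | ⟨h, _⟩ <;> rw [h]
      rw [mul_neg, Real.cos_neg]
    simp only [hh, e1, e2, evenCutoff_neg]
    push_cast
    rw [Complex.cos, show (-2 * Real.pi * u * w * I : ℂ) = -(2 * Real.pi * w * u) * I by ring,
      show (-2 * Real.pi * -u * w * I : ℂ) = (2 * Real.pi * w * u) * I by ring]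
    ring
  rw [h0, ← mul_right_inj' (two_ne_zero (α := ℂ)), h2, integral_complex_ofReal,
    integral_comp_abs (f := fun x => 2 * (evenCutoff p T x * Real.cos (2 * Real.pi * w * x))),
    integral_const_mul]
  have h3 := setIntegral_Ioi_evenCutoff_mul hT hpT (fun u => Real.cos (2 * Real.pi * w * u))
  simp only [smul_eq_mul] at h3
  rw [h3, cosineTransform]
  push_cast
  ring

/-- The cosine transform of a `C²` function that vanishes at the right end point decays
quadratically. -/
lemma exists_abs_cosineTransform_le (hT : 0 ≤ T) (h1 : ∀ u, HasDerivAt p (p' u) u)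
    (h2 : ∀ u, HasDerivAt p' (p'' u) u) (h3 : Continuous p'') (hpT : p T = 0) :
    ∃ C, 0 ≤ C ∧ ∀ w, |cosineTransform p T w| ≤ C / (1 + w ^ 2) := by
  have hp : Continuous p := continuous_iff_continuousAt.2 fun u => (h1 u).continuousAt
  set C₀ : ℝ := ∫ u in (0 : ℝ)..T, |p u| with hC₀
  set C₂ : ℝ := ∫ u in (0 : ℝ)..T, |p'' u| with hC₂
  have hC₀n : 0 ≤ C₀ := intervalIntegral.integral_nonneg hT fun u _ => abs_nonneg _
  have hC₂n : 0 ≤ C₂ := intervalIntegral.integral_nonneg hT fun u _ => abs_nonneg _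
  have hcos : ∀ (k : ℝ → ℝ), Continuous k → ∀ y : ℝ,
      |∫ u in (0 : ℝ)..T, k u * Real.cos (y * u)| ≤ ∫ u in (0 : ℝ)..T, |k u| := by
    intro k hk y
    rw [← Real.norm_eq_abs]
    refine intervalIntegral.norm_integral_le_of_norm_le hT (Eventually.of_forall fun u _ => ?_)
      (hk.abs.intervalIntegrable _ _)
    rw [Real.norm_eq_abs, abs_mul]
    exact mul_le_of_le_one_right (abs_nonneg _) (Real.abs_cos_le_one _)
  -- Two integrations by parts. The boundary terms containing `p` vanish because `p T = 0` and `sin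
  -- 0 = 0`; those containing `p'` survive, which limits the decay to second order.
  have hibp : ∀ y : ℝ, y ^ 2 * ∫ u in (0 : ℝ)..T, p u * Real.cos (y * u)
      = p' T * Real.cos (y * T) - p' 0 - ∫ u in (0 : ℝ)..T, p'' u * Real.cos (y * u) := by
    intro y
    have hd : ∀ u ∈ Set.uIcc 0 T, HasDerivAt
        (fun u => p u * (y * Real.sin (y * u)) + p' u * Real.cos (y * u))
        (y ^ 2 * (p u * Real.cos (y * u)) + p'' u * Real.cos (y * u)) u := by
      intro u _
      have hy : HasDerivAt (fun u : ℝ => y * u) y u := by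
        simpa using (hasDerivAt_id u).const_mul y
      have e1 := (h1 u).mul ((hy.sin).const_mul y)
      have e2 := (h2 u).mul hy.cos
      refine (e1.add e2).congr_deriv ?_
      ring
    have hftc := intervalIntegral.integral_eq_sub_of_hasDerivAt hd
      (Continuous.intervalIntegrable (by fun_prop) _ _)
    rw [intervalIntegral.integral_add (Continuous.intervalIntegrable (by fun_prop) _ _)
      (Continuous.intervalIntegrable (by fun_prop) _ _),
      intervalIntegral.integral_const_mul] at hftc
    simp only [hpT, zero_mul, zero_add, mul_zero, Real.sin_zero, Real.cos_zero, mul_one] at hftc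
    linarith
  refine ⟨2 * C₀ + 2 * (|p' T| + |p' 0| + C₂), by positivity, fun w => ?_⟩
  rw [le_div_iff₀ (by positivity)]
  set J := ∫ u in (0 : ℝ)..T, p u * Real.cos (2 * Real.pi * w * u) with hJ
  have hA : |cosineTransform p T w| = 2 * |J| := by
    rw [cosineTransform, abs_mul, abs_of_pos (by norm_num : (0 : ℝ) < 2)]
  have b1 : |J| ≤ C₀ := hcos p hp (2 * Real.pi * w)
  have b2 : w ^ 2 * |J| ≤ |p' T| + |p' 0| + C₂ := by
    have hy2 : w ^ 2 ≤ (2 * Real.pi * w) ^ 2 := by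
      have : (1 : ℝ) ≤ (2 * Real.pi) ^ 2 := by nlinarith [Real.pi_gt_three]
      nlinarith [sq_nonneg w]
    calc w ^ 2 * |J| ≤ (2 * Real.pi * w) ^ 2 * |J| := by gcongr
      _ = |(2 * Real.pi * w) ^ 2 * J| := by rw [abs_mul, abs_of_nonneg (sq_nonneg (2 * Real.pi * w))]
      _ = |p' T * Real.cos (2 * Real.pi * w * T) - p' 0
            - ∫ u in (0 : ℝ)..T, p'' u * Real.cos (2 * Real.pi * w * u)| := by
          rw [hJ, hibp]
      _ ≤ |p' T * Real.cos (2 * Real.pi * w * T)| + |p' 0|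
            + |∫ u in (0 : ℝ)..T, p'' u * Real.cos (2 * Real.pi * w * u)| := by
          simp only [← Real.norm_eq_abs]
          exact (norm_sub_le _ _).trans (add_le_add (norm_sub_le _ _) le_rfl)
      _ ≤ |p' T| + |p' 0| + C₂ := by
          refine add_le_add (add_le_add ?_ le_rfl) (hcos p'' h3 _)
          rw [abs_mul]
          exact mul_le_of_le_one_right (abs_nonneg _) (Real.abs_cos_le_one _)
  rw [hA]
  nlinarith

lemma integrable_of_abs_le_div_one_add_sq {A : ℝ → ℝ} (hA : Continuous A) {C : ℝ}
    (hC : ∀ w, |A w| ≤ C / (1 + w ^ 2)) : Integrable A := by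
  refine (integrable_inv_one_add_sq.const_mul C).mono' hA.aestronglyMeasurable
    (Eventually.of_forall fun w => ?_)
  rw [Real.norm_eq_abs, ← div_eq_mul_inv]
  exact hC w

lemma fourier_cosineTransform (hT : 0 ≤ T) (hp : Continuous p) (hpT : p T = 0)
    (hint : Integrable (cosineTransform p T)) (u : ℝ) :
    𝓕 (fun w => (cosineTransform p T w : ℂ)) u = (evenCutoff p T u : ℂ) := by
  have hF : 𝓕 (fun u => (evenCutoff p T u : ℂ)) = fun w => (cosineTransform p T w : ℂ) :=
    funext (fourier_evenCutoff hT hp hpT)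
  have hinv := Continuous.fourierInv_fourier_eq
    (f := fun u => (evenCutoff p T u : ℂ)) (continuous_ofReal.comp (continuous_evenCutoff hp))
    (integrable_evenCutoff hp hpT) (by rw [hF]; exact hint.ofReal)
  rw [hF] at hinv
  have h4 := congrFun hinv (-u)
  rw [Real.fourierInv_eq_fourier_neg, neg_neg, evenCutoff_neg] at h4
  exact h4

lemma integral_cosineTransform_mul_exp (hT : 0 ≤ T) (hp : Continuous p) (hpT : p T = 0)
    (hint : Integrable (cosineTransform p T)) (u : ℝ) :
    ∫ w, (cosineTransform p T w : ℂ) * exp (-(2 * Real.pi * w * u) * I)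
      = (evenCutoff p T u : ℂ) := by
  rw [← fourier_cosineTransform hT hp hpT hint u, Real.fourier_real_eq_integral_exp_smul]
  congr 1
  ext w
  rw [smul_eq_mul, mul_comm]
  congr 2
  push_cast
  ring

/-- Pairing the cosine transform with a Cauchy kernel gives a truncated Laplace transform. -/
lemma integral_cosineTransform_mul_inv (hT : 0 ≤ T) (hp : Continuous p) (hpT : p T = 0)
    (hint : Integrable (cosineTransform p T)) {z : ℂ} (hz : 0 < z.re) :
    ∫ w, (cosineTransform p T w : ℂ) * (1 / (z + 2 * Real.pi * w * I))
      = ∫ u in (0 : ℝ)..T, (p u : ℂ) * exp (-z * u) := by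
  set e : ℝ → ℂ := (Set.Ioi (0 : ℝ)).indicator fun u => exp (-z * u) with he
  have heint : Integrable e :=
    (integrable_indicator_iff measurableSet_Ioi).2
      (integrableOn_exp_mul_complex_Ioi (by simpa using hz) 0)
  have hFe : ∀ w : ℝ, 𝓕 e w = 1 / (z + 2 * Real.pi * w * I) := by
    intro w
    rw [Real.fourier_real_eq_integral_exp_smul]
    have : ∀ u : ℝ, exp (↑(-2 * Real.pi * u * w) * I) • e u
        = (Set.Ioi (0 : ℝ)).indicator (fun u : ℝ => exp (-(z + 2 * Real.pi * w * I) * u)) u := by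
      intro u
      by_cases hu : u ∈ Set.Ioi (0 : ℝ)
      · rw [he, Set.indicator_of_mem hu, Set.indicator_of_mem hu, smul_eq_mul, ← exp_add]
        congr 1
        push_cast
        ring
      · rw [he, Set.indicator_of_notMem hu, Set.indicator_of_notMem hu, smul_zero]
    simp_rw [this]
    rw [integral_indicator measurableSet_Ioi, integral_exp_mul_complex_Ioi (by simpa using hz)]
    simp only [ofReal_zero, mul_zero, exp_zero]
    rw [neg_div_neg_eq]
  -- The Cauchy kernel is the Fourier transform of the one-sided exponential `e`. The multiplication
  -- formula moves the transform from `e` to the cosine transform, where Fourier inversion applies.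
  have hflip := VectorFourier.integral_fourierIntegral_smul_eq_flip (L := innerₗ ℝ)
    (μ := volume) (ν := volume) (f := fun w => (cosineTransform p T w : ℂ)) (g := e)
    Real.continuous_fourierChar continuous_inner hint.ofReal heint
  have hflip' : ∫ u, 𝓕 (fun w => (cosineTransform p T w : ℂ)) u • e u
      = ∫ w, (cosineTransform p T w : ℂ) • 𝓕 e w := by
    rw [flip_innerₗ] at hflip
    exact hflip
  simp only [hFe, fourier_cosineTransform hT hp hpT hint, smul_eq_mul] at hflip'
  have h3 := setIntegral_Ioi_evenCutoff_mul hT hpT (fun u => exp (-z * u))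
  simp only [real_smul] at h3
  rw [← hflip', ← h3, ← integral_indicator measurableSet_Ioi]
  congr 1
  ext u
  by_cases hu : u ∈ Set.Ioi (0 : ℝ)
  · rw [he, Set.indicator_of_mem hu, Set.indicator_of_mem hu]
  · rw [he, Set.indicator_of_notMem hu, Set.indicator_of_notMem hu, mul_zero]

end

end LowZeros

end

section

open Complex Metric Filter Topology MeasureTheory

namespace LowZeros

/-! ### The Gamma function -/

lemma ne_neg_natCast_of_re_pos {s : ℂ} (hs : 0 < s.re) (m : ℕ) : s ≠ -m := by
  rintro rfl
  simp only [neg_re, natCast_re, Left.neg_pos_iff] at hs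
  exact absurd hs (not_lt.2 (Nat.cast_nonneg m))

lemma hasDerivAt_log_Gamma {x : ℝ} (hx : 0 < x) :
    HasDerivAt (Real.log ∘ Real.Gamma) (digamma x).re x := by
  have h1 := (differentiableAt_Gamma (x : ℂ)
    (ne_neg_natCast_of_re_pos (by simpa using hx))).hasDerivAt.real_of_complex
  simp only [Gamma_ofReal, ofReal_re] at h1
  have h2 := h1.log (Real.Gamma_pos_of_pos hx).ne'
  convert! h2 using 1
  rw [digamma_def, logDeriv_apply, Gamma_ofReal, div_ofReal_re]

lemma digamma_ofReal_im {x : ℝ} (hx : 0 < x) : (digamma x).im = 0 := by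
  have hd := (differentiableAt_Gamma (x : ℂ)
    (ne_neg_natCast_of_re_pos (by simpa using hx))).hasDerivAt
  have h1 := hd.real_of_complex
  have h2 := hd.comp_ofReal
  simp only [Gamma_ofReal, ofReal_re] at h1 h2
  have h3 := h2.unique h1.ofReal_comp
  rw [digamma_def, logDeriv_apply, Gamma_ofReal, div_ofReal_im, h3, ofReal_im, zero_div]

lemma digamma_re_mono {x y : ℝ} (hx : 0 < x) (hxy : x ≤ y) :
    (digamma x).re ≤ (digamma y).re := by
  have hm := Real.convexOn_log_Gamma.monotoneOn_deriv
    fun t ht => (hasDerivAt_log_Gamma ht).differentiableAt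
  have := hm (show x ∈ Set.Ioi (0 : ℝ) from hx) (show y ∈ Set.Ioi (0 : ℝ) from hx.trans_le hxy) hxy
  rwa [(hasDerivAt_log_Gamma hx).deriv, (hasDerivAt_log_Gamma (hx.trans_le hxy)).deriv] at this

lemma digamma_re_add_one {x : ℝ} (hx : 0 < x) :
    (digamma ((x + 1 : ℝ) : ℂ)).re = (digamma x).re + 1 / x := by
  have h := digamma_apply_add_one x (ne_neg_natCast_of_re_pos (by simpa using hx))
  push_cast
  rw [h, add_re, ← ofReal_inv, ofReal_re, one_div]

/-- With `E(x) = ψ(x + 1/2) - ψ(x)`, the recurrence for digamma makes the partial sums telescope to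
`E(x) - E(x + n)`. Log-convexity of Gamma makes `ψ` monotone, whence `0 ≤ E(x + n) ≤ 1/(x + n)`,
which tends to zero. -/
lemma hasSum_digamma_re_sub {x : ℝ} (hx : 0 < x) :
    HasSum (fun n : ℕ => 1 / (x + n) - 1 / (x + n + 1 / 2))
      ((digamma ((x + 1 / 2 : ℝ) : ℂ)).re - (digamma x).re) := by
  set E : ℝ → ℝ := fun x => (digamma ((x + 1 / 2 : ℝ) : ℂ)).re - (digamma x).re with hE
  have hstep : ∀ x : ℝ, 0 < x → E (x + 1) = E x - (1 / x - 1 / (x + 1 / 2)) := by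
    intro x hx
    simp only [hE]
    rw [show x + 1 + 1 / 2 = (x + 1 / 2) + 1 by ring, digamma_re_add_one hx,
      digamma_re_add_one (by positivity)]
    ring
  have hsum : ∀ n : ℕ, ∑ k ∈ Finset.range n, (1 / (x + k) - 1 / (x + k + 1 / 2))
      = E x - E (x + n) := by
    intro n
    induction n with
    | zero => simp
    | succ n ih =>
      rw [Finset.sum_range_succ, ih]
      push_cast
      rw [← add_assoc, hstep (x + n) (by positivity)]
      ring
  rw [hasSum_iff_tendsto_nat_of_nonneg]
  · simp_rw [hsum]
    have h0 : Tendsto (fun n : ℕ => E (x + n)) atTop (𝓝 0) := by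
      have hb : Tendsto (fun n : ℕ => 1 / (x + n)) atTop (𝓝 0) := by
        simp_rw [one_div]
        exact tendsto_inv_atTop_zero.comp
          (tendsto_atTop_add_const_left _ x tendsto_natCast_atTop_atTop)
      refine squeeze_zero (fun n => ?_) (fun n => ?_) hb
      · have := digamma_re_mono (x := x + n) (y := x + n + 1 / 2) (by positivity) (by linarith)
        simp only [hE]; linarith
      · have h1 := digamma_re_mono (x := x + n + 1 / 2) (y := x + n + 1) (by positivity)
          (by linarith)
        rw [digamma_re_add_one (x := x + n) (by positivity)] at h1
        simp only [hE]; linarith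
    have h1 := (tendsto_const_nhds (x := E x)).sub h0
    rwa [sub_zero] at h1
  · intro n
    have hxn : 0 < x + n := by positivity
    rw [sub_nonneg]
    exact one_div_le_one_div_of_le hxn (by linarith)

lemma norm_inv_sub_inv_le {z : ℂ} {a : ℝ} (ha : 0 < a) (hz : a ≤ z.re) {c : ℝ} (hc : 0 ≤ c) :
    ‖1 / z - 1 / (z + c)‖ ≤ c / a ^ 2 := by
  have h1 : a ≤ ‖z‖ := hz.trans (re_le_norm z)
  have h2 : a ≤ ‖z + c‖ := by
    refine le_trans ?_ (re_le_norm _)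
    simp only [add_re, ofReal_re]; linarith
  have hz0 : z ≠ 0 := norm_pos_iff.1 (ha.trans_le h1)
  have hz1 : z + c ≠ 0 := norm_pos_iff.1 (ha.trans_le h2)
  have : 1 / z - 1 / (z + c) = c / (z * (z + c)) := by
    field_simp
    ring
  rw [this, norm_div, norm_mul, norm_real, Real.norm_of_nonneg hc, sq]
  gcongr

lemma summable_one_div_add_nat_sq {a : ℝ} (ha : 0 < a) :
    Summable fun n : ℕ => 1 / (a + n) ^ 2 := by
  have := (Real.summable_one_div_nat_add_rpow a 2).2 (by norm_num)
  refine this.congr fun n => ?_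
  have : 0 ≤ n + a := by positivity
  rw [abs_of_nonneg this, add_comm a]
  norm_num

/-- Analytic continuation of the real identity: both sides are analytic in a half-plane around `z`
and agree on real points accumulating at `ε + 1`. -/
lemma hasSum_digamma_sub {z : ℂ} (hz : 0 < z.re) :
    HasSum (fun n : ℕ => 1 / (z + n) - 1 / (z + n + (1 / 2 : ℝ)))
      (digamma (z + 1 / 2) - digamma z) := by
  set ε := z.re / 2 with hε
  have hεpos : 0 < ε := by positivity
  set U : Set ℂ := {w | ε < w.re} with hU
  have hUo : IsOpen U := isOpen_lt continuous_const continuous_re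
  have hUc : IsPreconnected U := (convex_halfSpace_re_gt ε).isPreconnected
  have hsumm : Summable fun n : ℕ => (1 / 2 : ℝ) / (ε + n) ^ 2 := by
    refine ((summable_one_div_add_nat_sq hεpos).mul_left (1 / 2)).congr fun n => ?_
    rw [mul_one_div]
  have hbound : ∀ (n : ℕ), ∀ w ∈ U,
      ‖1 / (w + n) - 1 / (w + n + (1 / 2 : ℝ))‖ ≤ (1 / 2 : ℝ) / (ε + n) ^ 2 := by
    intro n w hw
    have hw' : ε < w.re := hw
    exact norm_inv_sub_inv_le (by positivity) (by simp; linarith) (by norm_num)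
  have hdig : ∀ w ∈ U, DifferentiableAt ℂ digamma w := by
    intro w hw
    have hw' : 0 < w.re := hεpos.trans hw
    have hG : DifferentiableOn ℂ Gamma {w | 0 < w.re} := fun v hv =>
      (differentiableAt_Gamma v (ne_neg_natCast_of_re_pos hv)).differentiableWithinAt
    have hGd : DifferentiableAt ℂ (deriv Gamma) w :=
      (hG.deriv (isOpen_lt continuous_const continuous_re)).differentiableAt
        ((isOpen_lt continuous_const continuous_re).mem_nhds hw')
    exact hGd.div (differentiableAt_Gamma w (ne_neg_natCast_of_re_pos hw'))
      (Gamma_ne_zero_of_re_pos hw')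
  have hlhs : AnalyticOnNhd ℂ (fun w : ℂ => ∑' n : ℕ, (1 / (w + n) - 1 / (w + n + (1 / 2 : ℝ)))) U := by
    refine (differentiableOn_tsum_of_summable_norm hsumm (fun n w hw => ?_) hUo
      hbound).analyticOnNhd hUo
    have hw' : 0 < w.re := hεpos.trans hw
    have h1 : w + n ≠ 0 := fun h => by
      have := congrArg re h; simp at this
      have := Nat.cast_nonneg (α := ℝ) n; linarith
    have h2 : w + n + (1 / 2 : ℝ) ≠ 0 := fun h => by
      have := congrArg re h
      simp only [add_re, natCast_re, ofReal_re, zero_re] at this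
      have := Nat.cast_nonneg (α := ℝ) n; linarith
    refine DifferentiableAt.differentiableWithinAt ?_
    exact ((differentiableAt_const (1 : ℂ)).div (differentiableAt_id.add_const (n : ℂ)) h1).sub
      ((differentiableAt_const (1 : ℂ)).div
        ((differentiableAt_id.add_const (n : ℂ)).add_const ((1 / 2 : ℝ) : ℂ)) h2)
  have hrhs : AnalyticOnNhd ℂ (fun w => digamma (w + 1 / 2) - digamma w) U := by
    refine DifferentiableOn.analyticOnNhd (fun w hw => ?_) hUo
    have hw2 : w + 1 / 2 ∈ U := by
      have hw' : ε < w.re := hw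
      show ε < (w + 1 / 2).re
      simp; linarith
    exact (((hdig _ hw2).comp w (by fun_prop)).sub (hdig w hw)).differentiableWithinAt
  have hreal : ∀ x : ℝ, 0 < x → ∑' n : ℕ, (1 / ((x : ℂ) + n) - 1 / ((x : ℂ) + n + (1 / 2 : ℝ)))
      = digamma ((x : ℂ) + 1 / 2) - digamma x := by
    intro x hx
    have h1 := hasSum_ofReal.2 (hasSum_digamma_re_sub hx)
    have h2 : ∀ y : ℝ, 0 < y → ((digamma y).re : ℂ) = digamma y := fun y hy =>
      Complex.ext (by simp) (by simp [digamma_ofReal_im hy])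
    have h3 := h1.tsum_eq
    rw [ofReal_sub, h2 (x + 1 / 2) (by positivity), h2 x hx] at h3
    push_cast at h3 ⊢
    exact h3
  have hfreq : ∃ᶠ w : ℂ in 𝓝[≠] ((ε + 1 : ℝ) : ℂ),
      ∑' n : ℕ, (1 / (w + n) - 1 / (w + n + (1 / 2 : ℝ))) = digamma (w + 1 / 2) - digamma w := by
    have ht : Tendsto (fun n : ℕ => ((ε + 1 + 1 / ((n : ℝ) + 1) : ℝ) : ℂ)) atTop
        (𝓝[≠] ((ε + 1 : ℝ) : ℂ)) := by
      refine tendsto_nhdsWithin_iff.2 ⟨?_, Eventually.of_forall fun n => ?_⟩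
      · refine (continuous_ofReal.tendsto _).comp ?_
        simpa using (tendsto_const_nhds (x := ε + 1)).add tendsto_one_div_add_atTop_nhds_zero_nat
      · have : (0 : ℝ) < 1 / ((n : ℝ) + 1) := by positivity
        simp only [Set.mem_compl_iff, Set.mem_singleton_iff, ofReal_inj]
        linarith
    exact ht.frequently (Frequently.of_forall fun n => hreal _ (by positivity))
  have hmem : ((ε + 1 : ℝ) : ℂ) ∈ U := by simp [hU]
  have heq := hlhs.eqOn_of_preconnected_of_frequently_eq hrhs hUc hmem hfreq
  have hzU : z ∈ U := by show ε < z.re; linarith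
  have hs : Summable fun n : ℕ => 1 / (z + n) - 1 / (z + n + (1 / 2 : ℝ)) :=
    Summable.of_norm_bounded hsumm fun n => hbound n z hzU
  have heq' := heq hzU
  simp only at heq'
  rw [← heq']
  exact hs.hasSum

lemma differentiableAt_Gammaℝ {s : ℂ} (hs : 0 < s.re) : DifferentiableAt ℂ Gammaℝ s := by
  have h : Gammaℝ = fun s : ℂ => (Real.pi : ℂ) ^ (-s / 2) * Gamma (s / 2) := rfl
  rw [h]
  refine DifferentiableAt.mul ?_ ?_
  · exact DifferentiableAt.const_cpow (by fun_prop) (Or.inl (by exact_mod_cast Real.pi_ne_zero))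
  · exact (differentiableAt_Gamma (s / 2) (ne_neg_natCast_of_re_pos (by simpa using hs))).comp s
      (by fun_prop)

lemma logDeriv_Gammaℝ {s : ℂ} (hs : 0 < s.re) :
    logDeriv Gammaℝ s = -(Real.log Real.pi : ℂ) / 2 + digamma (s / 2) / 2 := by
  have h : Gammaℝ = fun s : ℂ => (Real.pi : ℂ) ^ (-s / 2) * Gamma (s / 2) := rfl
  have hpi : (Real.pi : ℂ) ≠ 0 := by exact_mod_cast Real.pi_ne_zero
  have hs2 : 0 < (s / 2).re := by simpa using hs
  have hd1 : HasDerivAt (fun s : ℂ => (Real.pi : ℂ) ^ (-s / 2))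
      ((Real.pi : ℂ) ^ (-s / 2) * log Real.pi * (-1 / 2)) s :=
    (((hasDerivAt_id s).neg).div_const 2).const_cpow (Or.inl hpi)
  have hd2 : HasDerivAt (fun s : ℂ => Gamma (s / 2)) (deriv Gamma (s / 2) * (1 / 2)) s :=
    HasDerivAt.comp s (differentiableAt_Gamma (s / 2)
      (ne_neg_natCast_of_re_pos hs2)).hasDerivAt ((hasDerivAt_id s).div_const 2)
  have hne : (Real.pi : ℂ) ^ (-s / 2) ≠ 0 := by simp [cpow_eq_zero_iff, hpi]
  rw [h, logDeriv_mul (g := fun s : ℂ => Gamma (s / 2)) s hne (Gamma_ne_zero_of_re_pos hs2) hd1.differentiableAt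
    hd2.differentiableAt, logDeriv_apply, logDeriv_apply, hd1.deriv, hd2.deriv, digamma_def,
    logDeriv_apply, ofReal_log Real.pi_pos.le]
  field_simp

/-- The difference of the logarithmic derivatives of the two archimedean factors. -/
lemma hasSum_logDeriv_Gammaℝ_sub {s : ℂ} (hs : 0 < s.re) :
    HasSum (fun n : ℕ => 1 / (s + 2 * n) - 1 / (s + 2 * n + 1))
      (logDeriv Gammaℝ (s + 1) - logDeriv Gammaℝ s) := by
  rw [logDeriv_Gammaℝ hs, logDeriv_Gammaℝ (s := s + 1) (by simp; linarith)]
  have h := (hasSum_digamma_sub (z := s / 2) (by simpa using hs)).div_const 2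
  convert! h using 1
  · ext n
    have h1 : s + 2 * n ≠ 0 := fun h => by
      have := congrArg re h; simp at this
      have := Nat.cast_nonneg (α := ℝ) n; linarith
    have h2 : s + 2 * n + 1 ≠ 0 := fun h => by
      have := congrArg re h; simp at this
      have := Nat.cast_nonneg (α := ℝ) n; linarith
    have e1 : s / 2 + n = (s + 2 * n) / 2 := by ring
    have e2 : s / 2 + n + ((1 / 2 : ℝ) : ℂ) = (s + 2 * n + 1) / 2 := by push_cast; ring
    rw [e2, e1]
    field_simp
  · rw [show (s + 1) / 2 = s / 2 + 1 / 2 by ring]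
    ring

/-! ### Growth bounds of order `3/2` -/

lemma norm_Gamma_le {z : ℂ} (hz : 0 < z.re) : ‖Gamma z‖ ≤ Real.Gamma z.re := by
  rw [Gamma_eq_integral hz, Real.Gamma_eq_integral hz, GammaIntegral]
  refine (norm_integral_le_integral_norm _).trans (le_of_eq ?_)
  refine setIntegral_congr_fun measurableSet_Ioi fun x hx => ?_
  have hx' : 0 < x := hx
  simp only [norm_mul, norm_real, Real.norm_eq_abs, Real.abs_exp]
  rw [norm_cpow_eq_rpow_re_of_pos hx']
  simp

/-- Growth of order at most `3 / 2` on a set. -/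
def GrowthOn (S : Set ℂ) (f : ℂ → ℂ) : Prop :=
  ∃ C : ℝ, ∀ z ∈ S, ‖f z‖ ≤ Real.exp (C * (1 + ‖z‖) ^ (3 / 2 : ℝ))

lemma one_add_norm_le_rpow (z : ℂ) : 1 + ‖z‖ ≤ (1 + ‖z‖) ^ (3 / 2 : ℝ) := by
  have h : (1 : ℝ) ≤ 1 + ‖z‖ := by linarith [norm_nonneg z]
  simpa using Real.rpow_le_rpow_of_exponent_le h (by norm_num : (1 : ℝ) ≤ 3 / 2)

lemma GrowthOn.mul {S : Set ℂ} {f g : ℂ → ℂ} (hf : GrowthOn S f) (hg : GrowthOn S g) :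
    GrowthOn S fun z => f z * g z := by
  obtain ⟨C, hC⟩ := hf
  obtain ⟨D, hD⟩ := hg
  refine ⟨C + D, fun z hz => ?_⟩
  rw [norm_mul, add_mul, Real.exp_add]
  exact mul_le_mul (hC z hz) (hD z hz) (norm_nonneg _) (Real.exp_pos _).le

lemma growthOn_of_norm_le_exp {S : Set ℂ} {f : ℂ → ℂ} {D : ℝ} (hD : 0 ≤ D)
    (h : ∀ z ∈ S, ‖f z‖ ≤ Real.exp (D * (1 + ‖z‖))) : GrowthOn S f :=
  ⟨D, fun z hz => (h z hz).trans (Real.exp_le_exp.2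
    (mul_le_mul_of_nonneg_left (one_add_norm_le_rpow z) hD))⟩

lemma growthOn_of_bounded {S : Set ℂ} {f : ℂ → ℂ} {M : ℝ} (h : ∀ z ∈ S, ‖f z‖ ≤ M) :
    GrowthOn S f := by
  refine growthOn_of_norm_le_exp (D := |M|) (abs_nonneg _) fun z hz => (h z hz).trans ?_
  have h1 := Real.add_one_le_exp (|M| * (1 + ‖z‖))
  nlinarith [le_abs_self M, abs_nonneg M, norm_nonneg z]

lemma growthOn_add_const (S : Set ℂ) (a : ℂ) : GrowthOn S fun z => a + z := by
  refine growthOn_of_norm_le_exp (D := 1 + ‖a‖) (by positivity) fun z _ => ?_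
  have h1 := Real.add_one_le_exp ((1 + ‖a‖) * (1 + ‖z‖))
  have h2 := norm_add_le a z
  nlinarith [norm_nonneg a, norm_nonneg z]

lemma growthOn_const_sub (S : Set ℂ) (a : ℂ) : GrowthOn S fun z => a - z := by
  refine growthOn_of_norm_le_exp (D := 1 + ‖a‖) (by positivity) fun z _ => ?_
  have h1 := Real.add_one_le_exp ((1 + ‖a‖) * (1 + ‖z‖))
  have h2 := norm_sub_le a z
  nlinarith [norm_nonneg a, norm_nonneg z]

lemma growthOn_cpow (S : Set ℂ) {c : ℝ} (hc : 0 < c) (a b : ℂ) :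
    GrowthOn S fun z => (c : ℂ) ^ (a + b * z) := by
  refine growthOn_of_norm_le_exp (D := |Real.log c| * (‖a‖ + ‖b‖)) (by positivity) fun z _ => ?_
  rw [norm_cpow_eq_rpow_re_of_pos hc, Real.rpow_def_of_pos hc]
  apply Real.exp_le_exp.2
  have h1 : |(a + b * z).re| ≤ (‖a‖ + ‖b‖) * (1 + ‖z‖) := by
    refine (abs_re_le_norm _).trans ((norm_add_le _ _).trans ?_)
    rw [norm_mul]
    nlinarith [norm_nonneg a, norm_nonneg b, norm_nonneg z]
  calc Real.log c * (a + b * z).re ≤ |Real.log c| * |(a + b * z).re| := by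
        rw [← abs_mul]; exact le_abs_self _
    _ ≤ |Real.log c| * ((‖a‖ + ‖b‖) * (1 + ‖z‖)) := by gcongr
    _ = _ := by ring

/-- A crude form of Stirling: `Γ(x) ≤ n! ≤ n ^ n` with `n = ⌈x⌉`, and `log y ≤ 2√y`. Absorbing the
logarithm in this way is why growth is measured with exponent `3/2`, safely below the limit `2`. -/
lemma Gamma_le_exp {x : ℝ} (hx : 1 ≤ x) : Real.Gamma x ≤ Real.exp (2 * (1 + x) ^ (3 / 2 : ℝ)) := by
  have hx0 : 0 < x := by linarith
  set n := ⌈x⌉₊ with hn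
  have hxn : x ≤ n := Nat.le_ceil x
  have hnx : (n : ℝ) ≤ 1 + x := by linarith [(Nat.ceil_lt_add_one hx0.le).le]
  have h1 : Real.Gamma x ≤ Real.Gamma (x + 1) := by
    rw [Real.Gamma_add_one hx0.ne']
    exact le_mul_of_one_le_left (Real.Gamma_pos_of_pos hx0).le hx
  have h2 : Real.Gamma (x + 1) ≤ Real.Gamma (n + 1) :=
    Real.Gamma_strictMonoOn_Ici.monotoneOn (show (2 : ℝ) ≤ x + 1 by linarith)
      (show (2 : ℝ) ≤ n + 1 by linarith) (by linarith)
  have h3 : (n.factorial : ℝ) ≤ (n : ℝ) ^ n := by exact_mod_cast Nat.factorial_le_pow n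
  have hn0 : (0 : ℝ) < n := hx0.trans_le hxn
  have hlog : Real.log (1 + x) ≤ 2 * (1 + x) ^ (1 / 2 : ℝ) := by
    have := Real.log_le_rpow_div (x := 1 + x) (ε := 1 / 2) (by positivity) (by norm_num)
    linarith
  have hlog0 : 0 ≤ Real.log (1 + x) := Real.log_nonneg (by linarith)
  rw [Real.Gamma_nat_eq_factorial] at h2
  refine (h1.trans h2).trans (h3.trans ?_)
  rw [← Real.exp_log hn0, ← Real.exp_nat_mul]
  apply Real.exp_le_exp.2
  calc (n : ℝ) * Real.log n ≤ (1 + x) * Real.log (1 + x) :=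
        mul_le_mul hnx (Real.log_le_log hn0 hnx)
          (Real.log_nonneg (by linarith)) (by positivity)
    _ ≤ (1 + x) * (2 * (1 + x) ^ (1 / 2 : ℝ)) := by gcongr
    _ = 2 * (1 + x) ^ (3 / 2 : ℝ) := by
        rw [show (3 / 2 : ℝ) = 1 + 1 / 2 by norm_num, Real.rpow_add (by positivity),
          Real.rpow_one]
        ring

lemma growthOn_Gamma_comp {S : Set ℂ} {a b : ℝ} (hb : 0 ≤ b) (ha : 0 ≤ a)
    (hS : ∀ z ∈ S, 1 ≤ a + b * z.re) : GrowthOn S fun z => Gamma (a + b * z) := by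
  refine ⟨2 * (1 + a + b) ^ (3 / 2 : ℝ), fun z hz => ?_⟩
  have hre : ((a : ℂ) + b * z).re = a + b * z.re := by simp
  have h1 := hS z hz
  refine (norm_Gamma_le (by rw [hre]; linarith)).trans ?_
  rw [hre]
  refine (Gamma_le_exp h1).trans (Real.exp_le_exp.2 ?_)
  rw [mul_assoc, ← Real.mul_rpow (by positivity) (by positivity)]
  have h2 := re_le_norm z
  gcongr
  nlinarith [norm_nonneg z]

end LowZeros

end

section

open Complex Metric Filter Topology MeasureTheory

namespace LowZeros

/-! ### Boundedness of completed `L`-functions in vertical strips -/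

/-- In the strip, `t^{Re s - 1}` is at most `t^{a-1} + t^{b-1}` for every `t > 0`, so the two edge
integrals dominate. -/
lemma exists_norm_mellin_le {f : ℝ → ℂ} (h : ∀ s, MellinConvergent f s) (a b : ℝ) :
    ∃ M, ∀ s : ℂ, a ≤ s.re → s.re ≤ b → ‖mellin f s‖ ≤ M := by
  refine ⟨∫ t in Set.Ioi (0 : ℝ), (‖(t : ℂ) ^ ((a : ℂ) - 1) • f t‖
    + ‖(t : ℂ) ^ ((b : ℂ) - 1) • f t‖), fun s hsa hsb => ?_⟩
  refine norm_integral_le_of_norm_le ((h a).norm.add (h b).norm) ?_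
  filter_upwards [ae_restrict_mem measurableSet_Ioi] with t ht
  have ht' : 0 < t := ht
  rw [norm_smul, norm_smul, norm_smul, ← add_mul]
  gcongr
  rw [norm_cpow_eq_rpow_re_of_pos ht', norm_cpow_eq_rpow_re_of_pos ht',
    norm_cpow_eq_rpow_re_of_pos ht']
  simp only [sub_re, ofReal_re, one_re]
  rcases le_total 1 t with h1 | h1
  · have := Real.rpow_le_rpow_of_exponent_le h1 (by linarith : s.re - 1 ≤ b - 1)
    have := (Real.rpow_pos_of_pos ht' (a - 1)).le
    linarith
  · have := Real.rpow_le_rpow_of_exponent_ge ht' h1 (by linarith : a - 1 ≤ s.re - 1)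
    have := (Real.rpow_pos_of_pos ht' (b - 1)).le
    linarith

lemma exists_norm_completedHurwitzZetaEven₀_le (x : UnitAddCircle) (a b : ℝ) :
    ∃ M, ∀ s : ℂ, a ≤ s.re → s.re ≤ b → ‖HurwitzZeta.completedHurwitzZetaEven₀ x s‖ ≤ M := by
  set P := HurwitzZeta.hurwitzEvenFEPair x
  obtain ⟨M, hM⟩ := exists_norm_mellin_le (f := P.f_modif)
    (fun s => (P.isStrongFEPair_toStrongFEPair.hasMellin s).1) (a / 2) (b / 2)
  refine ⟨M / 2, fun s hsa hsb => ?_⟩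
  have h := hM (s / 2) (by simp; linarith) (by simp; linarith)
  have e : HurwitzZeta.completedHurwitzZetaEven₀ x s = mellin P.f_modif (s / 2) / 2 := rfl
  rw [e, norm_div]
  simp only [norm_ofNat]
  linarith

lemma exists_norm_completedHurwitzZetaOdd_le (x : UnitAddCircle) (a b : ℝ) :
    ∃ M, ∀ s : ℂ, a ≤ s.re → s.re ≤ b → ‖HurwitzZeta.completedHurwitzZetaOdd x s‖ ≤ M := by
  have hP := HurwitzZeta.isStrong_hurwitzOddFEPair x
  obtain ⟨M, hM⟩ := exists_norm_mellin_le (fun s => (hP.hasMellin s).1)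
    ((a + 1) / 2) ((b + 1) / 2)
  refine ⟨M / 2, fun s hsa hsb => ?_⟩
  have h := hM ((s + 1) / 2) (by simp; linarith) (by simp; linarith)
  rw [HurwitzZeta.completedHurwitzZetaOdd, hP.Λ_eq, norm_div]
  simp only [norm_ofNat]
  linarith

lemma exists_norm_completedLFunction_le {N : ℕ} [NeZero N] (hN : N ≠ 1)
    {χ : DirichletCharacter ℂ N} (hχ : χ ≠ 1) (a b : ℝ) :
    ∃ M, ∀ s : ℂ, a ≤ s.re → s.re ≤ b → ‖DirichletCharacter.completedLFunction χ s‖ ≤ M := by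
  choose M₁ h₁ using fun j : ZMod N =>
    exists_norm_completedHurwitzZetaEven₀_le (ZMod.toAddCircle j) a b
  choose M₂ h₂ using fun j : ZMod N =>
    exists_norm_completedHurwitzZetaOdd_le (ZMod.toAddCircle j) a b
  refine ⟨(N : ℝ) ^ (-a) * (∑ j : ZMod N, M₁ j) + (N : ℝ) ^ (-a) * (∑ j : ZMod N, M₂ j),
    fun s hsa hsb => ?_⟩
  have hN1 : (1 : ℝ) ≤ N := by exact_mod_cast Nat.one_le_iff_ne_zero.2 (NeZero.ne N)
  have hNs : ‖(N : ℂ) ^ (-s)‖ ≤ (N : ℝ) ^ (-a) := by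
    rw [norm_natCast_cpow_of_pos (NeZero.pos N)]
    exact Real.rpow_le_rpow_of_exponent_le hN1 (by simpa using hsa)
  have hterm : ∀ (j : ZMod N) (z : ℂ) (m : ℝ), ‖z‖ ≤ m → ‖χ j * z‖ ≤ m := fun j z m hz => by
    rw [norm_mul]
    exact (mul_le_of_le_one_left (norm_nonneg _) (χ.norm_le_one j)).trans hz
  -- The polar terms carry the coefficients `χ 0` and `∑ χ j`, and both are zero.
  have e : DirichletCharacter.completedLFunction χ s = ZMod.completedLFunction₀ χ s := by
    rw [DirichletCharacter.completedLFunction, ZMod.completedLFunction_eq, χ.map_zero' hN,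
      χ.sum_eq_zero_of_ne_one hχ]
    simp
  rw [e, ZMod.completedLFunction₀]
  refine (norm_add_le _ _).trans (add_le_add ?_ ?_) <;> rw [norm_mul] <;>
    refine mul_le_mul hNs ((norm_sum_le _ _).trans (Finset.sum_le_sum fun j _ => ?_))
      (norm_nonneg _) (by positivity)
  · exact hterm j _ _ (h₁ j s hsa hsb)
  · exact hterm j _ _ (h₂ j s hsa hsb)

lemma exists_norm_LFunction_le {N : ℕ} [NeZero N] (χ : DirichletCharacter ℂ N) :
    ∃ M, ∀ s : ℂ, 2 ≤ s.re → ‖DirichletCharacter.LFunction χ s‖ ≤ M := by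
  have hsum : Summable fun n => ‖LSeries.term (fun n : ℕ => χ n) 2 n‖ :=
    (χ.LSeriesSummable_of_one_lt_re (s := 2) (by norm_num)).norm
  refine ⟨∑' n, ‖LSeries.term (fun n : ℕ => χ n) 2 n‖, fun s hs => ?_⟩
  rw [χ.LFunction_eq_LSeries (by linarith), LSeries]
  exact tsum_of_norm_bounded hsum.hasSum
    fun n => LSeries.norm_term_le_of_re_le_re _ (by simpa using hs) n

/-! ### Complex conjugation -/

lemma Gammaℝ_conj (s : ℂ) : Gammaℝ ((starRingEnd ℂ) s) = (starRingEnd ℂ) (Gammaℝ s) := by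
  have hpi : (Real.pi : ℂ).arg ≠ Real.pi := by
    rw [arg_ofReal_of_nonneg Real.pi_pos.le]; exact Real.pi_ne_zero.symm
  have h := conj_cpow (Real.pi : ℂ) ((starRingEnd ℂ) (-s / 2)) hpi
  rw [conj_conj, conj_ofReal] at h
  have h2 : (starRingEnd ℂ) (2 : ℂ) = 2 := map_ofNat _ 2
  rw [Gammaℝ_def, Gammaℝ_def, map_mul, ← Gamma_conj, ← h]
  simp [h2]

lemma LFunction_inv_conj_of_one_lt {N : ℕ} [NeZero N] (χ : DirichletCharacter ℂ N) {s : ℂ}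
    (hs : 1 < s.re) :
    DirichletCharacter.LFunction χ⁻¹ ((starRingEnd ℂ) s)
      = (starRingEnd ℂ) (DirichletCharacter.LFunction χ s) := by
  rw [DirichletCharacter.LFunction_eq_LSeries _ (by simpa using hs),
    DirichletCharacter.LFunction_eq_LSeries _ hs, LSeries, LSeries, conj_tsum]
  refine tsum_congr fun n => ?_
  rcases eq_or_ne n 0 with rfl | hn
  · simp
  rw [LSeries.term_of_ne_zero hn, LSeries.term_of_ne_zero hn, map_div₀]
  have harg : ((n : ℂ)).arg ≠ Real.pi := by
    rw [natCast_arg]; exact Real.pi_ne_zero.symm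
  have h := conj_cpow (n : ℂ) ((starRingEnd ℂ) s) harg
  rw [conj_conj, conj_natCast] at h
  rw [h, ← MulChar.star_eq_inv, MulChar.star_apply]
  rfl

lemma gammaFactor_inv {N : ℕ} (χ : DirichletCharacter ℂ N) (s : ℂ) :
    DirichletCharacter.gammaFactor χ⁻¹ s = DirichletCharacter.gammaFactor χ s := by
  have h : χ⁻¹.Even ↔ χ.Even := by
    unfold DirichletCharacter.Even
    rw [MulChar.inv_apply_eq_inv']
    exact inv_eq_one
  unfold DirichletCharacter.gammaFactor
  by_cases hχ : χ.Even <;> simp [h, hχ]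

lemma gammaFactor_conj {N : ℕ} (χ : DirichletCharacter ℂ N) (s : ℂ) :
    DirichletCharacter.gammaFactor χ ((starRingEnd ℂ) s)
      = (starRingEnd ℂ) (DirichletCharacter.gammaFactor χ s) := by
  unfold DirichletCharacter.gammaFactor
  split_ifs
  · exact Gammaℝ_conj s
  · rw [← Gammaℝ_conj]; simp

lemma gammaFactor_ne_zero {N : ℕ} (χ : DirichletCharacter ℂ N) {s : ℂ} (hs : 0 < s.re) :
    DirichletCharacter.gammaFactor χ s ≠ 0 := by
  unfold DirichletCharacter.gammaFactor
  split_ifs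
  · exact Gammaℝ_ne_zero_of_re_pos hs
  · exact Gammaℝ_ne_zero_of_re_pos (by simp; linarith)

lemma completedLFunction_eq_gammaFactor_mul {N : ℕ} [NeZero N] (χ : DirichletCharacter ℂ N)
    {s : ℂ} (hs : 0 < s.re) :
    DirichletCharacter.completedLFunction χ s
      = DirichletCharacter.gammaFactor χ s * DirichletCharacter.LFunction χ s := by
  have hs0 : s ≠ 0 := by rintro rfl; simp at hs
  rw [DirichletCharacter.LFunction_eq_completed_div_gammaFactor χ s (Or.inl hs0),
    mul_div_cancel₀ _ (gammaFactor_ne_zero χ hs)]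

/-- Two entire functions that agree in a half-plane are equal. -/
lemma entire_eq_of_eq_of_one_lt_re {f g : ℂ → ℂ} (hf : Differentiable ℂ f)
    (hg : Differentiable ℂ g) (h : ∀ s : ℂ, 1 < s.re → f s = g s) : f = g := by
  refine AnalyticOnNhd.eq_of_eventuallyEq (𝕜 := ℂ) (z₀ := 2) (fun z _ => hf.analyticAt z)
    (fun z _ => hg.analyticAt z) ?_
  have hopen : IsOpen {s : ℂ | 1 < s.re} := isOpen_lt continuous_const continuous_re
  filter_upwards [hopen.mem_nhds (show (1 : ℝ) < (2 : ℂ).re by norm_num)] with s hs using h s hs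

lemma completedLFunction_inv_conj {N : ℕ} [NeZero N] {χ : DirichletCharacter ℂ N} (hχ : χ ≠ 1)
    (s : ℂ) :
    DirichletCharacter.completedLFunction χ⁻¹ ((starRingEnd ℂ) s)
      = (starRingEnd ℂ) (DirichletCharacter.completedLFunction χ s) := by
  have h := entire_eq_of_eq_of_one_lt_re
    (f := fun s => (starRingEnd ℂ)
      (DirichletCharacter.completedLFunction χ⁻¹ ((starRingEnd ℂ) s)))
    (g := DirichletCharacter.completedLFunction χ)
    (fun s => differentiableAt_conj_conj_iff.2
      (DirichletCharacter.differentiable_completedLFunction (inv_ne_one.2 hχ) _))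
    (DirichletCharacter.differentiable_completedLFunction hχ) (fun s hs => by
      have hs0 : 0 < s.re := by linarith
      rw [completedLFunction_eq_gammaFactor_mul _ (by simpa using hs0),
        completedLFunction_eq_gammaFactor_mul _ hs0, LFunction_inv_conj_of_one_lt χ hs,
        gammaFactor_inv, gammaFactor_conj]
      simp)
  rw [← congrFun h s, conj_conj]

/-! ### Growth in the whole plane -/

lemma GrowthOn.union {S₁ S₂ : Set ℂ} {f : ℂ → ℂ} (h₁ : GrowthOn S₁ f) (h₂ : GrowthOn S₂ f) :
    GrowthOn (S₁ ∪ S₂) f := by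
  obtain ⟨C₁, h₁⟩ := h₁
  obtain ⟨C₂, h₂⟩ := h₂
  refine ⟨max C₁ C₂, ?_⟩
  rintro z (hz | hz)
  · refine (h₁ z hz).trans (Real.exp_le_exp.2 ?_)
    gcongr
    exact le_max_left _ _
  · refine (h₂ z hz).trans (Real.exp_le_exp.2 ?_)
    gcongr
    exact le_max_right _ _

lemma GrowthOn.congr {S : Set ℂ} {f g : ℂ → ℂ} (hf : GrowthOn S f) (h : ∀ z ∈ S, f z = g z) :
    GrowthOn S g := by
  obtain ⟨C, hC⟩ := hf
  exact ⟨C, fun z hz => h z hz ▸ hC z hz⟩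

lemma GrowthOn.sub_one {S : Set ℂ} {f : ℂ → ℂ} (hf : GrowthOn S f) :
    GrowthOn S fun z => f z - 1 := by
  obtain ⟨C, hC⟩ := hf
  refine ⟨|C| + 1, fun z hz => (norm_sub_le _ _).trans ?_⟩
  set Y := (1 + ‖z‖) ^ (3 / 2 : ℝ) with hY
  have hY1 : 1 ≤ Y := by linarith [one_add_norm_le_rpow z, norm_nonneg z]
  have h1 : ‖f z‖ ≤ Real.exp (|C| * Y) := (hC z hz).trans (Real.exp_le_exp.2 (by
    gcongr; exact le_abs_self C))
  have h2 : (1 : ℝ) ≤ Real.exp (|C| * Y) := Real.one_le_exp (by positivity)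
  have h3 : (2 : ℝ) ≤ Real.exp Y := by linarith [Real.add_one_le_exp Y]
  rw [norm_one, add_mul, one_mul, Real.exp_add]
  nlinarith

lemma GrowthOn.univ_of_symm {f : ℂ → ℂ} (hf : GrowthOn {z | 0 ≤ z.re} f)
    (hsymm : ∀ z, ‖f (-(starRingEnd ℂ) z)‖ = ‖f z‖) : GrowthOn Set.univ f := by
  obtain ⟨C, hC⟩ := hf
  refine ⟨C, fun z _ => ?_⟩
  rcases le_total 0 z.re with hz | hz
  · exact hC z hz
  · have := hC (-(starRingEnd ℂ) z) (by simpa using hz)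
    rwa [hsymm, norm_neg, norm_conj] at this

lemma growthOn_Gammaℝ_add {a : ℝ} (ha : 1 / 2 ≤ a) :
    GrowthOn {z : ℂ | 3 / 2 ≤ z.re} fun z => Gammaℝ (a + z) := by
  have h1 := growthOn_cpow {z : ℂ | 3 / 2 ≤ z.re} Real.pi_pos (-(a / 2 : ℝ)) (-(1 / 2 : ℝ))
  have h2 := growthOn_Gamma_comp (S := {z : ℂ | 3 / 2 ≤ z.re}) (a := a / 2) (b := 1 / 2)
    (by norm_num) (by linarith) (fun z hz => by
      have : 3 / 2 ≤ z.re := hz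
      linarith)
  refine (h1.mul h2).congr fun z _ => ?_
  rw [Gammaℝ_def]
  congr 2
  · push_cast; ring
  · push_cast; ring

lemma growthOn_gammaFactor {N : ℕ} (χ : DirichletCharacter ℂ N) :
    GrowthOn {z : ℂ | 3 / 2 ≤ z.re} fun z => DirichletCharacter.gammaFactor χ (1 / 2 + z) := by
  unfold DirichletCharacter.gammaFactor
  by_cases hχ : χ.Even
  · refine (growthOn_Gammaℝ_add (a := 1 / 2) le_rfl).congr fun z _ => ?_
    simp [hχ]
  · refine (growthOn_Gammaℝ_add (a := 3 / 2) (by norm_num)).congr fun z _ => ?_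
    rw [if_neg hχ]
    congr 1
    push_cast; ring

lemma setOf_re_nonneg_eq : {z : ℂ | 0 ≤ z.re} = {z | 0 ≤ z.re ∧ z.re ≤ 3 / 2} ∪ {z | 3 / 2 ≤ z.re} := by
  ext z
  simp only [Set.mem_ofPred_eq, Set.mem_union]
  constructor
  · intro h
    rcases le_total z.re (3 / 2) with h1 | h1
    · exact Or.inl ⟨h, h1⟩
    · exact Or.inr h1
  · rintro (h | h)
    · exact h.1
    · linarith

end LowZeros

end

section

open Complex Metric Filter Topology MeasureTheory

namespace LowZeros

/-! ### The completed functions centred at the critical point -/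

lemma differentiableAt_gammaFactor {N : ℕ} {χ : DirichletCharacter ℂ N} {s : ℂ} (hs : 0 < s.re) :
    DifferentiableAt ℂ (DirichletCharacter.gammaFactor χ) s := by
  by_cases hχ : χ.Even
  · have : DirichletCharacter.gammaFactor χ = Gammaℝ := funext hχ.gammaFactor_def
    rw [this]
    exact differentiableAt_Gammaℝ hs
  · have : DirichletCharacter.gammaFactor χ = fun s => Gammaℝ (s + 1) := by
      ext s; simp [DirichletCharacter.gammaFactor, hχ]
    rw [this]
    exact DifferentiableAt.comp (g := Gammaℝ) (f := fun z => z + 1) s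
      (differentiableAt_Gammaℝ (by simp; linarith)) (by fun_prop)

/-! ### Completed Dirichlet L-functions -/

section Char

variable {N : ℕ} [NeZero N] {χ : DirichletCharacter ℂ N}

/-- The completed `L`-function `Λ(1/2 + s, χ)`, with the conductor included. -/
noncomputable def xiChar (χ : DirichletCharacter ℂ N) (s : ℂ) : ℂ :=
  (N : ℂ) ^ (s / 2) * DirichletCharacter.completedLFunction χ (1 / 2 + s)

lemma ne_one_of_isPrimitive (hN : 1 < N) (hχ : χ.IsPrimitive) : χ ≠ 1 := by
  rintro rfl
  rw [DirichletCharacter.isPrimitive_def, DirichletCharacter.conductor_one] at hχ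
  omega

lemma natCast_ne_zero_complex (N : ℕ) [NeZero N] : (N : ℂ) ≠ 0 := by
  exact_mod_cast NeZero.ne N

lemma natCast_cpow_ne_zero (N : ℕ) [NeZero N] (s : ℂ) : (N : ℂ) ^ s ≠ 0 := by
  simp [cpow_eq_zero_iff, natCast_ne_zero_complex N]

lemma differentiable_natCast_cpow (N : ℕ) [NeZero N] :
    Differentiable ℂ fun s : ℂ => (N : ℂ) ^ (s / 2) := fun s =>
  DifferentiableAt.const_cpow (by fun_prop) (Or.inl (natCast_ne_zero_complex N))

lemma differentiable_xiChar (hχ : χ ≠ 1) : Differentiable ℂ (xiChar χ) := by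
  refine (differentiable_natCast_cpow N).mul ?_
  exact (DirichletCharacter.differentiable_completedLFunction hχ).comp (by fun_prop)

lemma xiChar_eq {s : ℂ} (hs : -(1 / 2) < s.re) :
    xiChar χ s = (N : ℂ) ^ (s / 2) * (DirichletCharacter.gammaFactor χ (1 / 2 + s)
      * DirichletCharacter.LFunction χ (1 / 2 + s)) := by
  rw [xiChar, completedLFunction_eq_gammaFactor_mul χ (by simp; linarith)]

lemma xiChar_eq_zero_iff {s : ℂ} (hs : -(1 / 2) < s.re) :
    xiChar χ s = 0 ↔ DirichletCharacter.LFunction χ (1 / 2 + s) = 0 := by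
  have hg := gammaFactor_ne_zero χ (show 0 < (1 / 2 + s).re by simp; linarith)
  rw [xiChar_eq hs, mul_eq_zero, mul_eq_zero, or_iff_right (natCast_cpow_ne_zero N _),
    or_iff_right hg]

lemma xiChar_one_ne_zero (hχ : χ ≠ 1) : xiChar χ 1 ≠ 0 := by
  rw [Ne, xiChar_eq_zero_iff (by simp; norm_num)]
  exact DirichletCharacter.LFunction_ne_zero_of_one_le_re χ (Or.inl hχ) (by simp)

/-- The functional equation and conjugation give the symmetry up to the factor `r = ‖rootNumber χ‖`.
Reflecting twice at a point where the function is nonzero forces `r² = 1`, so no evaluation of Gauss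
sums is needed. -/
lemma norm_xiChar_symm (hN : 1 < N) (hχ : χ.IsPrimitive) (z : ℂ) :
    ‖xiChar χ (-(starRingEnd ℂ) z)‖ = ‖xiChar χ z‖ := by
  have hχ1 := ne_one_of_isPrimitive hN hχ
  have hNpos : (0 : ℝ) < N := by exact_mod_cast NeZero.pos N
  set r := ‖DirichletCharacter.rootNumber χ‖ with hr
  have key : ∀ z, ‖xiChar χ (-(starRingEnd ℂ) z)‖ = r * ‖xiChar χ z‖ := by
    intro z
    have h1 : 1 / 2 + -(starRingEnd ℂ) z = 1 - (starRingEnd ℂ) (1 / 2 + z) := by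
      have h2 : (starRingEnd ℂ) (2 : ℂ) = 2 := map_ofNat _ 2
      simp only [map_add, map_div₀, map_one, h2]
      ring
    rw [xiChar, h1, hχ.completedLFunction_one_sub, completedLFunction_inv_conj hχ1, xiChar]
    simp only [norm_mul, norm_natCast_cpow_of_pos (NeZero.pos N), norm_conj]
    rw [← hr]
    have e : (N : ℝ) ^ (-(starRingEnd ℂ) z / 2).re
        * (N : ℝ) ^ ((starRingEnd ℂ) (1 / 2 + z) - 1 / 2).re = (N : ℝ) ^ (z / 2).re := by
      rw [← Real.rpow_add hNpos]
      congr 1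
      simp
      ring
    rw [← e]
    ring
  have hr2 : r * r = 1 := by
    have h1 := key (-(starRingEnd ℂ) 1)
    rw [key 1] at h1
    have h2 : -(starRingEnd ℂ) (-(starRingEnd ℂ) (1 : ℂ)) = 1 := by simp
    rw [h2] at h1
    have h3 : ‖xiChar χ 1‖ ≠ 0 := norm_ne_zero_iff.2 (xiChar_one_ne_zero hχ1)
    have : r * r * ‖xiChar χ 1‖ = 1 * ‖xiChar χ 1‖ := by linarith
    exact mul_right_cancel₀ h3 this
  have hr1 : r = 1 := by nlinarith [norm_nonneg (DirichletCharacter.rootNumber χ)]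
  rw [key, hr1, one_mul]

/-- To the right of the axis, GRH covers `Re < 1` and nonvanishing of `L` covers `Re ≥ 1`; the
symmetry of the modulus transfers this to the left. -/
lemma re_eq_zero_of_xiChar_eq_zero (hGRH : GRH) (hN : 1 < N) (hχ : χ.IsPrimitive) {z : ℂ}
    (hz : xiChar χ z = 0) : z.re = 0 := by
  have hχ1 := ne_one_of_isPrimitive hN hχ
  have main : ∀ w : ℂ, 0 ≤ w.re → xiChar χ w = 0 → w.re = 0 := by
    intro w hw h0
    rw [xiChar_eq_zero_iff (by linarith)] at h0
    have hlt : (1 / 2 + w).re < 1 := by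
      by_contra h
      exact DirichletCharacter.LFunction_ne_zero_of_one_le_re χ (Or.inl hχ1) (not_lt.1 h) h0
    have := hGRH N χ (1 / 2 + w) ⟨by simp; linarith, hlt, h0⟩
    simp at this
    linarith
  rcases le_total 0 z.re with h | h
  · exact main z h hz
  · have h2 := main (-(starRingEnd ℂ) z) (by simpa using h)
      (norm_eq_zero.1 (by rw [norm_xiChar_symm hN hχ, hz, norm_zero]))
    simpa using h2

/-- By symmetry the right half-plane suffices. In a strip the completed function is bounded as a
Mellin transform; further right `L` is bounded and the Gamma factor governs the growth. -/
lemma growthOn_xiChar (hN : 1 < N) (hχ : χ.IsPrimitive) : GrowthOn Set.univ (xiChar χ) := by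
  have hχ1 := ne_one_of_isPrimitive hN hχ
  have hNpos : (0 : ℝ) < N := by exact_mod_cast NeZero.pos N
  have hcp : ∀ S, GrowthOn S fun z : ℂ => (N : ℂ) ^ (z / 2) := fun S =>
    (growthOn_cpow S hNpos 0 (1 / 2)).congr fun z _ => by
      rw [ofReal_natCast, zero_add, one_div_mul_eq_div]
  refine GrowthOn.univ_of_symm ?_ (norm_xiChar_symm hN hχ)
  rw [setOf_re_nonneg_eq]
  refine GrowthOn.union ?_ ?_
  · obtain ⟨M, hM⟩ := exists_norm_completedLFunction_le hN.ne' hχ1 (1 / 2) 2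
    refine (hcp _).mul (growthOn_of_bounded (M := M) fun z hz => hM _ ?_ ?_)
    · have := hz.1; simp; linarith
    · have := hz.2; simp; linarith
  · obtain ⟨M, hM⟩ := exists_norm_LFunction_le χ
    refine ((hcp _).mul ((growthOn_gammaFactor χ).mul (growthOn_of_bounded (M := M)
      fun z hz => hM (1 / 2 + z) ?_))).congr fun z hz => ?_
    · have : 3 / 2 ≤ z.re := hz
      simp; linarith
    · have : 3 / 2 ≤ z.re := hz
      rw [xiChar_eq (by linarith)]

lemma logDeriv_const_add {f : ℂ → ℂ} (a s : ℂ) :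
    logDeriv (fun z => f (a + z)) s = logDeriv f (a + s) := by
  rw [logDeriv_apply, logDeriv_apply, deriv_comp_const_add]

lemma logDeriv_xiChar (hχ : χ ≠ 1) {s : ℂ} (hs : 1 / 2 < s.re) :
    logDeriv (xiChar χ) s = (Real.log N : ℂ) / 2
      + logDeriv (DirichletCharacter.gammaFactor χ) (1 / 2 + s)
      + logDeriv (DirichletCharacter.LFunction χ) (1 / 2 + s) := by
  have hs1 : 1 < (1 / 2 + s).re := by simp; linarith
  have hev : xiChar χ =ᶠ[𝓝 s] fun z => (N : ℂ) ^ (z / 2) *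
      (DirichletCharacter.gammaFactor χ (1 / 2 + z)
        * DirichletCharacter.LFunction χ (1 / 2 + z)) := by
    have hopen : IsOpen {z : ℂ | 1 / 2 < z.re} := isOpen_lt continuous_const continuous_re
    filter_upwards [hopen.mem_nhds hs] with z hz
    have : 1 / 2 < z.re := hz
    exact xiChar_eq (by linarith)
  have hd1 : HasDerivAt (fun z : ℂ => (N : ℂ) ^ (z / 2))
      ((N : ℂ) ^ (s / 2) * log N * (1 / 2)) s :=
    ((hasDerivAt_id s).div_const 2).const_cpow (Or.inl (natCast_ne_zero_complex N))
  have hdg : DifferentiableAt ℂ (fun z => DirichletCharacter.gammaFactor χ (1 / 2 + z)) s :=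
    (differentiableAt_gammaFactor (s := 1 / 2 + s) (by linarith)).comp s (by fun_prop)
  have hdL : DifferentiableAt ℂ (fun z => DirichletCharacter.LFunction χ (1 / 2 + z)) s :=
    (DirichletCharacter.differentiable_LFunction hχ _).comp s (by fun_prop)
  have hg0 := gammaFactor_ne_zero χ (s := 1 / 2 + s) (by linarith)
  have hL0 := DirichletCharacter.LFunction_ne_zero_of_one_le_re χ (Or.inl hχ) hs1.le
  rw [(logDeriv_congr_nhds hev).self_of_nhds,
    logDeriv_mul (f := fun z => (N : ℂ) ^ (z / 2)) (g := fun z =>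
      DirichletCharacter.gammaFactor χ (1 / 2 + z) * DirichletCharacter.LFunction χ (1 / 2 + z)) s
      (natCast_cpow_ne_zero N _) (mul_ne_zero hg0 hL0) hd1.differentiableAt (hdg.mul hdL),
    logDeriv_mul (f := fun z => DirichletCharacter.gammaFactor χ (1 / 2 + z))
      (g := fun z => DirichletCharacter.LFunction χ (1 / 2 + z)) s hg0 hL0 hdg hdL, logDeriv_const_add, logDeriv_const_add, ← add_assoc]
  congr 2
  rw [logDeriv_apply, hd1.deriv, ← natCast_log]
  have := natCast_cpow_ne_zero N (s / 2)
  field_simp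

lemma analyticOrderNatAt_xiChar (hχ : χ ≠ 1) {s : ℂ} (hs : -(1 / 2) < s.re) :
    analyticOrderNatAt (xiChar χ) s
      = analyticOrderNatAt (DirichletCharacter.LFunction χ) (1 / 2 + s) := by
  have hopen : IsOpen {z : ℂ | -(1 / 2) < z.re} := isOpen_lt continuous_const continuous_re
  set U : ℂ → ℂ := fun z => (N : ℂ) ^ (z / 2) * DirichletCharacter.gammaFactor χ (1 / 2 + z)
    with hU
  have hUd : DifferentiableOn ℂ U {z : ℂ | -(1 / 2) < z.re} := fun z hz => by
    have hz' : -(1 / 2) < z.re := hz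
    exact ((differentiable_natCast_cpow N z).mul
      ((differentiableAt_gammaFactor (s := 1 / 2 + z) (by simp; linarith)).comp z
        (by fun_prop))).differentiableWithinAt
  have hUan : AnalyticAt ℂ U s := hUd.analyticAt (hopen.mem_nhds hs)
  have hU0 : U s ≠ 0 := mul_ne_zero (natCast_cpow_ne_zero N _)
    (gammaFactor_ne_zero χ (by simp; linarith))
  have hLd := DirichletCharacter.differentiable_LFunction hχ
  have hLan : AnalyticAt ℂ (fun z => DirichletCharacter.LFunction χ (1 / 2 + z)) s :=
    (hLd.comp (by fun_prop : Differentiable ℂ fun z : ℂ => 1 / 2 + z)).analyticAt s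
  have hev : xiChar χ =ᶠ[𝓝 s] U * fun z => DirichletCharacter.LFunction χ (1 / 2 + z) := by
    filter_upwards [hopen.mem_nhds hs] with z hz
    rw [xiChar_eq hz, Pi.mul_apply]
    simp only [hU]
    ring
  have hcomp : analyticOrderAt (fun z => DirichletCharacter.LFunction χ (1 / 2 + z)) s
      = analyticOrderAt (DirichletCharacter.LFunction χ) (1 / 2 + s) := by
    have hgd : HasDerivAt (fun z : ℂ => 1 / 2 + z) 1 s := (hasDerivAt_id s).const_add _
    exact analyticOrderAt_comp_of_deriv_ne_zero (f := DirichletCharacter.LFunction χ)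
      (g := fun z : ℂ => 1 / 2 + z) (by fun_prop) (by rw [hgd.deriv]; exact one_ne_zero)
  rw [analyticOrderNatAt, analyticOrderNatAt, analyticOrderAt_congr hev,
    analyticOrderAt_mul hUan hLan, (hUan.analyticOrderAt_eq_zero).2 hU0, zero_add, hcomp]

end Char

/-! ### The Riemann zeta function -/

/-- The Riemann `ξ`-function `-s(1 - s)Λ(s)`, up to a sign, centred at `1 / 2`. -/
noncomputable def xiZeta (s : ℂ) : ℂ :=
  (1 / 2 + s) * (1 / 2 - s) * completedRiemannZeta₀ (1 / 2 + s) - 1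

lemma differentiable_xiZeta : Differentiable ℂ xiZeta := by
  unfold xiZeta
  have h : Differentiable ℂ fun s : ℂ => completedRiemannZeta₀ (1 / 2 + s) :=
    differentiable_completedZeta₀.comp (by fun_prop)
  fun_prop

lemma xiZeta_eq {s : ℂ} (hs : -(1 / 2) < s.re) (hs1 : s ≠ 1 / 2) :
    xiZeta s = (1 / 2 + s) * (1 / 2 - s) * (Gammaℝ (1 / 2 + s) * riemannZeta (1 / 2 + s)) := by
  have hre : 0 < (1 / 2 + s).re := by simp; linarith
  have h0 : 1 / 2 + s ≠ 0 := by intro h; rw [h] at hre; simp at hre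
  have h1 : 1 / 2 - s ≠ 0 := sub_ne_zero.2 hs1.symm
  rw [riemannZeta_def_of_ne_zero h0, mul_div_cancel₀ _ (Gammaℝ_ne_zero_of_re_pos hre),
    completedRiemannZeta_eq, xiZeta]
  have h2 : 1 - (1 / 2 + s) = 1 / 2 - s := by ring
  rw [h2]
  generalize completedRiemannZeta₀ (1 / 2 + s) = w
  have e1 : (1 / 2 + s) * (1 / (1 / 2 + s)) = 1 := mul_one_div_cancel h0
  have e2 : (1 / 2 - s) * (1 / (1 / 2 - s)) = 1 := mul_one_div_cancel h1
  linear_combination (1 / 2 - s) * e1 + (1 / 2 + s) * e2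

lemma xiZeta_half : xiZeta (1 / 2) = -1 := by
  simp [xiZeta]

lemma xiZeta_neg (s : ℂ) : xiZeta (-s) = xiZeta s := by
  rw [xiZeta, xiZeta, ← completedRiemannZeta₀_one_sub]
  rw [show 1 - (1 / 2 + -s) = 1 / 2 + s by ring]
  ring

lemma xiZeta_conj (s : ℂ) : xiZeta ((starRingEnd ℂ) s) = (starRingEnd ℂ) (xiZeta s) := by
  have h2 : (starRingEnd ℂ) (2 : ℂ) = 2 := map_ofNat _ 2
  have h := entire_eq_of_eq_of_one_lt_re (f := fun s => (starRingEnd ℂ) (xiZeta ((starRingEnd ℂ) s)))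
    (g := xiZeta) (fun s => differentiableAt_conj_conj_iff.2 (differentiable_xiZeta _))
    differentiable_xiZeta (fun s hs => by
      have hne : ∀ z : ℂ, 1 < z.re → z ≠ 1 / 2 := by
        rintro z hz rfl; norm_num at hz
      have hc : (1 / 2 + (starRingEnd ℂ) s) = (starRingEnd ℂ) (1 / 2 + s) := by simp [h2]
      rw [xiZeta_eq (by simp; linarith) (hne _ (by simpa using hs)),
        xiZeta_eq (by linarith) (hne _ hs), hc, Gammaℝ_conj, riemannZeta_conj]
      simp [h2])
  rw [← congrFun h s, conj_conj]

lemma norm_xiZeta_symm (z : ℂ) : ‖xiZeta (-(starRingEnd ℂ) z)‖ = ‖xiZeta z‖ := by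
  rw [xiZeta_neg, xiZeta_conj, norm_conj]

lemma riemannZeta_eq_zero_of_xiZeta_eq_zero {s : ℂ} (hs : 0 ≤ s.re) (h : xiZeta s = 0) :
    riemannZeta (1 / 2 + s) = 0 := by
  have hs1 : s ≠ 1 / 2 := by
    rintro rfl
    rw [xiZeta_half] at h
    norm_num at h
  have hre : 0 < (1 / 2 + s).re := by simp; linarith
  have h0 : 1 / 2 + s ≠ 0 := by intro h; rw [h] at hre; simp at hre
  rw [xiZeta_eq (by linarith) hs1] at h
  have := Gammaℝ_ne_zero_of_re_pos hre
  rw [mul_eq_zero, mul_eq_zero, mul_eq_zero, or_iff_right this] at h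
  exact h.resolve_left (not_or.2 ⟨h0, sub_ne_zero.2 hs1.symm⟩)

lemma xiZeta_one_ne_zero : xiZeta 1 ≠ 0 := fun h =>
  riemannZeta_ne_zero_of_one_le_re (by simp)
    (riemannZeta_eq_zero_of_xiZeta_eq_zero (by simp) h)

lemma re_eq_zero_of_xiZeta_eq_zero (hGRH : GRH) {z : ℂ} (hz : xiZeta z = 0) : z.re = 0 := by
  have main : ∀ w : ℂ, 0 ≤ w.re → xiZeta w = 0 → w.re = 0 := by
    intro w hw h0
    have h1 := riemannZeta_eq_zero_of_xiZeta_eq_zero hw h0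
    have hlt : (1 / 2 + w).re < 1 := by
      by_contra h
      exact riemannZeta_ne_zero_of_one_le_re (not_lt.1 h) h1
    -- The character of level one has L-function `ζ`, so GRH as stated contains the Riemann
    -- hypothesis.
    have := hGRH 1 1 (1 / 2 + w) ⟨by simp; linarith, hlt, by
      rw [DirichletCharacter.LFunction_modOne_eq]; exact h1⟩
    simp at this
    linarith
  rcases le_total 0 z.re with h | h
  · exact main z h hz
  · have h2 := main (-z) (by simpa using h) (by rw [xiZeta_neg, hz])
    simpa using h2

lemma growthOn_xiZeta : GrowthOn Set.univ xiZeta := by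
  refine GrowthOn.univ_of_symm ?_ norm_xiZeta_symm
  rw [setOf_re_nonneg_eq]
  have hpoly : ∀ S, GrowthOn S fun z : ℂ => (1 / 2 + z) * (1 / 2 - z) := fun S =>
    (growthOn_add_const S _).mul (growthOn_const_sub S _)
  refine GrowthOn.union ?_ ?_
  · obtain ⟨M, hM⟩ := exists_norm_completedHurwitzZetaEven₀_le 0 (1 / 2) 2
    refine ((hpoly _).mul (growthOn_of_bounded (M := M) fun z hz => hM (1 / 2 + z) ?_ ?_)).sub_one
    · have := hz.1; simp; linarith
    · have := hz.2; simp; linarith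
  · obtain ⟨M, hM⟩ := exists_norm_LFunction_le (1 : DirichletCharacter ℂ 1)
    refine ((hpoly _).mul ((growthOn_Gammaℝ_add (a := 1 / 2) le_rfl).mul
      (growthOn_of_bounded (M := M) fun z hz => hM (1 / 2 + z) ?_))).congr fun z hz => ?_
    · have : 3 / 2 ≤ z.re := hz
      simp; linarith
    · have : 3 / 2 ≤ z.re := hz
      rw [xiZeta_eq (by linarith) (by rintro rfl; norm_num at this),
        DirichletCharacter.LFunction_modOne_eq]
      push_cast
      rfl

lemma logDeriv_xiZeta {s : ℂ} (hs : 1 / 2 < s.re) :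
    logDeriv xiZeta s = 1 / (1 / 2 + s) + 1 / (s - 1 / 2) + logDeriv Gammaℝ (1 / 2 + s)
      + logDeriv riemannZeta (1 / 2 + s) := by
  have hs1 : 1 < (1 / 2 + s).re := by simp; linarith
  have hopen : IsOpen {z : ℂ | 1 / 2 < z.re} := isOpen_lt continuous_const continuous_re
  have hne : ∀ z : ℂ, 1 / 2 < z.re → z ≠ 1 / 2 := by
    rintro z hz rfl; norm_num at hz
  have hev : xiZeta =ᶠ[𝓝 s] fun z => ((1 / 2 + z) * (1 / 2 - z)) *
      (Gammaℝ (1 / 2 + z) * riemannZeta (1 / 2 + z)) := by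
    filter_upwards [hopen.mem_nhds hs] with z hz
    have : 1 / 2 < z.re := hz
    exact xiZeta_eq (by linarith) (hne z hz)
  have h0 : 1 / 2 + s ≠ 0 := by intro h; rw [h] at hs1; norm_num at hs1
  have h1 : 1 / 2 - s ≠ 0 := sub_ne_zero.2 (hne s hs).symm
  have hdg : DifferentiableAt ℂ (fun z => Gammaℝ (1 / 2 + z)) s :=
    (differentiableAt_Gammaℝ (s := 1 / 2 + s) (by linarith)).comp s (by fun_prop)
  have hdL : DifferentiableAt ℂ (fun z => riemannZeta (1 / 2 + z)) s :=
    (differentiableAt_riemannZeta (s := 1 / 2 + s)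
      (by intro h; rw [h] at hs1; norm_num at hs1)).comp s (by fun_prop)
  have hg0 := Gammaℝ_ne_zero_of_re_pos (s := 1 / 2 + s) (by linarith)
  have hL0 := riemannZeta_ne_zero_of_one_le_re hs1.le
  rw [(logDeriv_congr_nhds hev).self_of_nhds,
    logDeriv_mul (f := fun z => (1 / 2 + z) * (1 / 2 - z))
      (g := fun z => Gammaℝ (1 / 2 + z) * riemannZeta (1 / 2 + z)) s (mul_ne_zero h0 h1)
      (mul_ne_zero hg0 hL0) (by fun_prop) (hdg.mul hdL),
    logDeriv_mul (f := fun z => Gammaℝ (1 / 2 + z)) (g := fun z => riemannZeta (1 / 2 + z)) s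
      hg0 hL0 hdg hdL,
    logDeriv_mul (f := fun z : ℂ => 1 / 2 + z) (g := fun z => 1 / 2 - z) s h0 h1 (by fun_prop)
      (by fun_prop),
    logDeriv_const_add, logDeriv_const_add, ← add_assoc]
  congr 3
  · rw [logDeriv_apply, deriv_const_add]; simp
  · rw [logDeriv_apply, deriv_const_sub]
    have : s - 1 / 2 ≠ 0 := sub_ne_zero.2 (hne s hs)
    simp only [deriv_id'']
    rw [← neg_sub, div_neg, neg_div, neg_neg]

end LowZeros

end

section

open Complex Metric Filter Topology MeasureTheory

namespace LowZeros

/-! ### Termwise integration -/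

lemma integrable_and_hasSum_integral_of_hasSum {α ι E : Type*} [MeasurableSpace α] {μ : Measure α}
    [Countable ι] [NormedAddCommGroup E] [NormedSpace ℝ E] {F : ι → α → E} {G : α → E}
    (hF : ∀ i, Integrable (F i) μ) (hsum : Summable fun i => ∫ a, ‖F i a‖ ∂μ)
    (hG : ∀ a, HasSum (fun i => F i a) (G a)) :
    Integrable G μ ∧ HasSum (fun i => ∫ a, F i a ∂μ) (∫ a, G a ∂μ) := by
  have hGeq : G = fun a => ∑' i, F i a := funext fun a => (hG a).tsum_eq.symm
  constructor
  · refine ⟨aestronglyMeasurable_of_tendsto_ae (u := atTop)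
      (f := fun (s : Finset ι) a => ∑ i ∈ s, F i a)
      (fun s => (integrable_finsetSum s fun i _ => hF i).aestronglyMeasurable)
      (Eventually.of_forall fun a => hG a), ?_⟩
    have hle : ∀ a, ‖G a‖ₑ ≤ ∑' i, ‖F i a‖ₑ := by
      intro a
      refine le_of_tendsto (f := fun s : Finset ι => ‖∑ i ∈ s, F i a‖ₑ) (x := atTop)
        ((continuous_enorm.tendsto _).comp (hG a)) (Eventually.of_forall fun s => ?_)
      exact (enorm_sum_le _ _).trans (ENNReal.sum_le_tsum s)
    refine (lintegral_mono hle).trans_lt ?_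
    rw [lintegral_tsum fun i => (hF i).aestronglyMeasurable.enorm]
    have h1 : ∀ i, ∫⁻ a, ‖F i a‖ₑ ∂μ = ENNReal.ofReal (∫ a, ‖F i a‖ ∂μ) := fun i => by
      rw [ofReal_integral_norm_eq_lintegral_enorm (hF i)]
    simp_rw [h1]
    rw [← ENNReal.ofReal_tsum_of_nonneg (fun i => integral_nonneg fun a => norm_nonneg _) hsum]
    exact ENNReal.ofReal_lt_top
  · rw [hGeq]
    exact hasSum_integral_of_summable_integral_norm hF hsum

/-! ### Integrating series against a kernel with quadratic decay -/

section Kernel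

variable {A : ℝ → ℝ} {C : ℝ}

/-- Two bumps whose centres are `x/(2π)` apart cannot both be large: `1 + x² ≤ 80 (a + b)` for the
two denominators, with `80` an upper bound for `2(2π)²`. Integrated over `w`, this gives each zero a
contribution `O(1/(1 + γ²))`. -/
lemma one_div_mul_one_add_sq_le (w x : ℝ) :
    1 / (1 + w ^ 2) * (1 / (1 + (2 * Real.pi * w - x) ^ 2))
      ≤ 80 / (1 + x ^ 2) * ((1 + w ^ 2)⁻¹ + (1 + (2 * Real.pi * w - x) ^ 2)⁻¹) := by
  set a := 1 + w ^ 2 with ha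
  set b := 1 + (2 * Real.pi * w - x) ^ 2 with hb
  have ha0 : 0 < a := by positivity
  have hb0 : 0 < b := by positivity
  have hx : 1 + x ^ 2 ≤ 80 * (a + b) := by
    have h1 : (2 * Real.pi * w) ^ 2 ≤ 40 * w ^ 2 := by
      have := Real.pi_lt_d2
      have := Real.pi_pos
      nlinarith [mul_nonneg (sq_nonneg w) (show 0 ≤ 40 - 4 * Real.pi ^ 2 by nlinarith)]
    have h2 : x ^ 2 ≤ 2 * (2 * Real.pi * w) ^ 2 + 2 * (2 * Real.pi * w - x) ^ 2 := by
      nlinarith [sq_nonneg (2 * (2 * Real.pi * w) - x)]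
    nlinarith [sq_nonneg (2 * Real.pi * w - x), sq_nonneg w]
  have hx0 : 0 < 1 + x ^ 2 := by positivity
  have e1 : 1 / a * (1 / b) = 1 / (a * b) := by field_simp
  have e2 : 80 / (1 + x ^ 2) * (a⁻¹ + b⁻¹) = 80 * (a + b) / ((1 + x ^ 2) * (a * b)) := by
    field_simp
    ring
  rw [e1, e2, div_le_div_iff₀ (by positivity) (by positivity)]
  nlinarith [mul_pos ha0 hb0]

lemma integrable_inv_one_add_sq_two_pi (x : ℝ) :
    Integrable fun w : ℝ => (1 + (2 * Real.pi * w - x) ^ 2)⁻¹ :=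
  (integrable_inv_one_add_sq.comp_sub_right x).comp_mul_left' (by positivity)

lemma integral_inv_one_add_sq_two_pi (x : ℝ) :
    ∫ w : ℝ, (1 + (2 * Real.pi * w - x) ^ 2)⁻¹ = (2 * Real.pi)⁻¹ * ∫ w : ℝ, (1 + w ^ 2)⁻¹ := by
  rw [Measure.integral_comp_mul_left (fun y => (1 + (y - x) ^ 2)⁻¹),
    integral_sub_right_eq_self (fun y : ℝ => (1 + y ^ 2)⁻¹), abs_of_pos (by positivity),
    smul_eq_mul]

lemma re_one_div_one_add_sub (w : ℝ) {ρ : ℂ} (hρ : ρ.re = 0) :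
    (1 / (1 + 2 * Real.pi * w * I - ρ)).re = 1 / (1 + (2 * Real.pi * w - ρ.im) ^ 2) := by
  have h1 : (1 + 2 * Real.pi * w * I - ρ).re = 1 := by simp [hρ]
  have h2 : (1 + 2 * Real.pi * w * I - ρ).im = 2 * Real.pi * w - ρ.im := by simp
  rw [one_div, inv_re, normSq_apply, h1, h2]
  ring_nf

lemma integrable_kernel_mul_of_bounded (hA : Continuous A) (hC : ∀ w, |A w| ≤ C / (1 + w ^ 2))
    {k : ℝ → ℂ} (hk : Continuous k) {b : ℝ} (hb : ∀ w, ‖k w‖ ≤ b) :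
    Integrable fun w => (A w : ℂ) * k w :=
  (integrable_of_abs_le_div_one_add_sq hA hC).ofReal.mul_bdd hk.aestronglyMeasurable
    (Eventually.of_forall hb)

lemma integrable_and_hasSum_zeros {f : ℂ → ℂ} (hf : Differentiable ℂ f) (h1 : f 1 ≠ 0)
    (hzero : ∀ z, f z = 0 → z.re = 0)
    (hsymm : ∀ z, ‖f (-(starRingEnd ℂ) z)‖ = ‖f z‖) (hgrowth : GrowthOn Set.univ f)
    (hA : Continuous A) (hC : ∀ w, |A w| ≤ C / (1 + w ^ 2)) :
    Integrable (fun w => A w * (logDeriv f (1 + 2 * Real.pi * w * I)).re) ∧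
    HasSum (fun ρ : ℂ => analyticOrderNatAt f ρ *
        ∫ w, A w * (1 / (1 + 2 * Real.pi * w * I - ρ)).re)
      (∫ w, A w * (logDeriv f (1 + 2 * Real.pi * w * I)).re) := by
  obtain ⟨D, hD⟩ := hgrowth
  have hsum : ∀ s : ℂ, 0 < s.re → HasSum
      (fun ρ : {z | f z = 0} => analyticOrderNatAt f ρ * (1 / (s - ρ)).re) (logDeriv f s).re := by
    intro s hs
    have h := hasSum_re_logDeriv hf h1 hzero hsymm (fun z => hD z trivial) hs
    refine (hasSum_subtype_iff_of_support_subset (s := {z | f z = 0}) (fun ρ hρ => ?_)).2 h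
    by_contra h0
    apply hρ
    have : analyticOrderAt f ρ = 0 := ((hf.analyticAt ρ).analyticOrderAt_eq_zero).2 h0
    simp [analyticOrderNatAt, this]
  have : Countable {z | f z = 0} := (countable_zeros hf h1).to_subtype
  set J : ℝ := ∫ w : ℝ, (1 + w ^ 2)⁻¹ with hJ
  set F : {z | f z = 0} → ℝ → ℝ := fun ρ w =>
    A w * (analyticOrderNatAt f ρ * (1 / (1 + 2 * Real.pi * w * I - ρ)).re) with hF
  have hC0 : 0 ≤ C := by
    have := (abs_nonneg _).trans (hC 0)
    simpa using this
  have hFle : ∀ ρ w, ‖F ρ w‖ ≤ (C * 80) * (analyticOrderNatAt f ρ * (1 / (1 + (ρ : ℂ).im ^ 2)))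
      * ((1 + w ^ 2)⁻¹ + (1 + (2 * Real.pi * w - (ρ : ℂ).im) ^ 2)⁻¹) := by
    intro ρ w
    have h2 := re_one_div_one_add_sub w (hzero ρ ρ.2)
    simp only [hF]
    rw [h2, Real.norm_eq_abs, abs_mul, abs_of_nonneg (by positivity :
      0 ≤ (analyticOrderNatAt f ρ : ℝ) * (1 / (1 + (2 * Real.pi * w - (ρ : ℂ).im) ^ 2)))]
    calc _ ≤ C / (1 + w ^ 2) * (analyticOrderNatAt f ρ *
          (1 / (1 + (2 * Real.pi * w - (ρ : ℂ).im) ^ 2))) :=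
          mul_le_mul_of_nonneg_right (hC w) (by positivity)
      _ = (C * analyticOrderNatAt f ρ) * (1 / (1 + w ^ 2) *
          (1 / (1 + (2 * Real.pi * w - (ρ : ℂ).im) ^ 2))) := by ring
      _ ≤ (C * analyticOrderNatAt f ρ) * _ :=
          mul_le_mul_of_nonneg_left (one_div_mul_one_add_sq_le w _) (by positivity)
      _ = _ := by ring
  have hbint : ∀ x : ℝ, Integrable fun w : ℝ =>
      (1 + w ^ 2)⁻¹ + (1 + (2 * Real.pi * w - x) ^ 2)⁻¹ := fun x =>
    integrable_inv_one_add_sq.add (integrable_inv_one_add_sq_two_pi x)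
  have hFint : ∀ ρ, Integrable (F ρ) := by
    intro ρ
    refine ((hbint (ρ : ℂ).im).const_mul _).mono' ?_ (Eventually.of_forall (hFle ρ))
    refine Continuous.aestronglyMeasurable ?_
    have : F ρ = fun w => A w * (analyticOrderNatAt f ρ *
        (1 / (1 + (2 * Real.pi * w - (ρ : ℂ).im) ^ 2))) := by
      ext w
      simp only [hF]
      rw [re_one_div_one_add_sub w (hzero ρ ρ.2)]
    rw [this]
    refine hA.mul (continuous_const.mul (continuous_const.div (by fun_prop) fun w => ?_))
    positivity
  have hFsum : Summable fun ρ => ∫ w, ‖F ρ w‖ := by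
    -- The partial fraction expansion at `s = 1` is itself the statement that `∑ 1/(1 + γ²)`
    -- converges.
    have h2 : Summable fun ρ : {z | f z = 0} =>
        (analyticOrderNatAt f ρ : ℝ) * (1 / (1 + (ρ : ℂ).im ^ 2)) := by
      refine (hsum 1 (by simp)).summable.congr fun ρ => ?_
      have := re_one_div_one_add_sub 0 (hzero ρ ρ.2)
      simp only [ofReal_zero, mul_zero, zero_mul, add_zero, zero_sub, neg_sq] at this
      rw [this]
    refine Summable.of_nonneg_of_le (fun ρ => integral_nonneg fun _ => norm_nonneg _) (fun ρ => ?_)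
      (h2.mul_left ((C * 80) * (J + (2 * Real.pi)⁻¹ * J)))
    calc ∫ w, ‖F ρ w‖ ≤ ∫ w, (C * 80) * (analyticOrderNatAt f ρ * (1 / (1 + (ρ : ℂ).im ^ 2)))
            * ((1 + w ^ 2)⁻¹ + (1 + (2 * Real.pi * w - (ρ : ℂ).im) ^ 2)⁻¹) :=
          integral_mono (hFint ρ).norm ((hbint (ρ : ℂ).im).const_mul _) (hFle ρ)
      _ = _ := by
          rw [integral_const_mul, integral_add integrable_inv_one_add_sq
            (integrable_inv_one_add_sq_two_pi _), integral_inv_one_add_sq_two_pi]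
          ring
  obtain ⟨i1, i2⟩ := integrable_and_hasSum_integral_of_hasSum hFint hFsum
    (G := fun w => A w * (logDeriv f (1 + 2 * Real.pi * w * I)).re)
    (fun w => (hsum _ (by simp)).mul_left (A w))
  refine ⟨i1, ?_⟩
  refine (hasSum_subtype_iff_of_support_subset (s := {z | f z = 0}) (fun ρ hρ => ?_)).1 ?_
  · by_contra h0
    apply hρ
    have : analyticOrderAt f ρ = 0 := ((hf.analyticAt ρ).analyticOrderAt_eq_zero).2 h0
    simp [analyticOrderNatAt, this]
  · convert! i2 using 1
    ext ρ
    simp only [Function.comp, hF]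
    rw [← integral_const_mul]
    congr 1
    ext w
    ring

/-- Used for both the prime sum and the Gamma factors: the total never has to be evaluated, since
its sign follows from that of each term after integration. -/
lemma integrable_and_re_integral_nonneg {ι : Type*} [Countable ι] {k : ι → ℝ → ℂ} {G : ℝ → ℂ}
    (hA : Continuous A) (hC : ∀ w, |A w| ≤ C / (1 + w ^ 2))
    (hk : ∀ i, Continuous (k i)) {b : ι → ℝ} (hb : ∀ i w, ‖k i w‖ ≤ b i) (hbs : Summable b)
    (hG : ∀ w, HasSum (fun i => k i w) (G w))
    (hpos : ∀ i, 0 ≤ (∫ w, (A w : ℂ) * k i w).re) :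
    Integrable (fun w => A w * (G w).re) ∧ 0 ≤ ∫ w, A w * (G w).re := by
  have hAi := integrable_of_abs_le_div_one_add_sq hA hC
  have hint : ∀ i, Integrable fun w => (A w : ℂ) * k i w := fun i =>
    integrable_kernel_mul_of_bounded hA hC (hk i) (hb i)
  have hsum : Summable fun i => ∫ w, ‖(A w : ℂ) * k i w‖ := by
    refine Summable.of_nonneg_of_le (fun i => integral_nonneg fun _ => norm_nonneg _) (fun i => ?_)
      (hbs.mul_left (∫ w, |A w|))
    rw [← integral_mul_const]
    refine integral_mono (hint i).norm (hAi.abs.mul_const _) fun w => ?_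
    rw [norm_mul, norm_real, Real.norm_eq_abs]
    exact mul_le_mul_of_nonneg_left (hb i w) (abs_nonneg _)
  obtain ⟨i1, i2⟩ := integrable_and_hasSum_integral_of_hasSum hint hsum
    (G := fun w => (A w : ℂ) * G w) (fun w => (hG w).mul_left _)
  have e : (fun w => A w * (G w).re) = fun w => ((A w : ℂ) * G w).re := by
    ext w; rw [re_ofReal_mul]
  rw [e]
  refine ⟨i1.re, ?_⟩
  have h3 : ∫ w, ((A w : ℂ) * G w).re = (∫ w, (A w : ℂ) * G w).re := integral_re i1
  rw [h3]
  exact (hasSum_re i2).nonneg hpos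

end Kernel

end LowZeros

end

section

open Complex Metric Filter Topology MeasureTheory

namespace LowZeros

/-! ### An explicit inequality for the zeros of an `L`-function -/

section Explicit

variable {g g' g'' : ℝ → ℝ} {T : ℝ}

/-- The Fourier transform of `e ^ |u| g(|u|)`, cut off at `T`. -/
noncomputable def kernel (g : ℝ → ℝ) (T : ℝ) : ℝ → ℝ :=
  cosineTransform (fun u => Real.exp u * g u) T

lemma continuous_kernel (hg : Continuous g) : Continuous (kernel g T) :=
  continuous_cosineTransform (by fun_prop)

lemma exists_abs_kernel_le (hT : 0 ≤ T) (h1 : ∀ u, HasDerivAt g (g' u) u)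
    (h2 : ∀ u, HasDerivAt g' (g'' u) u) (h3 : Continuous g'') (hgT : g T = 0) :
    ∃ C, ∀ w, |kernel g T w| ≤ C / (1 + w ^ 2) := by
  have hg : Continuous g := continuous_iff_continuousAt.2 fun u => (h1 u).continuousAt
  have hg' : Continuous g' := continuous_iff_continuousAt.2 fun u => (h2 u).continuousAt
  obtain ⟨C, -, hC⟩ := exists_abs_cosineTransform_le (p := fun u => Real.exp u * g u)
    (p' := fun u => Real.exp u * g u + Real.exp u * g' u)
    (p'' := fun u => (Real.exp u * g u + Real.exp u * g' u)
      + (Real.exp u * g' u + Real.exp u * g'' u)) hT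
    (fun u => (Real.hasDerivAt_exp u).mul (h1 u))
    (fun u => ((Real.hasDerivAt_exp u).mul (h1 u)).add ((Real.hasDerivAt_exp u).mul (h2 u)))
    (by fun_prop) (by simp [hgT])
  exact ⟨C, hC⟩

lemma norm_one_div_le_of_le_re {z : ℂ} {a : ℝ} (ha : 0 < a) (hz : a ≤ z.re) :
    ‖1 / z‖ ≤ 1 / a := by
  rw [norm_div, norm_one]
  exact one_div_le_one_div_of_le ha (hz.trans (re_le_norm z))

lemma continuous_one_div_vertical {z : ℂ} (hz : -1 < z.re) :
    Continuous fun w : ℝ => 1 / (1 + 2 * Real.pi * w * I + z) := by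
  refine continuous_const.div (by fun_prop) fun w h => ?_
  have := congrArg re h
  simp at this
  linarith

lemma norm_one_div_vertical_le {z : ℂ} (hz : -1 < z.re) (w : ℝ) :
    ‖1 / (1 + 2 * Real.pi * w * I + z)‖ ≤ 1 / (1 + z.re) :=
  norm_one_div_le_of_le_re (by linarith) (by simp)

variable (hT : 0 ≤ T) (hg : Continuous g) (hgT : g T = 0) {C : ℝ}
  (hC : ∀ w, |kernel g T w| ≤ C / (1 + w ^ 2))

include hT hg hgT hC

/-- The factor `e ^ u` in the kernel cancels the shift by `1`. Integration can thus take place on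
the line `Re = 1`, where the Dirichlet series converge absolutely, while each pole at `-z` still
contributes the unshifted transform of `g`. -/
lemma integral_kernel_mul_one_div {z : ℂ} (hz : -1 < z.re) :
    ∫ w, (kernel g T w : ℂ) * (1 / (1 + 2 * Real.pi * w * I + z))
      = ∫ u in (0 : ℝ)..T, (g u : ℂ) * exp (-z * u) := by
  have h := integral_cosineTransform_mul_inv (p := fun u => Real.exp u * g u) hT (by fun_prop)
    (by simp [hgT]) (integrable_of_abs_le_div_one_add_sq (continuous_kernel hg) hC)
    (z := 1 + z) (by simp; linarith)
  have e1 : (fun w : ℝ => (kernel g T w : ℂ) * (1 / (1 + 2 * Real.pi * w * I + z)))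
      = fun w : ℝ => (cosineTransform (fun u => Real.exp u * g u) T w : ℂ)
        * (1 / (1 + z + 2 * Real.pi * w * I)) := by
    ext w
    rw [kernel, add_right_comm]
  rw [e1, h]
  congr 1
  ext u
  push_cast
  rw [show -(1 + z) * (u : ℂ) = -u + -z * u by ring, exp_add, exp_neg]
  have := exp_ne_zero (u : ℂ)
  field_simp

lemma integral_kernel_mul_re_one_div {z : ℂ} (hz : -1 < z.re) :
    ∫ w, kernel g T w * (1 / (1 + 2 * Real.pi * w * I + z)).re
      = ∫ u in (0 : ℝ)..T, g u * (Real.exp (-z.re * u) * Real.cos (z.im * u)) := by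
  have hi := integrable_kernel_mul_of_bounded (continuous_kernel hg) hC
    (continuous_one_div_vertical hz) (norm_one_div_vertical_le hz)
  have e1 : (fun w => kernel g T w * (1 / (1 + 2 * Real.pi * w * I + z)).re)
      = fun w => ((kernel g T w : ℂ) * (1 / (1 + 2 * Real.pi * w * I + z))).re := by
    ext w; rw [re_ofReal_mul]
  have e2 : ∫ w, ((kernel g T w : ℂ) * (1 / (1 + 2 * Real.pi * w * I + z))).re
      = (∫ w, (kernel g T w : ℂ) * (1 / (1 + 2 * Real.pi * w * I + z))).re := integral_re hi
  rw [e1, e2, integral_kernel_mul_one_div hT hg hgT hC hz]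
  have hii : IntervalIntegrable (fun u : ℝ => (g u : ℂ) * exp (-z * u)) volume 0 T :=
    Continuous.intervalIntegrable (by fun_prop) _ _
  have e3 := reCLM.intervalIntegral_comp_comm hii
  simp only [reCLM_apply] at e3
  rw [← e3]
  congr 1
  ext u
  rw [re_ofReal_mul, exp_re]
  simp

lemma integral_kernel : ∫ w, kernel g T w = g 0 := by
  have h := integral_cosineTransform_mul_exp (p := fun u => Real.exp u * g u) hT (by fun_prop)
    (by simp [hgT]) (integrable_of_abs_le_div_one_add_sq (continuous_kernel hg) hC) 0
  rw [evenCutoff_of_nonneg le_rfl hT] at h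
  simp only [ofReal_zero, mul_zero, neg_zero, zero_mul, exp_zero, mul_one] at h
  have h2 : ((∫ w, kernel g T w : ℝ) : ℂ) = ((Real.exp 0 * g 0 : ℝ) : ℂ) := by
    rw [← integral_complex_ofReal]
    exact h
  have := ofReal_injective h2
  simpa using this

lemma integrable_and_hasSum_zeros_kernel {f : ℂ → ℂ} (hf : Differentiable ℂ f) (h1 : f 1 ≠ 0)
    (hzero : ∀ z, f z = 0 → z.re = 0)
    (hsymm : ∀ z, ‖f (-(starRingEnd ℂ) z)‖ = ‖f z‖) (hgrowth : GrowthOn Set.univ f) :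
    Integrable (fun w => kernel g T w * (logDeriv f (1 + 2 * Real.pi * w * I)).re) ∧
    HasSum (fun ρ : ℂ => analyticOrderNatAt f ρ * ∫ u in (0 : ℝ)..T, g u * Real.cos (ρ.im * u))
      (∫ w, kernel g T w * (logDeriv f (1 + 2 * Real.pi * w * I)).re) := by
  obtain ⟨i1, i2⟩ := integrable_and_hasSum_zeros hf h1 hzero hsymm hgrowth
    (continuous_kernel hg) hC
  refine ⟨i1, ?_⟩
  convert! i2 using 1
  ext ρ
  by_cases h0 : f ρ = 0
  · have h2 := integral_kernel_mul_re_one_div hT hg hgT hC (z := -ρ) (by simp [hzero ρ h0])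
    simp only [← sub_eq_add_neg] at h2
    rw [h2]
    simp [hzero ρ h0]
  · have : analyticOrderAt f ρ = 0 := ((hf.analyticAt ρ).analyticOrderAt_eq_zero).2 h0
    simp [analyticOrderNatAt, this]

end Explicit

/-! ### Comparing primes and Gamma factors with those of zeta -/

section Primes

open ArithmeticFunction

variable {N : ℕ}

lemma re_vonMangoldt_sub_nonneg (χ : DirichletCharacter ℂ N) (n : ℕ) :
    0 ≤ ((vonMangoldt n : ℂ) - χ n * vonMangoldt n).re := by
  have h1 : (χ n).re ≤ 1 := (re_le_norm _).trans (DirichletCharacter.norm_le_one χ _)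
  rw [sub_re, re_mul_ofReal, ofReal_re]
  nlinarith [vonMangoldt_nonneg (n := n)]

lemma hasSum_logDeriv_LFunction_sub [NeZero N] (χ : DirichletCharacter ℂ N) {s : ℂ} (hs : 1 < s.re) :
    HasSum (fun n => LSeries.term (fun n => (vonMangoldt n : ℂ) - χ n * vonMangoldt n) s n)
      (logDeriv (DirichletCharacter.LFunction χ) s - logDeriv riemannZeta s) := by
  have h1 := (ArithmeticFunction.LSeriesSummable_vonMangoldt hs).hasSum
  have h2 := (DirichletCharacter.LSeriesSummable_twist_vonMangoldt χ hs).hasSum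
  have e1 := ArithmeticFunction.LSeries_vonMangoldt_eq_deriv_riemannZeta_div hs
  have e2 := DirichletCharacter.LSeries_twist_vonMangoldt_eq χ hs
  rw [← DirichletCharacter.LFunction_eq_LSeries χ hs,
    ← DirichletCharacter.deriv_LFunction_eq_deriv_LSeries χ hs] at e2
  rw [LSeries] at e1 e2
  rw [e1] at h1
  rw [e2] at h2
  have h3 := h1.sub h2
  rw [logDeriv_apply, logDeriv_apply]
  convert! h3 using 1
  · ext n
    rcases eq_or_ne n 0 with rfl | hn
    · simp
    · simp [LSeries.term_of_ne_zero hn, sub_div]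
  · ring

variable {g : ℝ → ℝ} {T : ℝ} (hT : 0 ≤ T) (hg : Continuous g) (hgT : g T = 0) {C : ℝ}
  (hC : ∀ w, |kernel g T w| ≤ C / (1 + w ^ 2)) (hpos : ∀ u ∈ Set.Icc 0 T, 0 ≤ g u)

include hT hg hgT hC hpos

/-- For even `χ` the difference is zero. For odd `χ` it is a series over `n` whose terms integrate
to `∫ g(u) (e^{-(1/2+2n)u} - e^{-(3/2+2n)u}) du`, nonnegative because `g` is. -/
lemma integrable_and_integral_gammaFactor_nonneg (χ : DirichletCharacter ℂ N) :
    Integrable (fun w : ℝ => kernel g T w *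
      (logDeriv (DirichletCharacter.gammaFactor χ) (1 / 2 + (1 + 2 * Real.pi * w * I))
        - logDeriv Gammaℝ (1 / 2 + (1 + 2 * Real.pi * w * I))).re) ∧
    0 ≤ ∫ w : ℝ, kernel g T w *
      (logDeriv (DirichletCharacter.gammaFactor χ) (1 / 2 + (1 + 2 * Real.pi * w * I))
        - logDeriv Gammaℝ (1 / 2 + (1 + 2 * Real.pi * w * I))).re := by
  by_cases hχ : χ.Even
  · have : DirichletCharacter.gammaFactor χ = Gammaℝ := funext hχ.gammaFactor_def
    simp [this]
  have hodd : ∀ s, logDeriv (DirichletCharacter.gammaFactor χ) s = logDeriv Gammaℝ (s + 1) := by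
    intro s
    have : DirichletCharacter.gammaFactor χ = fun s => Gammaℝ (s + 1) := by
      ext s; simp [DirichletCharacter.gammaFactor, hχ]
    rw [this, logDeriv_apply, logDeriv_apply, deriv_comp_add_const]
  simp_rw [hodd]
  have hre1 : ∀ n : ℕ, -1 < (1 / 2 + 2 * n : ℂ).re := fun n => by
    have : (0 : ℝ) ≤ n := n.cast_nonneg
    simp; linarith
  have hre2 : ∀ n : ℕ, -1 < (1 / 2 + 2 * n + 1 : ℂ).re := fun n => by
    have : (0 : ℝ) ≤ n := n.cast_nonneg
    simp; linarith
  refine integrable_and_re_integral_nonneg (ι := ℕ)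
    (k := fun n w => 1 / (1 + 2 * Real.pi * w * I + (1 / 2 + 2 * n))
      - 1 / (1 + 2 * Real.pi * w * I + (1 / 2 + 2 * n + 1)))
    (b := fun n => 1 / (1 + n : ℝ) ^ 2)
    (continuous_kernel hg) hC ?_ ?_ ?_ ?_ ?_
  · intro n
    exact (continuous_one_div_vertical (hre1 n)).sub (continuous_one_div_vertical (hre2 n))
  · intro n w
    have := norm_inv_sub_inv_le (z := 1 + 2 * Real.pi * w * I + (1 / 2 + 2 * n)) (a := 1 + n)
      (c := 1) (by positivity) (by
        have : (0 : ℝ) ≤ n := n.cast_nonneg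
        simp; linarith) zero_le_one
    rwa [ofReal_one, add_assoc _ _ (1 : ℂ)] at this
  · exact summable_one_div_add_nat_sq one_pos
  · intro w
    have := hasSum_logDeriv_Gammaℝ_sub (s := 1 / 2 + (1 + 2 * Real.pi * w * I))
      (by simp; norm_num)
    convert! this using 1
    ext n
    congr 2 <;> ring
  · intro n
    have i1 := integrable_kernel_mul_of_bounded (continuous_kernel hg) hC
      (continuous_one_div_vertical (hre1 n)) (norm_one_div_vertical_le (hre1 n))
    have i2 := integrable_kernel_mul_of_bounded (continuous_kernel hg) hC
      (continuous_one_div_vertical (hre2 n)) (norm_one_div_vertical_le (hre2 n))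
    simp_rw [mul_sub]
    rw [integral_sub i1 i2, integral_kernel_mul_one_div hT hg hgT hC (hre1 n),
      integral_kernel_mul_one_div hT hg hgT hC (hre2 n)]
    have e : ∀ b : ℝ, ∫ u in (0 : ℝ)..T, (g u : ℂ) * exp (-(b : ℂ) * u)
        = ((∫ u in (0 : ℝ)..T, g u * Real.exp (-b * u) : ℝ) : ℂ) := by
      intro b
      rw [← intervalIntegral.integral_ofReal]
      congr 1
      ext u
      push_cast
      rfl
    have e1 := e (1 / 2 + 2 * n)
    have e2 := e (1 / 2 + 2 * n + 1)
    push_cast at e1 e2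
    rw [e1, e2, sub_re, ofReal_re, ofReal_re, sub_nonneg]
    refine intervalIntegral.integral_mono_on hT (Continuous.intervalIntegrable (by fun_prop) _ _)
      (Continuous.intervalIntegrable (by fun_prop) _ _) fun u hu => ?_
    refine mul_le_mul_of_nonneg_left (Real.exp_le_exp.2 ?_) (hpos u hu)
    nlinarith [hu.1]

variable [NeZero N]

/-- Fourier inversion turns the `n`-th term into `Λ(n)(1 - Re χ(n)) n^{-3/2}` times the even cutoff
of `e^u g(u)` at `log n`. Every factor is nonnegative, so nothing about the distribution of `χ` on
primes is needed. -/
lemma integrable_and_integral_primes_nonneg (χ : DirichletCharacter ℂ N) :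
    Integrable (fun w : ℝ => kernel g T w *
      (logDeriv (DirichletCharacter.LFunction χ) (1 / 2 + (1 + 2 * Real.pi * w * I))
        - logDeriv riemannZeta (1 / 2 + (1 + 2 * Real.pi * w * I))).re) ∧
    0 ≤ ∫ w : ℝ, kernel g T w *
      (logDeriv (DirichletCharacter.LFunction χ) (1 / 2 + (1 + 2 * Real.pi * w * I))
        - logDeriv riemannZeta (1 / 2 + (1 + 2 * Real.pi * w * I))).re := by
  set c : ℕ → ℂ := fun n => (vonMangoldt n : ℂ) - χ n * vonMangoldt n with hc
  have hre : ∀ w : ℝ, (1 / 2 + (1 + 2 * Real.pi * w * I) : ℂ).re = 3 / 2 := by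
    intro w; simp; norm_num
  refine integrable_and_re_integral_nonneg (ι := ℕ)
    (k := fun n w => LSeries.term c (1 / 2 + (1 + 2 * Real.pi * w * I)) n)
    (b := fun n => ‖LSeries.term c (3 / 2) n‖)
    (continuous_kernel hg) hC ?_ ?_ ?_ ?_ ?_
  · intro n
    rcases eq_or_ne n 0 with rfl | hn
    · simp only [LSeries.term_zero]; fun_prop
    · simp only [LSeries.term_of_ne_zero hn]
      have hn' : (n : ℂ) ≠ 0 := by exact_mod_cast hn
      refine continuous_const.div ?_ fun w => by simp [cpow_eq_zero_iff, hn']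
      exact Continuous.const_cpow (by fun_prop) (Or.inl hn')
  · intro n w
    rw [LSeries.norm_term_eq, LSeries.norm_term_eq, hre]
    norm_num
  · exact (hasSum_logDeriv_LFunction_sub χ (s := 3 / 2) (by norm_num)).summable.norm
  · intro w
    exact hasSum_logDeriv_LFunction_sub χ (by rw [hre]; norm_num)
  · intro n
    rcases eq_or_ne n 0 with rfl | hn
    · simp
    have hn' : (n : ℂ) ≠ 0 := by exact_mod_cast hn
    have hnpos : (0 : ℝ) < n := by exact_mod_cast Nat.pos_of_ne_zero hn
    have h := integral_cosineTransform_mul_exp (p := fun u => Real.exp u * g u) hT (by fun_prop)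
      (by simp [hgT]) (integrable_of_abs_le_div_one_add_sq (continuous_kernel hg) hC) (Real.log n)
    have e : ∀ w : ℝ, (kernel g T w : ℂ) * LSeries.term c (1 / 2 + (1 + 2 * Real.pi * w * I)) n
        = ((kernel g T w : ℂ) * exp (-(2 * Real.pi * w * Real.log n) * I))
          * (c n * ((Real.exp (-(3 / 2 * Real.log n)) : ℝ) : ℂ)) := by
      intro w
      rw [LSeries.term_of_ne_zero hn, cpow_def_of_ne_zero hn', ← natCast_log, div_eq_mul_inv,
        ← exp_neg]
      rw [show -((Real.log n : ℂ) * (1 / 2 + (1 + 2 * Real.pi * w * I)))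
        = -(2 * Real.pi * w * Real.log n) * I + ((-(3 / 2 * Real.log n) : ℝ) : ℂ) by
          push_cast; ring, exp_add, ofReal_exp]
      ring
    simp_rw [e]
    have h' : ∫ w : ℝ, (kernel g T w : ℂ) * exp (-(2 * Real.pi * w * Real.log n) * I)
        = (evenCutoff (fun u => Real.exp u * g u) T (Real.log n) : ℂ) := h
    rw [integral_mul_const, h', re_ofReal_mul, re_mul_ofReal]
    have hlog : 0 ≤ Real.log n := Real.log_natCast_nonneg n
    refine mul_nonneg ?_ (mul_nonneg (re_vonMangoldt_sub_nonneg χ n) (Real.exp_pos _).le)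
    rw [evenCutoff]
    exact mul_nonneg (Real.exp_pos _).le
      (hpos _ ⟨le_min (abs_nonneg _) hT, min_le_right _ _⟩)

/-- On `Re s = 1` the logarithmic derivative of `xiChar χ` equals that of `xiZeta` plus `(log N)/2`,
minus the two polar terms of `ζ`, plus the Gamma and prime differences. Integrating against the
kernel and dropping the last two, which are nonnegative, gives the bound. -/
theorem explicit_inequality (hGRH : GRH) {χ : DirichletCharacter ℂ N} (hN : 1 < N)
    (hχ : χ.IsPrimitive) :
    (Summable fun ρ : ℂ => analyticOrderNatAt (xiChar χ) ρ *
      ∫ u in (0 : ℝ)..T, g u * Real.cos (ρ.im * u)) ∧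
    (Summable fun ρ : ℂ => analyticOrderNatAt xiZeta ρ *
      ∫ u in (0 : ℝ)..T, g u * Real.cos (ρ.im * u)) ∧
    g 0 * (Real.log N / 2)
        + (∑' ρ : ℂ, analyticOrderNatAt xiZeta ρ * ∫ u in (0 : ℝ)..T, g u * Real.cos (ρ.im * u))
        - ((∫ u in (0 : ℝ)..T, g u * Real.exp (-(1 / 2) * u))
          + ∫ u in (0 : ℝ)..T, g u * Real.exp (1 / 2 * u))
      ≤ ∑' ρ : ℂ, analyticOrderNatAt (xiChar χ) ρ *
          ∫ u in (0 : ℝ)..T, g u * Real.cos (ρ.im * u) := by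
  have hχ1 := ne_one_of_isPrimitive hN hχ
  obtain ⟨a1, a2⟩ := integrable_and_hasSum_zeros_kernel hT hg hgT hC (differentiable_xiChar hχ1)
    (xiChar_one_ne_zero hχ1) (fun z => re_eq_zero_of_xiChar_eq_zero hGRH hN hχ)
    (norm_xiChar_symm hN hχ) (growthOn_xiChar hN hχ)
  obtain ⟨b1, b2⟩ := integrable_and_hasSum_zeros_kernel hT hg hgT hC differentiable_xiZeta
    xiZeta_one_ne_zero (fun z => re_eq_zero_of_xiZeta_eq_zero hGRH) norm_xiZeta_symm
    growthOn_xiZeta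
  obtain ⟨p1, p2⟩ := integrable_and_integral_primes_nonneg hT hg hgT hC hpos χ
  obtain ⟨q1, q2⟩ := integrable_and_integral_gammaFactor_nonneg hT hg hgT hC hpos χ
  have hz1 : -1 < (1 / 2 : ℂ).re := by norm_num
  have hz2 : -1 < (-(1 / 2) : ℂ).re := by norm_num
  have hK : Integrable (kernel g T) :=
    integrable_of_abs_le_div_one_add_sq (continuous_kernel hg) hC
  have hre : ∀ z : ℂ, -1 < z.re → Integrable fun w : ℝ =>
      kernel g T w * (1 / (1 + 2 * Real.pi * w * I + z)).re := fun z hz => by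
    have := (integrable_kernel_mul_of_bounded (continuous_kernel hg) hC
      (continuous_one_div_vertical hz) (norm_one_div_vertical_le hz)).re
    simpa only [RCLike.re_eq_complex_re, re_ofReal_mul] using this
  have v1 := integral_kernel_mul_re_one_div hT hg hgT hC hz1
  have v2 := integral_kernel_mul_re_one_div hT hg hgT hC hz2
  refine ⟨a2.summable, b2.summable, ?_⟩
  rw [a2.tsum_eq, b2.tsum_eq]
  have key : ∀ w : ℝ, kernel g T w * (logDeriv (xiChar χ) (1 + 2 * Real.pi * w * I)).re
      = kernel g T w * (Real.log N / 2)
        + kernel g T w * (logDeriv xiZeta (1 + 2 * Real.pi * w * I)).re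
        - (kernel g T w * (1 / (1 + 2 * Real.pi * w * I + 1 / 2)).re
          + kernel g T w * (1 / (1 + 2 * Real.pi * w * I + -(1 / 2))).re)
        + kernel g T w *
          (logDeriv (DirichletCharacter.gammaFactor χ) (1 / 2 + (1 + 2 * Real.pi * w * I))
            - logDeriv Gammaℝ (1 / 2 + (1 + 2 * Real.pi * w * I))).re
        + kernel g T w *
          (logDeriv (DirichletCharacter.LFunction χ) (1 / 2 + (1 + 2 * Real.pi * w * I))
            - logDeriv riemannZeta (1 / 2 + (1 + 2 * Real.pi * w * I))).re := by
    intro w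
    rw [logDeriv_xiChar hχ1 (by simp; norm_num), logDeriv_xiZeta (by simp; norm_num),
      add_comm (1 / 2 : ℂ) (1 + 2 * Real.pi * w * I), ← sub_eq_add_neg]
    have : ((Real.log N : ℂ) / 2).re = Real.log N / 2 := by
      rw [← ofReal_ofNat, ← ofReal_div, ofReal_re]
    simp only [add_re, sub_re, this]
    ring
  simp_rw [key]
  rw [integral_add, integral_add, integral_sub, integral_add, integral_add, integral_mul_const,
    integral_kernel hT hg hgT hC, v1, v2]
  · have e1 : (∫ u in (0 : ℝ)..T, g u * (Real.exp (-(1 / 2 : ℂ).re * u)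
        * Real.cos ((1 / 2 : ℂ).im * u))) = ∫ u in (0 : ℝ)..T, g u * Real.exp (-(1 / 2) * u) := by
      congr 1; ext u; norm_num
    have e2 : (∫ u in (0 : ℝ)..T, g u * (Real.exp (-(-(1 / 2) : ℂ).re * u)
        * Real.cos ((-(1 / 2) : ℂ).im * u))) = ∫ u in (0 : ℝ)..T, g u * Real.exp (1 / 2 * u) := by
      congr 1; ext u; norm_num
    rw [e1, e2]
    linarith
  · exact hre _ hz1
  · exact hre _ hz2
  · exact hK.mul_const _
  · exact b1
  · exact (hK.mul_const _).add b1
  · exact (hre _ hz1).add (hre _ hz2)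
  · exact ((hK.mul_const _).add b1).sub ((hre _ hz1).add (hre _ hz2))
  · exact q1
  · exact (((hK.mul_const _).add b1).sub ((hre _ hz1).add (hre _ hz2))).add q1
  · exact p1

end Primes

end LowZeros

end

section

open Complex Metric Filter Topology MeasureTheory

namespace LowZeros

/-! ### The test function -/

/-- A test function on `[0, π / a]`, whose cosine transform is `(a²(1 + δ) - x²) E(x)² / (2a)` for
a real function `E`. -/
noncomputable def testFn (a δ u : ℝ) : ℝ :=
  δ / 2 * ((Real.pi - a * u) * Real.cos (a * u)) + (1 + δ / 2) * Real.sin (a * u)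

/-- The cosine transform of `cos (a v)` on `[-π / (2a), π / (2a)]`. -/
noncomputable def bumpTransform (a x : ℝ) : ℝ :=
  2 * ∫ v in (0 : ℝ)..Real.pi / (2 * a), Real.cos (a * v) * Real.cos (x * v)

/-- The cosine transform of the test function. -/
noncomputable def testTransform (a δ x : ℝ) : ℝ :=
  ∫ u in (0 : ℝ)..Real.pi / a, testFn a δ u * Real.cos (x * u)

section

variable {a δ : ℝ}

lemma hasDerivAt_cos_mul (a u : ℝ) :
    HasDerivAt (fun u => Real.cos (a * u)) (-a * Real.sin (a * u)) u := by
  have := ((hasDerivAt_id u).const_mul a).cos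
  convert! this using 1
  simp; ring

lemma hasDerivAt_sin_mul (a u : ℝ) :
    HasDerivAt (fun u => Real.sin (a * u)) (a * Real.cos (a * u)) u := by
  have := ((hasDerivAt_id u).const_mul a).sin
  convert! this using 1
  simp; ring

lemma hasDerivAt_pi_sub (a u : ℝ) : HasDerivAt (fun u => Real.pi - a * u) (-a) u := by
  have := ((hasDerivAt_id u).const_mul a).const_sub Real.pi
  simpa using this

lemma hasDerivAt_testFn (a δ u : ℝ) : HasDerivAt (testFn a δ)
    (δ / 2 * (-a * Real.cos (a * u) + (Real.pi - a * u) * (-a * Real.sin (a * u)))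
      + (1 + δ / 2) * (a * Real.cos (a * u))) u :=
  (((hasDerivAt_pi_sub a u).mul (hasDerivAt_cos_mul a u)).const_mul _).add
    ((hasDerivAt_sin_mul a u).const_mul _)

lemma hasDerivAt_deriv_testFn (a δ u : ℝ) : HasDerivAt
    (fun u => δ / 2 * (-a * Real.cos (a * u) + (Real.pi - a * u) * (-a * Real.sin (a * u)))
      + (1 + δ / 2) * (a * Real.cos (a * u)))
    (δ / 2 * (-a * (-a * Real.sin (a * u)) + (-a * (-a * Real.sin (a * u))
      + (Real.pi - a * u) * (-a * (a * Real.cos (a * u)))))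
      + (1 + δ / 2) * (a * (-a * Real.sin (a * u)))) u :=
  ((((hasDerivAt_cos_mul a u).const_mul _).add ((hasDerivAt_pi_sub a u).mul
    ((hasDerivAt_sin_mul a u).const_mul _))).const_mul _).add
    (((hasDerivAt_cos_mul a u).const_mul _).const_mul _)

lemma continuous_testFn (a δ : ℝ) : Continuous (testFn a δ) := by
  unfold testFn; fun_prop

lemma testFn_zero (a δ : ℝ) : testFn a δ 0 = Real.pi * δ / 2 := by
  simp [testFn]; ring

lemma testFn_pi_div (ha : 0 < a) (δ : ℝ) : testFn a δ (Real.pi / a) = 0 := by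
  simp [testFn, mul_div_cancel₀ _ ha.ne']

lemma testFn_eq (a δ u : ℝ) : testFn a δ u = (1 + δ / 2) * Real.sin (Real.pi - a * u)
    - δ / 2 * ((Real.pi - a * u) * Real.cos (Real.pi - a * u)) := by
  rw [testFn, Real.sin_pi_sub, Real.cos_pi_sub]
  ring

lemma mul_cos_le_sin {x : ℝ} (h0 : 0 ≤ x) (h1 : x ≤ Real.pi) : x * Real.cos x ≤ Real.sin x := by
  rcases lt_or_ge x (Real.pi / 2) with h | h
  · have hc : 0 < Real.cos x := Real.cos_pos_of_mem_Ioo ⟨by linarith [Real.pi_pos], h⟩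
    have := Real.le_tan h0 h
    rw [Real.tan_eq_sin_div_cos, le_div_iff₀ hc] at this
    exact this
  · have hc : Real.cos x ≤ 0 := Real.cos_nonpos_of_pi_div_two_le_of_le h (by linarith [Real.pi_pos])
    have hs := Real.sin_nonneg_of_nonneg_of_le_pi h0 h1
    nlinarith

lemma pi_sub_mem (ha : 0 < a) {u : ℝ} (hu : u ∈ Set.Icc 0 (Real.pi / a)) :
    0 ≤ Real.pi - a * u ∧ Real.pi - a * u ≤ Real.pi := by
  have := (le_div_iff₀ ha).1 hu.2
  have := mul_nonneg ha.le hu.1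
  constructor <;> linarith

lemma testFn_nonneg (ha : 0 < a) (hδ : 0 ≤ δ) {u : ℝ} (hu : u ∈ Set.Icc 0 (Real.pi / a)) :
    0 ≤ testFn a δ u := by
  obtain ⟨h0, h1⟩ := pi_sub_mem ha hu
  rw [testFn_eq]
  have := mul_cos_le_sin h0 h1
  have hs := Real.sin_nonneg_of_nonneg_of_le_pi h0 h1
  nlinarith

lemma testFn_le (ha : 0 < a) (hδ : 0 ≤ δ) {u : ℝ} (hu : u ∈ Set.Icc 0 (Real.pi / a)) :
    testFn a δ u ≤ (1 + δ) * a * (Real.pi / a - u) := by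
  obtain ⟨h0, h1⟩ := pi_sub_mem ha hu
  have e : (1 + δ) * a * (Real.pi / a - u) = (1 + δ) * (Real.pi - a * u) := by
    field_simp
  rw [testFn_eq, e]
  set y := Real.pi - a * u
  have h2 : Real.sin y ≤ y := Real.sin_le h0
  have h3 : -y ≤ y * Real.cos y := by nlinarith [Real.neg_one_le_cos y]
  nlinarith

/-- The linear majorant `(1+δ) a (T - u)` is integrated exactly. The dominant weight `e^{u/2}`
concentrates near `T`, where the test function is asymptotic to `a (T - u)`; only a factor `1 + δ`
is lost there, harmless when `δ` is small. -/
lemma integral_testFn_mul_exp_le (ha : 0 < a) (hδ : 0 ≤ δ) :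
    (∫ u in (0 : ℝ)..Real.pi / a, testFn a δ u * Real.exp (-(1 / 2) * u))
      + (∫ u in (0 : ℝ)..Real.pi / a, testFn a δ u * Real.exp (1 / 2 * u))
      ≤ (1 + δ) * a * (4 * Real.exp (Real.pi / a / 2) + 4 * Real.exp (-(Real.pi / a / 2)) - 8) := by
  set T := Real.pi / a with hTdef
  have hT : 0 ≤ T := by positivity
  have hd1 : ∀ u : ℝ, HasDerivAt (fun u => (-(2 * (T - u)) + 4) * Real.exp (-(1 / 2) * u))
      ((T - u) * Real.exp (-(1 / 2) * u)) u := fun u => by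
    have h1 : HasDerivAt (fun u : ℝ => -(2 * (T - u)) + 4) 2 u := by
      have := ((((hasDerivAt_id u).const_sub T).const_mul 2).neg).add_const 4
      simpa using this
    have h2 : HasDerivAt (fun u : ℝ => Real.exp (-(1 / 2) * u))
        (Real.exp (-(1 / 2) * u) * (-(1 / 2) * 1)) u := ((hasDerivAt_id u).const_mul _).exp
    convert! h1.mul h2 using 1
    ring
  have hd2 : ∀ u : ℝ, HasDerivAt (fun u => (2 * (T - u) + 4) * Real.exp (1 / 2 * u))
      ((T - u) * Real.exp (1 / 2 * u)) u := fun u => by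
    have h1 : HasDerivAt (fun u : ℝ => 2 * (T - u) + 4) (-2) u := by
      have := (((hasDerivAt_id u).const_sub T).const_mul 2).add_const 4
      simpa using this
    have h2 : HasDerivAt (fun u : ℝ => Real.exp (1 / 2 * u))
        (Real.exp (1 / 2 * u) * (1 / 2 * 1)) u := ((hasDerivAt_id u).const_mul _).exp
    convert! h1.mul h2 using 1
    ring
  have v1 := intervalIntegral.integral_eq_sub_of_hasDerivAt (a := 0) (b := T)
    (fun u _ => hd1 u) (Continuous.intervalIntegrable (by fun_prop) _ _)
  have v2 := intervalIntegral.integral_eq_sub_of_hasDerivAt (a := 0) (b := T)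
    (fun u _ => hd2 u) (Continuous.intervalIntegrable (by fun_prop) _ _)
  have hg := continuous_testFn a δ
  have hle : ∀ b : ℝ, (∫ u in (0 : ℝ)..T, testFn a δ u * Real.exp (b * u))
      ≤ (1 + δ) * a * ∫ u in (0 : ℝ)..T, (T - u) * Real.exp (b * u) := fun b => by
    rw [← intervalIntegral.integral_const_mul]
    refine intervalIntegral.integral_mono_on hT (Continuous.intervalIntegrable (by fun_prop) _ _)
      (Continuous.intervalIntegrable (by fun_prop) _ _) fun u hu => ?_
    rw [← mul_assoc]
    exact mul_le_mul_of_nonneg_right (testFn_le ha hδ hu) (Real.exp_pos _).le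
  refine (add_le_add (hle _) (hle _)).trans (le_of_eq ?_)
  rw [v1, v2, ← mul_add]
  congr 1
  rw [show -(1 / 2) * T = -(T / 2) by ring, show 1 / 2 * T = T / 2 by ring]
  simp
  ring

/-! ### The transform of the test function -/

lemma continuous_bumpTransform (a : ℝ) : Continuous (bumpTransform a) := by
  unfold bumpTransform
  refine continuous_const.mul ?_
  exact intervalIntegral.continuous_parametric_intervalIntegral_of_continuous' (by fun_prop) 0 _

lemma continuous_testTransform (a δ : ℝ) : Continuous (testTransform a δ) := by
  have := continuous_testFn a δ
  exact intervalIntegral.continuous_parametric_intervalIntegral_of_continuous' (by fun_prop) 0 _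

lemma mul_bumpTransform (ha : 0 < a) (x : ℝ) :
    (a ^ 2 - x ^ 2) * bumpTransform a x = 2 * a * Real.cos (x * (Real.pi / (2 * a))) := by
  have hd : ∀ u, HasDerivAt (fun u => a * (Real.sin (a * u) * Real.cos (x * u))
      - x * (Real.cos (a * u) * Real.sin (x * u)))
      ((a ^ 2 - x ^ 2) * (Real.cos (a * u) * Real.cos (x * u))) u := fun u => by
    have := (((hasDerivAt_sin_mul a u).mul (hasDerivAt_cos_mul x u)).const_mul a).sub
      (((hasDerivAt_cos_mul a u).mul (hasDerivAt_sin_mul x u)).const_mul x)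
    convert! this using 1
    ring
  have v := intervalIntegral.integral_eq_sub_of_hasDerivAt (a := 0) (b := Real.pi / (2 * a))
    (fun u _ => hd u) (Continuous.intervalIntegrable (by fun_prop) _ _)
  rw [intervalIntegral.integral_const_mul] at v
  rw [bumpTransform, mul_left_comm, v]
  have e : a * (Real.pi / (2 * a)) = Real.pi / 2 := by field_simp
  simp [e]
  ring

lemma abs_bumpTransform_le (ha : 0 < a) (x : ℝ) : |bumpTransform a x| ≤ 2 / a := by
  have hT : 0 ≤ Real.pi / (2 * a) := by positivity
  have v : ∫ v in (0 : ℝ)..Real.pi / (2 * a), Real.cos (a * v) = 1 / a := by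
    have hd : ∀ u, HasDerivAt (fun u => 1 / a * Real.sin (a * u)) (Real.cos (a * u)) u :=
      fun u => by
        have := (hasDerivAt_sin_mul a u).const_mul (1 / a)
        convert! this using 1
        field_simp
    rw [intervalIntegral.integral_eq_sub_of_hasDerivAt (fun u _ => hd u)
      (Continuous.intervalIntegrable (by fun_prop) _ _)]
    have e : a * (Real.pi / (2 * a)) = Real.pi / 2 := by field_simp
    simp [e]
  rw [bumpTransform, abs_mul, abs_two, show 2 / a = 2 * (1 / a) by ring, ← v]
  refine mul_le_mul_of_nonneg_left ?_ zero_le_two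
  refine (intervalIntegral.abs_integral_le_integral_abs hT).trans ?_
  refine intervalIntegral.integral_mono_on hT (Continuous.intervalIntegrable (by fun_prop) _ _)
    (Continuous.intervalIntegrable (by fun_prop) _ _) fun u hu => ?_
  have h1 : a * u ≤ Real.pi / 2 := by
    have := (le_div_iff₀ (by positivity)).1 hu.2
    linarith
  have hc : 0 ≤ Real.cos (a * u) := Real.cos_nonneg_of_mem_Icc
    ⟨by linarith [mul_nonneg ha.le hu.1, Real.pi_pos], h1⟩
  rw [abs_mul, abs_of_nonneg hc]
  exact mul_le_of_le_one_right hc (Real.abs_cos_le_one _)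

/-- Let `c` be `cos (a v)` on `[-π/(2a), π/(2a)]`, with transform `E`. On `[0, π/a]` the test
function is `a⁻¹ (a²(1+δ) + d²/du²)(c ∗ c)`; convolution gives the square and the differential
operator the factor `a²(1+δ) - x²`. The proof checks this with explicit antiderivatives, which
requires `x ≠ ±a`. -/
lemma testTransform_eq_of_ne (ha : 0 < a) (δ : ℝ) {x : ℝ} (hx : a ^ 2 - x ^ 2 ≠ 0) :
    testTransform a δ x = (a ^ 2 * (1 + δ) - x ^ 2) * bumpTransform a x ^ 2 / (2 * a) := by
  set D := a ^ 2 - x ^ 2 with hD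
  have hS : ∀ u, HasDerivAt (fun u => -(a * (Real.cos (a * u) * Real.cos (x * u))
      + x * (Real.sin (a * u) * Real.sin (x * u))) / D)
      (Real.sin (a * u) * Real.cos (x * u)) u := fun u => by
    have := ((((hasDerivAt_cos_mul a u).mul (hasDerivAt_cos_mul x u)).const_mul a).add
      (((hasDerivAt_sin_mul a u).mul (hasDerivAt_sin_mul x u)).const_mul x)).neg.div_const D
    convert! this using 1
    field_simp
    rw [hD]
    ring
  have hP : ∀ u, HasDerivAt (fun u => (a * (Real.sin (a * u) * Real.cos (x * u))
      - x * (Real.cos (a * u) * Real.sin (x * u))) / D)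
      (Real.cos (a * u) * Real.cos (x * u)) u := fun u => by
    have := ((((hasDerivAt_sin_mul a u).mul (hasDerivAt_cos_mul x u)).const_mul a).sub
      (((hasDerivAt_cos_mul a u).mul (hasDerivAt_sin_mul x u)).const_mul x)).div_const D
    convert! this using 1
    field_simp
    rw [hD]
    ring
  have hQ : ∀ u, HasDerivAt (fun u => (a * (Real.sin (a * u) * Real.sin (x * u))
      + x * (Real.cos (a * u) * Real.cos (x * u))) / D)
      (Real.cos (a * u) * Real.sin (x * u)) u := fun u => by
    have := ((((hasDerivAt_sin_mul a u).mul (hasDerivAt_sin_mul x u)).const_mul a).add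
      (((hasDerivAt_cos_mul a u).mul (hasDerivAt_cos_mul x u)).const_mul x)).div_const D
    convert! this using 1
    field_simp
    rw [hD]
    ring
  have hH := fun u => ((((hasDerivAt_pi_sub a u).mul (hP u)).add
    ((((hS u).const_mul a).sub ((hQ u).const_mul x)).const_mul (a / D))).const_mul (δ / 2)).add
    ((hS u).const_mul (1 + δ / 2))
  have hcont := continuous_testFn a δ
  have v := intervalIntegral.integral_eq_sub_of_hasDerivAt (a := 0) (b := Real.pi / a)
    (f' := fun u => testFn a δ u * Real.cos (x * u))
    (fun u _ => (hH u).congr_deriv (by rw [testFn]; field_simp; ring))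
    (Continuous.intervalIntegrable (by fun_prop) _ _)
  rw [testTransform, v]
  have hb : bumpTransform a x = 2 * a * Real.cos (x * (Real.pi / (2 * a))) / D := by
    rw [eq_div_iff hx, mul_comm, mul_bumpTransform ha]
  have hc : Real.cos (x * (Real.pi / a)) = 2 * Real.cos (x * (Real.pi / (2 * a))) ^ 2 - 1 := by
    rw [← Real.cos_two_mul]
    congr 1
    field_simp
  have e : a * (Real.pi / a) = Real.pi := by field_simp
  rw [hb]
  simp [e, hc]
  field_simp
  rw [hD]
  ring

lemma testTransform_eq (ha : 0 < a) (δ x : ℝ) :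
    testTransform a δ x = (a ^ 2 * (1 + δ) - x ^ 2) * bumpTransform a x ^ 2 / (2 * a) := by
  have hd : Dense ({a, -a}ᶜ : Set ℝ) := (Set.toFinite {a, -a}).countable.dense_compl ℝ
  have hcb := continuous_bumpTransform a
  refine congrFun (Continuous.ext_on
    (g := fun x => (a ^ 2 * (1 + δ) - x ^ 2) * bumpTransform a x ^ 2 / (2 * a)) hd
    (continuous_testTransform a δ) (by fun_prop) fun y hy => ?_) x
  refine testTransform_eq_of_ne ha δ fun h => hy ?_
  have : (y - a) * (y + a) = 0 := by linear_combination -h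
  rcases mul_eq_zero.1 this with h | h
  · exact Or.inl (by linarith)
  · exact Or.inr (by rw [Set.mem_singleton_iff]; linarith)

/-- For `x² ≤ 2a²` the bound `|E| ≤ 2/a` suffices. Beyond that, the closed form gives `|E| ≤ 4a/x²`.
This controls the negative part of the transform, uniformly in `δ`, by a quantity summable over the
zeros of `ζ`. -/
lemma sq_mul_sq_bumpTransform_le (ha : 0 < a) (x : ℝ) :
    x ^ 2 * bumpTransform a x ^ 2 * (1 + x ^ 2) ≤ 8 + 16 * a ^ 2 := by
  set E := bumpTransform a x with hE
  rcases le_total (x ^ 2) (2 * a ^ 2) with h | h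
  · have h1 : a ^ 2 * E ^ 2 ≤ 4 := by
      have := abs_bumpTransform_le ha x
      rw [le_div_iff₀ ha, ← abs_of_pos ha, ← abs_mul, abs_of_pos ha] at this
      have := (sq_le_sq' (by linarith [neg_abs_le (E * a)]) ((le_abs_self _).trans this))
      linarith
    have h2 : x ^ 2 * E ^ 2 ≤ 8 := by nlinarith [sq_nonneg E]
    nlinarith [sq_nonneg x, mul_nonneg (sq_nonneg x) (sq_nonneg E)]
  · have h1 := mul_bumpTransform ha x
    rw [← hE] at h1
    have h2 : ((a ^ 2 - x ^ 2) * E) ^ 2 ≤ 4 * a ^ 2 := by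
      rw [h1]
      nlinarith [Real.cos_sq_le_one (x * (Real.pi / (2 * a))), sq_nonneg a]
    have h3 : (x ^ 2 / 2) ^ 2 ≤ (a ^ 2 - x ^ 2) ^ 2 := by nlinarith [sq_nonneg a]
    have h4 : x ^ 2 * x ^ 2 * E ^ 2 ≤ 16 * a ^ 2 := by nlinarith [sq_nonneg E]
    have h5 : x ^ 2 * E ^ 2 ≤ 8 := by
      have : 2 * a ^ 2 * (x ^ 2 * E ^ 2) ≤ 2 * a ^ 2 * 8 := by
        nlinarith [mul_nonneg (sq_nonneg x) (sq_nonneg E)]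
      exact le_of_mul_le_mul_left this (by positivity)
    nlinarith

lemma neg_div_le_testTransform (ha : 0 < a) (hδ : 0 ≤ δ) (x : ℝ) :
    -((4 / a + 8 * a) * (1 / (1 + x ^ 2))) ≤ testTransform a δ x := by
  rw [testTransform_eq ha]
  have h := sq_mul_sq_bumpTransform_le ha x
  have hx : 0 < 1 + x ^ 2 := by positivity
  have e : (4 / a + 8 * a) * (1 / (1 + x ^ 2)) = (8 + 16 * a ^ 2) / (1 + x ^ 2) / (2 * a) := by
    field_simp
    ring
  rw [e, ← neg_div]
  refine div_le_div_of_nonneg_right ?_ (by positivity)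
  rw [neg_le]
  rw [le_div_iff₀ hx]
  have : 0 ≤ a ^ 2 * (1 + δ) * bumpTransform a x ^ 2 := by positivity
  nlinarith

lemma testTransform_le (ha : 0 < a) (hδ : 0 ≤ δ) (x : ℝ) :
    testTransform a δ x ≤ 2 * (1 + δ) / a := by
  rw [testTransform_eq ha]
  have h1 : a ^ 2 * bumpTransform a x ^ 2 ≤ 4 := by
    have := abs_bumpTransform_le ha x
    rw [le_div_iff₀ ha, ← abs_of_pos ha, ← abs_mul, abs_of_pos ha] at this
    have := (sq_le_sq' (by linarith [neg_abs_le (bumpTransform a x * a)])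
      ((le_abs_self _).trans this))
    linarith
  rw [div_le_div_iff₀ (by positivity) ha]
  have : (a ^ 2 * (1 + δ) - x ^ 2) * bumpTransform a x ^ 2 ≤ 4 * (1 + δ) := by
    nlinarith [mul_nonneg (sq_nonneg x) (sq_nonneg (bumpTransform a x))]
  nlinarith

lemma testTransform_nonpos (ha : 0 < a) {x : ℝ} (hx : a ^ 2 * (1 + δ) ≤ x ^ 2) :
    testTransform a δ x ≤ 0 := by
  rw [testTransform_eq ha]
  exact div_nonpos_of_nonpos_of_nonneg
    (mul_nonpos_of_nonpos_of_nonneg (by linarith) (sq_nonneg _)) (by positivity)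

end

end LowZeros

end

section

open Complex Metric Filter Topology MeasureTheory

namespace LowZeros

/-! ### Counting low zeros of primitive characters -/

lemma isCompact_verticalSegment (t : ℝ) : IsCompact {z : ℂ | z.re = 0 ∧ |z.im| ≤ t} := by
  refine Metric.isCompact_of_isClosed_isBounded ?_ ?_
  · exact (isClosed_eq continuous_re continuous_const).inter
      (isClosed_le (continuous_abs.comp continuous_im) continuous_const)
  · refine (Metric.isBounded_closedBall (x := (0 : ℂ)) (r := t)).subset fun z hz => ?_
    rw [mem_closedBall_zero_iff]
    refine (norm_le_abs_re_add_abs_im z).trans ?_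
    rw [hz.1, abs_zero, zero_add]
    exact hz.2

section

variable {N : ℕ} [NeZero N] {χ : DirichletCharacter ℂ N}

lemma finite_lowZeros_xiChar (hGRH : GRH) (hN : 1 < N) (hχ : χ.IsPrimitive) (t : ℝ) :
    {z : ℂ | xiChar χ z = 0 ∧ |z.im| ≤ t}.Finite := by
  have hχ1 := ne_one_of_isPrimitive hN hχ
  refine (finite_zeros_inter_of_isCompact (differentiable_xiChar hχ1) (xiChar_one_ne_zero hχ1)
    (isCompact_verticalSegment t)).subset fun z hz => ?_
  exact ⟨⟨re_eq_zero_of_xiChar_eq_zero hGRH hN hχ hz.1, hz.2⟩, hz.1⟩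

lemma lowZeros_eq_image (hGRH : GRH) (hN : 1 < N) (hχ : χ.IsPrimitive) (t : ℝ) :
    {ρ ∈ nontrivialZeros χ | |ρ.im| ≤ t}
      = (fun z : ℂ => 1 / 2 + z) '' {z : ℂ | xiChar χ z = 0 ∧ |z.im| ≤ t} := by
  ext ρ
  constructor
  · rintro ⟨⟨h0, h1, h2⟩, ht⟩
    refine ⟨ρ - 1 / 2, ⟨?_, by simpa using ht⟩, by simp⟩
    rw [xiChar_eq_zero_iff (by simp; linarith)]
    simpa using h2
  · rintro ⟨z, ⟨hz, ht⟩, rfl⟩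
    have hre := re_eq_zero_of_xiChar_eq_zero hGRH hN hχ hz
    refine ⟨⟨by simp [hre], by simp [hre]; norm_num, ?_⟩, by simpa using ht⟩
    exact (xiChar_eq_zero_iff (by rw [hre]; norm_num)).1 hz

lemma zeroCount_eq_finsum_xiChar (hGRH : GRH) (hN : 1 < N) (hχ : χ.IsPrimitive) (t : ℝ) :
    zeroCount χ t = ∑ᶠ z ∈ {z : ℂ | xiChar χ z = 0 ∧ |z.im| ≤ t},
      analyticOrderNatAt (xiChar χ) z := by
  rw [zeroCount, lowZeros_eq_image hGRH hN hχ,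
    finsum_mem_image (fun _ _ _ _ h => add_left_cancel h)]
  refine finsum_mem_congr rfl fun z hz => ?_
  have hre := re_eq_zero_of_xiChar_eq_zero hGRH hN hχ hz.1
  rw [analyticOrderNatAt_xiChar (ne_one_of_isPrimitive hN hχ) (by rw [hre]; norm_num)]

/-- Zeros above height `a√(1+δ)` have a nonpositive transform and may be discarded; each of the
others contributes at most `2(1+δ)/a`. -/
lemma tsum_testTransform_le (hGRH : GRH) (hN : 1 < N) (hχ : χ.IsPrimitive) {a δ : ℝ} (ha : 0 < a)
    (hδ : 0 ≤ δ)
    (hs : Summable fun ρ : ℂ => analyticOrderNatAt (xiChar χ) ρ * testTransform a δ ρ.im) :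
    ∑' ρ : ℂ, analyticOrderNatAt (xiChar χ) ρ * testTransform a δ ρ.im
      ≤ zeroCount χ (a * Real.sqrt (1 + δ)) * (2 * (1 + δ) / a) := by
  classical
  have hχ1 := ne_one_of_isPrimitive hN hχ
  set t := a * Real.sqrt (1 + δ) with ht
  have ht2 : t ^ 2 = a ^ 2 * (1 + δ) := by rw [ht, mul_pow, Real.sq_sqrt (by linarith)]
  have ht0 : 0 ≤ t := by positivity
  have hfin := finite_lowZeros_xiChar hGRH hN hχ t
  set S := hfin.toFinset with hS
  have hcount : (zeroCount χ t : ℝ) = ∑ z ∈ S, (analyticOrderNatAt (xiChar χ) z : ℝ) := by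
    rw [zeroCount_eq_finsum_xiChar hGRH hN hχ, finsum_mem_eq_finite_toFinset_sum _ hfin]
    push_cast
    rfl
  have h1 : ∑' ρ : ℂ, analyticOrderNatAt (xiChar χ) ρ * testTransform a δ ρ.im
      ≤ ∑ ρ ∈ S, analyticOrderNatAt (xiChar χ) ρ * testTransform a δ ρ.im := by
    rw [← hs.sum_add_tsum_compl (s := S)]
    have : ∑' ρ : ↑((S : Set ℂ)ᶜ),
        analyticOrderNatAt (xiChar χ) ρ * testTransform a δ (ρ : ℂ).im ≤ 0 := by
      refine tsum_nonpos fun ρ => ?_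
      by_cases h0 : xiChar χ ρ = 0
      · refine mul_nonpos_of_nonneg_of_nonpos (Nat.cast_nonneg _) (testTransform_nonpos ha ?_)
        have : ¬ |(ρ : ℂ).im| ≤ t := fun h => ρ.2 (by simpa [hS] using ⟨h0, h⟩)
        rw [← ht2, ← sq_abs (ρ : ℂ).im]
        exact pow_le_pow_left₀ ht0 (not_le.1 this).le 2
      · have : analyticOrderAt (xiChar χ) ρ = 0 :=
          (((differentiable_xiChar hχ1).analyticAt _).analyticOrderAt_eq_zero).2 h0
        simp [analyticOrderNatAt, this]
    linarith
  refine h1.trans ?_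
  rw [hcount, Finset.sum_mul]
  exact Finset.sum_le_sum fun ρ _ =>
    mul_le_mul_of_nonneg_left (testTransform_le ha hδ _) (Nat.cast_nonneg _)

end

lemma summable_zeros_xiZeta (hGRH : GRH) :
    Summable fun ρ : ℂ => analyticOrderNatAt xiZeta ρ * (1 / (1 + ρ.im ^ 2)) := by
  obtain ⟨D, hD⟩ := growthOn_xiZeta
  refine (hasSum_re_logDeriv differentiable_xiZeta xiZeta_one_ne_zero
    (fun z => re_eq_zero_of_xiZeta_eq_zero hGRH) norm_xiZeta_symm (fun z => hD z trivial)
    (s := 1) (by simp)).summable.congr fun ρ => ?_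
  by_cases h0 : xiZeta ρ = 0
  · have := re_one_div_one_add_sub 0 (re_eq_zero_of_xiZeta_eq_zero hGRH h0)
    simp only [ofReal_zero, mul_zero, zero_mul, add_zero, zero_sub, neg_sq] at this
    rw [this]
  · have : analyticOrderAt xiZeta ρ = 0 :=
      ((differentiable_xiZeta.analyticAt _).analyticOrderAt_eq_zero).2 h0
    simp [analyticOrderNatAt, this]

/-- The explicit inequality for `testFn`, whose value `πδ/2` at zero gives the main term. `Z` is `∑
1/(1 + γ²)` over the zeros of `ζ`, hence independent of the character and of `a`, `δ`. -/
theorem exists_forall_log_le_zeroCount (hGRH : GRH) : ∃ Z : ℝ, 0 ≤ Z ∧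
    ∀ (N : ℕ) [NeZero N] (χ : DirichletCharacter ℂ N), 1 < N → χ.IsPrimitive →
    ∀ a δ : ℝ, 0 < a → 0 ≤ δ →
      Real.pi * δ / 4 * Real.log N ≤
        zeroCount χ (a * Real.sqrt (1 + δ)) * (2 * (1 + δ) / a)
        + (1 + δ) * a *
          (4 * Real.exp (Real.pi / a / 2) + 4 * Real.exp (-(Real.pi / a / 2)) - 8)
        + (4 / a + 8 * a) * Z := by
  have hZs := summable_zeros_xiZeta hGRH
  refine ⟨∑' ρ : ℂ, analyticOrderNatAt xiZeta ρ * (1 / (1 + ρ.im ^ 2)),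
    tsum_nonneg fun ρ => by positivity, fun N _ χ hN hχ a δ ha hδ => ?_⟩
  have hT : 0 ≤ Real.pi / a := by positivity
  obtain ⟨C, hC⟩ := exists_abs_kernel_le hT (hasDerivAt_testFn a δ) (hasDerivAt_deriv_testFn a δ)
    (by fun_prop) (testFn_pi_div ha δ)
  obtain ⟨s1, s2, h⟩ := explicit_inequality hT (continuous_testFn a δ) (testFn_pi_div ha δ) hC
    (fun u hu => testFn_nonneg ha hδ hu) hGRH hN hχ
  have hle := tsum_testTransform_le hGRH hN hχ ha hδ s1
  have hpole := integral_testFn_mul_exp_le ha hδ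
  have hzeta : -((4 / a + 8 * a) *
      ∑' ρ : ℂ, analyticOrderNatAt xiZeta ρ * (1 / (1 + ρ.im ^ 2)))
      ≤ ∑' ρ : ℂ, analyticOrderNatAt xiZeta ρ * testTransform a δ ρ.im := by
    rw [← tsum_mul_left, ← tsum_neg]
    refine Summable.tsum_le_tsum (fun ρ => ?_) (hZs.mul_left _).neg s2
    have := mul_le_mul_of_nonneg_left (neg_div_le_testTransform ha hδ ρ.im)
      (Nat.cast_nonneg (analyticOrderNatAt xiZeta ρ) : (0 : ℝ) ≤ _)
    refine le_trans (le_of_eq ?_) this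
    ring
  rw [testFn_zero] at h
  simp only [testTransform] at hle hzeta
  linarith

end LowZeros

end

section

open Complex Metric Filter Topology MeasureTheory

namespace LowZeros

/-! ### Reduction to primitive characters -/

lemma eulerProduct_ne_zero {M : ℕ} (N : ℕ) (χ : DirichletCharacter ℂ M) {s : ℂ} (hs : 0 < s.re) :
    ∏ p ∈ N.primeFactors, (1 - χ p * (p : ℂ) ^ (-s)) ≠ 0 := by
  refine Finset.prod_ne_zero_iff.2 fun p hp h => ?_
  have hp' := Nat.prime_of_mem_primeFactors hp
  have h1 : ‖χ p * (p : ℂ) ^ (-s)‖ = 1 := by rw [← sub_eq_zero.1 h, norm_one]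
  have h2 : ‖(p : ℂ) ^ (-s)‖ < 1 := by
    rw [norm_natCast_cpow_of_pos hp'.pos]
    exact Real.rpow_lt_one_of_one_lt_of_neg (by exact_mod_cast hp'.one_lt) (by simpa using hs)
  rw [norm_mul] at h1
  nlinarith [DirichletCharacter.norm_le_one χ p, norm_nonneg ((p : ℂ) ^ (-s)), norm_nonneg (χ p)]

section ChangeLevel

variable {M N : ℕ} [NeZero M] [NeZero N]

/-- The extra Euler factors satisfy `|χ(p) p^{-s}| < 1` for `Re s > 0`, so they vanish nowhere in
the open strip. -/
lemma nontrivialZeros_changeLevel (hMN : M ∣ N) {χ : DirichletCharacter ℂ M} (hχ : χ ≠ 1) :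
    nontrivialZeros (DirichletCharacter.changeLevel hMN χ) = nontrivialZeros χ := by
  ext ρ
  simp only [nontrivialZeros, Set.mem_ofPred_eq]
  refine and_congr_right fun h0 => and_congr_right fun _ => ?_
  rw [DirichletCharacter.LFunction_changeLevel hMN χ (Or.inl hχ), mul_eq_zero,
    or_iff_left (eulerProduct_ne_zero N χ h0)]

lemma analyticOrderNatAt_LFunction_changeLevel (hMN : M ∣ N) {χ : DirichletCharacter ℂ M}
    (hχ : χ ≠ 1) {s : ℂ} (hs : 0 < s.re) :
    analyticOrderNatAt (DirichletCharacter.LFunction (DirichletCharacter.changeLevel hMN χ)) s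
      = analyticOrderNatAt (DirichletCharacter.LFunction χ) s := by
  have hP : AnalyticAt ℂ (fun s : ℂ => ∏ p ∈ N.primeFactors, (1 - χ p * (p : ℂ) ^ (-s))) s := by
    refine Differentiable.analyticAt ?_ s
    refine Differentiable.fun_finsetProd fun p hp => ?_
    have hp0 : (p : ℂ) ≠ 0 := by exact_mod_cast (Nat.prime_of_mem_primeFactors hp).ne_zero
    refine (differentiable_const _).sub ((differentiable_const _).mul fun z => ?_)
    exact DifferentiableAt.const_cpow (by fun_prop) (Or.inl hp0)
  have e : DirichletCharacter.LFunction (DirichletCharacter.changeLevel hMN χ)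
      = DirichletCharacter.LFunction χ *
        fun s : ℂ => ∏ p ∈ N.primeFactors, (1 - χ p * (p : ℂ) ^ (-s)) :=
    funext fun _ => DirichletCharacter.LFunction_changeLevel hMN χ (Or.inl hχ)
  rw [analyticOrderNatAt, e, analyticOrderAt_mul
    ((DirichletCharacter.differentiable_LFunction hχ).analyticAt s) hP,
    (hP.analyticOrderAt_eq_zero).2 (eulerProduct_ne_zero N χ hs), add_zero, analyticOrderNatAt]

lemma zeroCount_changeLevel (hMN : M ∣ N) {χ : DirichletCharacter ℂ M} (hχ : χ ≠ 1) (t : ℝ) :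
    zeroCount (DirichletCharacter.changeLevel hMN χ) t = zeroCount χ t := by
  rw [zeroCount, zeroCount, nontrivialZeros_changeLevel hMN hχ]
  exact finsum_mem_congr rfl fun ρ hρ =>
    analyticOrderNatAt_LFunction_changeLevel hMN hχ hρ.1.1

end ChangeLevel

/-- Facts about the low zeros of primitive characters hold for all characters. -/
lemma of_primitive {p : ℕ → Set ℝ → (ℝ → ℕ) → Prop}
    (h : ∀ (N : ℕ) [NeZero N] (χ : DirichletCharacter ℂ N), 1 < N → χ.IsPrimitive →
      p N (zeroHeights χ) (zeroCount χ))
    {N : ℕ} [NeZero N] (χ : DirichletCharacter ℂ N) (hχ : 1 < χ.conductor) :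
    p χ.conductor (zeroHeights χ) (zeroCount χ) := by
  have : NeZero χ.conductor := ⟨χ.conductor_ne_zero⟩
  have hp := χ.primitiveCharacter_isPrimitive
  have h1 := ne_one_of_isPrimitive hχ hp
  have hz := nontrivialZeros_changeLevel χ.conductor_dvd_level h1
  have hc := funext (zeroCount_changeLevel χ.conductor_dvd_level h1)
  rw [χ.changeLevel_primitiveCharacter] at hz hc
  rw [zeroHeights, hz, hc]
  exact h _ _ hχ hp

/-- The unit group mod `2` is trivial, so its only character is `1`. Hence `N ≥ 3 > e`, which makes
`log log N` positive. -/
lemma two_lt_of_isPrimitive {N : ℕ} [NeZero N] {χ : DirichletCharacter ℂ N} (hN : 1 < N)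
    (hχ : χ.IsPrimitive) : 2 < N := by
  refine lt_of_le_of_ne hN fun h => ?_
  subst h
  refine ne_one_of_isPrimitive hN hχ (MulChar.ext fun u => ?_)
  have : u = 1 := by revert u; decide
  simp [this]

lemma one_lt_log_of_two_lt {N : ℕ} (hN : 2 < N) : 1 < Real.log N := by
  have h3 : (3 : ℝ) ≤ N := by exact_mod_cast hN
  rw [Real.lt_log_iff_exp_lt (by linarith)]
  linarith [Real.exp_one_lt_d9]

/-! ### Existence of a lowest zero -/

section Lowest

variable {N : ℕ} [NeZero N] {χ : DirichletCharacter ℂ N}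

lemma exists_mem_zeroHeights_le_of_zeroCount_ne_zero {t : ℝ} (h : zeroCount χ t ≠ 0) :
    ∃ x ∈ zeroHeights χ, x ≤ t := by
  by_contra! hne
  apply h
  have : {ρ ∈ nontrivialZeros χ | |ρ.im| ≤ t} = ∅ := by
    ext ρ
    simp only [Set.mem_ofPred_eq, Set.mem_empty_iff_false, iff_false, not_and, not_le]
    exact fun hρ => hne _ ⟨ρ, hρ, rfl⟩
  rw [zeroCount, this, finsum_mem_empty]

lemma finite_zeroHeights_inter_Iic (hGRH : GRH) (hN : 1 < N) (hχ : χ.IsPrimitive) (t : ℝ) :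
    (zeroHeights χ ∩ Set.Iic t).Finite := by
  have hfin := ((finite_lowZeros_xiChar hGRH hN hχ t).image fun z : ℂ => 1 / 2 + z)
  rw [← lowZeros_eq_image hGRH hN hχ] at hfin
  refine (hfin.image fun ρ : ℂ => |ρ.im|).subset ?_
  rintro _ ⟨⟨ρ, hρ, rfl⟩, ht⟩
  exact ⟨ρ, ⟨hρ, ht⟩, rfl⟩

lemma isLeast_sInf_of_finite_inter_Iic {S : Set ℝ} {t x : ℝ} (hS : (S ∩ Set.Iic t).Finite)
    (hx : x ∈ S) (hxt : x ≤ t) : IsLeast S (sInf S) := by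
  obtain ⟨y, ⟨hyS, hyt⟩, hy⟩ := hS.exists_minimalFor id _ ⟨x, hx, hxt⟩
  have hl : IsLeast S y := by
    refine ⟨hyS, fun z hz => ?_⟩
    rcases le_total z t with h | h
    · rcases le_total z y with h' | h'
      · exact hy ⟨hz, h⟩ h'
      · exact h'
    · exact le_trans hyt h
  rwa [hl.csInf_eq]

end Lowest

/-! ### Choice of the parameters -/

section Parameters

lemma log_four_pos : 0 < Real.log 4 := Real.log_pos (by norm_num)

lemma log_four_le : Real.log 4 ≤ 2 := by
  rw [show (4 : ℝ) = 2 * 2 by norm_num, Real.log_mul two_ne_zero two_ne_zero]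
  linarith [Real.log_two_lt_d9]

lemma exp_add_log_four (x : ℝ) : Real.exp (x - Real.log 4) = Real.exp x / 4 := by
  rw [Real.exp_sub, Real.exp_log (by norm_num)]

lemma pi_div_pi_div_two {m : ℝ} (hm : 0 < m) :
    Real.pi / (Real.pi / (2 * m)) / 2 = m := by
  have := Real.pi_ne_zero
  field_simp

/-- The origin of `log 4`: the support ends at `T = 2m`, and `4 e^{T/2} = 4 e^m = e^L`. The `-8`
absorbs `4 e^{-m}`. -/
lemma poleTerm_le {m L : ℝ} (hm : 0 < m) (hL : L = m + Real.log 4) {δ : ℝ} (hδ : 0 ≤ δ) :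
    (1 + δ) * (Real.pi / (2 * m)) * (4 * Real.exp (Real.pi / (Real.pi / (2 * m)) / 2)
      + 4 * Real.exp (-(Real.pi / (Real.pi / (2 * m)) / 2)) - 8)
      ≤ (1 + δ) * (Real.pi / (2 * m)) * Real.exp L := by
  have hπ := Real.pi_pos
  rw [pi_div_pi_div_two hm]
  refine mul_le_mul_of_nonneg_left ?_ (by positivity)
  have h1 : Real.exp m = Real.exp L / 4 := by rw [← exp_add_log_four, hL, add_sub_cancel_right]
  have h2 : Real.exp (-m) ≤ 1 := Real.exp_le_one_iff.2 (by linarith)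
  linarith

/-- The parameters for a single zero, when the conductor is large. -/
lemma exists_parameters_lowest (Z : ℝ) (hZ : 0 ≤ Z) : ∃ L₀ : ℝ, 0 < L₀ ∧ ∀ L, L₀ ≤ L →
    ∃ a δ : ℝ, 0 < a ∧ 0 ≤ δ ∧
      (1 + δ) * a * (4 * Real.exp (Real.pi / a / 2) + 4 * Real.exp (-(Real.pi / a / 2)) - 8)
        + (4 / a + 8 * a) * Z < Real.pi * δ / 4 * Real.exp L ∧
      a * Real.sqrt (1 + δ) ≤ Real.pi / (2 * L) + Real.pi * (Real.log 4 + 1) / (2 * L ^ 2)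
        + 28 * Real.pi / L ^ 3 := by
  -- The zeta-zero term is at most `24 m Z` and must stay below the margin `π e^L/(2m²)`. Since `e^L
  -- = 4 e^m` and `π ≥ 1`, it suffices that `12 Z m³ < e^m`.
  have hlim : Tendsto (fun m : ℝ => 12 * Z * (m ^ 3 * Real.exp (-m))) atTop (𝓝 0) := by
    simpa using (Real.tendsto_pow_mul_exp_neg_atTop_nhds_zero 3).const_mul (12 * Z)
  obtain ⟨m₀, hm₀⟩ := eventually_atTop.1 (hlim.eventually (gt_mem_nhds one_pos))
  have hc0 := log_four_pos
  have hc2 := log_four_le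
  set c := Real.log 4 with hc
  have hπ := Real.pi_gt_three
  have hπ4 := Real.pi_le_four
  refine ⟨max m₀ 8 + c, by positivity, fun L hL => ?_⟩
  set m := L - c with hm
  have hm8 : 8 ≤ m := by linarith [le_max_right m₀ 8]
  have hmm : m₀ ≤ m := by linarith [le_max_left m₀ 8]
  have hmpos : 0 < m := by linarith
  have hLpos : 0 < L := by linarith
  have hLm : L = m + Real.log 4 := by rw [hm, ← hc]; ring
  -- Beating the pole term requires `πδ/4 > (1 + δ)π/(2m)`, that is `δ = 2/m + 4/m² + ...`. Taking
  -- `8/m²` instead leaves the margin `π e^L/(2m²)` as soon as `m ≥ 8`, and alters the height only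
  -- at order `m⁻³`.
  refine ⟨Real.pi / (2 * m), 2 / m + 8 / m ^ 2, by positivity, by positivity, ?_, ?_⟩
  · have h1 := poleTerm_le hmpos hLm (δ := 2 / m + 8 / m ^ 2) (by positivity)
    have h2 := hm₀ m hmm
    have hexp : Real.exp m = Real.exp L / 4 := by
      rw [← exp_add_log_four, hLm, add_sub_cancel_right]
    have h3 : 12 * Z * m ^ 3 < Real.exp L / 4 := by
      have h4 : 12 * Z * (m ^ 3 * Real.exp (-m)) * Real.exp m < 1 * Real.exp m :=
        mul_lt_mul_of_pos_right h2 (Real.exp_pos m)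
      rw [one_mul, hexp] at h4
      calc 12 * Z * m ^ 3 = 12 * Z * (m ^ 3 * Real.exp (-m)) * (Real.exp L / 4) := by
            rw [← hexp, Real.exp_neg]
            field_simp
        _ < _ := h4
    have h5 : (4 / (Real.pi / (2 * m)) + 8 * (Real.pi / (2 * m))) * Z ≤ 24 * m * Z := by
      refine mul_le_mul_of_nonneg_right ?_ hZ
      have e1 : 4 / (Real.pi / (2 * m)) = 8 * m / Real.pi := by field_simp; norm_num
      have e2 : 8 * m / Real.pi ≤ 8 * m := div_le_self (by positivity) (by linarith)
      have e3 : 8 * (Real.pi / (2 * m)) = 4 * Real.pi / m := by field_simp; norm_num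
      have e4 : 4 * Real.pi / m ≤ 16 * m := by
        rw [div_le_iff₀ hmpos]
        nlinarith
      rw [e1, e3]
      linarith
    have h6 : 24 * m * Z * (2 * m ^ 2) < Real.exp L * Real.pi := by
      have := le_mul_of_one_le_right (Real.exp_pos L).le (by linarith : 1 ≤ Real.pi)
      linarith
    have h7 : 24 * m * Z < Real.exp L * Real.pi / (2 * m ^ 2) := by
      rw [lt_div_iff₀ (by positivity)]
      exact h6
    have h8 : Real.exp L * Real.pi / (2 * m ^ 2)
        ≤ Real.pi * (2 / m + 8 / m ^ 2) / 4 * Real.exp L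
          - (1 + (2 / m + 8 / m ^ 2)) * (Real.pi / (2 * m)) * Real.exp L := by
      have e : Real.pi * (2 / m + 8 / m ^ 2) / 4 * Real.exp L
          - (1 + (2 / m + 8 / m ^ 2)) * (Real.pi / (2 * m)) * Real.exp L
          - Real.exp L * Real.pi / (2 * m ^ 2)
          = Real.exp L * Real.pi * (m - 8) / (2 * m ^ 3) := by
        field_simp
        ring
      have : 0 ≤ Real.exp L * Real.pi * (m - 8) / (2 * m ^ 3) := by
        have := Real.exp_pos L
        have : 0 ≤ m - 8 := by linarith
        positivity
      linarith
    linarith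
  · have hs : Real.sqrt (1 + (2 / m + 8 / m ^ 2)) ≤ 1 + (2 / m + 8 / m ^ 2) / 2 := by
      have : 0 ≤ 2 / m + 8 / m ^ 2 := by positivity
      rw [Real.sqrt_le_left (by positivity)]
      nlinarith
    refine (mul_le_mul_of_nonneg_left hs (by positivity)).trans ?_
    have hLc : L ≤ 2 * m := by linarith
    have i0 : 1 / m ≤ 2 / L := by
      rw [div_le_div_iff₀ hmpos hLpos]; linarith
    -- Expansion of `1/m = 1/(L - c)` in powers of `1/L`; the remainder uses `m ≥ L/2`.
    have i1 : 1 / m ≤ 1 / L + c / L ^ 2 + 2 * c ^ 2 / L ^ 3 := by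
      have e : 1 / m = 1 / L + c / L ^ 2 + c ^ 2 / L ^ 2 * (1 / m) := by
        have : m ≠ 0 := hmpos.ne'
        have hcL : c = L - m := by rw [hm]; ring
        rw [hcL]
        field_simp
        ring
      have : c ^ 2 / L ^ 2 * (1 / m) ≤ c ^ 2 / L ^ 2 * (2 / L) :=
        mul_le_mul_of_nonneg_left i0 (by positivity)
      have e2 : c ^ 2 / L ^ 2 * (2 / L) = 2 * c ^ 2 / L ^ 3 := by field_simp
      linarith
    have i2 : 1 / m ^ 2 ≤ 1 / L ^ 2 + 8 * c / L ^ 3 := by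
      have e : 1 / m ^ 2 = 1 / L ^ 2 + c * (L + m) / L ^ 2 * (1 / m) ^ 2 := by
        have : m ≠ 0 := hmpos.ne'
        have hcL : c = L - m := by rw [hm]; ring
        rw [hcL]
        field_simp
        ring
      have h2 : (1 / m) ^ 2 ≤ (2 / L) ^ 2 := pow_le_pow_left₀ (by positivity) i0 2
      have h3 : c * (L + m) / L ^ 2 ≤ c * (2 * L) / L ^ 2 := by
        refine div_le_div_of_nonneg_right ?_ (by positivity)
        exact mul_le_mul_of_nonneg_left (by linarith) hc0.le
      have h4 : c * (L + m) / L ^ 2 * (1 / m) ^ 2 ≤ c * (2 * L) / L ^ 2 * (2 / L) ^ 2 :=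
        mul_le_mul h3 h2 (by positivity) (by positivity)
      have e2 : c * (2 * L) / L ^ 2 * (2 / L) ^ 2 = 8 * c / L ^ 3 := by field_simp; norm_num
      linarith
    have i3 : 1 / m ^ 3 ≤ 8 / L ^ 3 := by
      have := pow_le_pow_left₀ (by positivity) i0 3
      rw [div_pow, div_pow] at this
      norm_num at this ⊢
      exact this
    have e : Real.pi / (2 * m) * (1 + (2 / m + 8 / m ^ 2) / 2)
        = Real.pi / 2 * (1 / m + 1 / m ^ 2 + 4 * (1 / m ^ 3)) := by
      field_simp
      ring
    have e' : Real.pi / (2 * L) + Real.pi * (c + 1) / (2 * L ^ 2) + 28 * Real.pi / L ^ 3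
        = Real.pi / 2 * (1 / L + (c + 1) / L ^ 2 + 56 / L ^ 3) := by
      field_simp
      ring
    rw [e, e']
    refine mul_le_mul_of_nonneg_left ?_ (by positivity)
    -- As `c = log 4 ≤ 2`, the cubic terms add up to at most `8 + 16 + 32 = 56`, which the prefactor
    -- `π/2` turns into `28π`.
    have j : 2 * c ^ 2 / L ^ 3 + 8 * c / L ^ 3 + 4 * (8 / L ^ 3) ≤ 56 / L ^ 3 := by
      rw [← add_div, mul_div_assoc', ← add_div]
      refine div_le_div_of_nonneg_right ?_ (by positivity)
      nlinarith
    have e3 : (c + 1) / L ^ 2 = c / L ^ 2 + 1 / L ^ 2 := add_div _ _ _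
    linarith

/-- The parameters for a single zero, uniformly in the conductor. -/
lemma exists_parameters_uniform (Z : ℝ) (hZ : 0 ≤ Z) : ∃ a δ : ℝ, 0 < a ∧ 0 ≤ δ ∧
    (1 + δ) * a * (4 * Real.exp (Real.pi / a / 2) + 4 * Real.exp (-(Real.pi / a / 2)) - 8)
      + (4 / a + 8 * a) * Z < Real.pi * δ / 4 := by
  have hπ := Real.pi_pos
  have hπ3 := Real.pi_gt_three
  -- Here `T/2 = 1/32`, so the bracket in the pole term is at most `1/128` and the pole term at most
  -- `(1 + δ)π/8`. This is half of the main term up to a constant; the choice `δ = 2 + 8W` then also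
  -- covers `W`.
  set a := 16 * Real.pi with ha
  have hapos : 0 < a := by positivity
  set W := (4 / a + 8 * a) * Z with hW
  have hW0 : 0 ≤ W := by positivity
  refine ⟨a, 2 + 8 * W, hapos, by positivity, ?_⟩
  have hT : Real.pi / a / 2 = 1 / 32 := by
    rw [ha]; field_simp; norm_num
  rw [hT]
  have h1 := (abs_le.1 (Real.abs_exp_sub_one_sub_id_le (x := 1 / 32) (by norm_num))).2
  have h2 := (abs_le.1 (Real.abs_exp_sub_one_sub_id_le (x := -(1 / 32))
    (by rw [abs_neg]; norm_num))).2
  have h3 : 4 * Real.exp (1 / 32) + 4 * Real.exp (-(1 / 32)) - 8 ≤ 1 / 128 := by linarith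
  have h4 : (1 + (2 + 8 * W)) * a * (4 * Real.exp (1 / 32) + 4 * Real.exp (-(1 / 32)) - 8)
      ≤ (1 + (2 + 8 * W)) * a * (1 / 128) := mul_le_mul_of_nonneg_left h3 (by positivity)
  have h5 : (1 + (2 + 8 * W)) * a * (1 / 128) = Real.pi / 8 * (3 + 8 * W) := by rw [ha]; ring
  nlinarith

/-- The parameters for counting zeros. -/
lemma exists_parameters_count (Z : ℝ) {C ε : ℝ} (hC : Real.log 4 + 1 < C) (hε : 0 < ε) :
    ∃ L₀ : ℝ, ∀ L, L₀ ≤ L → ∃ a δ : ℝ, 0 < a ∧ 0 ≤ δ ∧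
      a * Real.sqrt (1 + δ) = Real.pi / (2 * L) + Real.pi * C / (2 * L ^ 2) ∧
      (Real.pi ^ 2 / 8 * (C - Real.log 4 - 1) - ε) * (Real.exp L / L ^ 2) * (2 * (1 + δ) / a)
        + (1 + δ) * a * (4 * Real.exp (Real.pi / a / 2) + 4 * Real.exp (-(Real.pi / a / 2)) - 8)
        + (4 / a + 8 * a) * Z ≤ Real.pi * δ / 4 * Real.exp L := by
  have hc0 := log_four_pos
  set c := Real.log 4 with hc
  have hπ := Real.pi_pos
  set a : ℝ → ℝ := fun L => Real.pi / (2 * (L - c)) with ha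
  -- `r` is `√(1+δ)`, forced by the prescribed height: `a r = (π/(2L))(1 + C/L)` with `a = π/(2(L -
  -- c))`.
  set r : ℝ → ℝ := fun L => (1 + C * L⁻¹) * (1 - c * L⁻¹) with hr
  set δ : ℝ → ℝ := fun L => r L ^ 2 - 1 with hδ
  have hinv : Tendsto (fun L : ℝ => L⁻¹) atTop (𝓝 0) := tendsto_inv_atTop_zero
  have hpos : ∀ᶠ L : ℝ in atTop, 0 < L ∧ c < L :=
    (eventually_gt_atTop 0).and (eventually_gt_atTop c)
  have t1 : Tendsto (fun L => L * a L) atTop (𝓝 (Real.pi / 2)) := by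
    have : Tendsto (fun L : ℝ => Real.pi / (2 * (1 - c * L⁻¹))) atTop
        (𝓝 (Real.pi / (2 * (1 - c * 0)))) :=
      tendsto_const_nhds.div (tendsto_const_nhds.mul (tendsto_const_nhds.sub
        (hinv.const_mul c))) (by norm_num)
    rw [mul_zero, sub_zero, mul_one] at this
    refine this.congr' ?_
    filter_upwards [hpos] with L hL
    have h1 : L - c ≠ 0 := by linarith [hL.2]
    have h2 : L ≠ 0 := hL.1.ne'
    simp only [ha]
    field_simp
  have t2 : Tendsto r atTop (𝓝 1) := by
    have : Tendsto r atTop (𝓝 ((1 + C * 0) * (1 - c * 0))) :=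
      (tendsto_const_nhds.add (hinv.const_mul C)).mul (tendsto_const_nhds.sub (hinv.const_mul c))
    simpa using this
  have t3 : Tendsto (fun L => L * (r L - 1)) atTop (𝓝 (C - c)) := by
    have : Tendsto (fun L : ℝ => C - c - c * C * L⁻¹) atTop (𝓝 (C - c - c * C * 0)) :=
      tendsto_const_nhds.sub (hinv.const_mul _)
    rw [mul_zero, sub_zero] at this
    refine this.congr' ?_
    filter_upwards [hpos] with L hL
    have h2 : L ≠ 0 := hL.1.ne'
    simp only [hr]
    field_simp
    ring
  have t4 : Tendsto δ atTop (𝓝 0) := by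
    have := (t2.pow 2).sub_const 1
    simpa using this
  have t5 : Tendsto (fun L => L * δ L) atTop (𝓝 (2 * (C - c))) := by
    have := t3.mul (t2.add_const 1)
    rw [show (C - c) * (1 + 1) = 2 * (C - c) by ring] at this
    refine this.congr fun L => ?_
    simp only [hδ]
    ring
  have x0 : Tendsto (fun L : ℝ => Real.exp (-L)) atTop (𝓝 0) := by
    simpa using Real.tendsto_pow_mul_exp_neg_atTop_nhds_zero 0
  have x1 : Tendsto (fun L : ℝ => L * Real.exp (-L)) atTop (𝓝 0) := by
    simpa using Real.tendsto_pow_mul_exp_neg_atTop_nhds_zero 1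
  have x2 := Real.tendsto_pow_mul_exp_neg_atTop_nhds_zero 2
  have t6 : Tendsto (fun L => L / a L * Real.exp (-L)) atTop (𝓝 0) := by
    have : Tendsto (fun L : ℝ => 2 / Real.pi * (L ^ 2 * Real.exp (-L) - c * (L * Real.exp (-L))))
        atTop (𝓝 (2 / Real.pi * (0 - c * 0))) := (x2.sub (x1.const_mul c)).const_mul _
    rw [mul_zero, sub_zero, mul_zero] at this
    refine this.congr' ?_
    filter_upwards [hpos] with L hL
    have h1 : L - c ≠ 0 := by linarith [hL.2]
    simp only [ha]
    field_simp
  have t7 : Tendsto (fun L => L * a L * Real.exp (-L)) atTop (𝓝 0) := by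
    simpa using t1.mul x0
  -- The surplus of main term over pole and zeta terms, divided by `e^L/L²` and by the largest
  -- contribution `2(1+δ)/a` of one zero. Since `L a → π/2` and `L δ → 2(C - c)`, the limit is
  -- `(π/4)((π/2)(C - c) - π/2)`; the `ε` absorbs the error.
  have main : Tendsto (fun L => L * a L / (2 * (1 + δ L)) * (Real.pi / 4 * (L * δ L)
      - (1 + δ L) * (L * a L) - (4 * (L / a L * Real.exp (-L)) + 8 * (L * a L * Real.exp (-L))) * Z))
      atTop (𝓝 (Real.pi ^ 2 / 8 * (C - c - 1))) := by
    have h := (t1.div ((t4.const_add 1).const_mul 2) (by norm_num)).mul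
      ((((t5.const_mul (Real.pi / 4)).sub ((t4.const_add 1).mul t1)).sub
        (((t6.const_mul 4).add (t7.const_mul 8)).mul_const Z)))
    convert! h using 2
    ring
  have hev := main.eventually (lt_mem_nhds (show Real.pi ^ 2 / 8 * (C - c - 1) - ε
    < Real.pi ^ 2 / 8 * (C - c - 1) by linarith))
  have hδpos : ∀ᶠ L in atTop, 0 < L * δ L :=
    t5.eventually (lt_mem_nhds (by linarith : 0 < 2 * (C - c)))
  obtain ⟨L₀, hL₀⟩ := eventually_atTop.1 ((hpos.and hδpos).and hev)
  refine ⟨L₀, fun L hL => ?_⟩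
  obtain ⟨⟨⟨hL0, hLc⟩, hd⟩, hmain⟩ := hL₀ L hL
  have hd0 : 0 < δ L := pos_of_mul_pos_right hd hL0.le
  have hm : 0 < L - c := by linarith
  have ha0 : 0 < a L := by simp only [ha]; positivity
  refine ⟨a L, δ L, ha0, hd0.le, ?_, ?_⟩
  · have hr0 : 0 ≤ r L := by
      have h1 : c * L⁻¹ ≤ 1 := by
        rw [← div_eq_mul_inv, div_le_one hL0]; exact hLc.le
      have h2 : 0 ≤ C * L⁻¹ := mul_nonneg (by linarith) (inv_nonneg.2 hL0.le)
      exact mul_nonneg (by linarith) (by linarith)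
    have e : 1 + δ L = r L ^ 2 := by simp only [hδ]; ring
    rw [e, Real.sqrt_sq hr0]
    simp only [ha, hr]
    field_simp
  · have hpole := poleTerm_le hm (L := L) (by rw [← hc]; ring) hd0.le
    have hx := Real.exp_pos L
    set B := 2 * (1 + δ L) / a L with hB
    have hB0 : 0 < B := by positivity
    set Φ := L * a L / (2 * (1 + δ L)) * (Real.pi / 4 * (L * δ L)
      - (1 + δ L) * (L * a L) - (4 * (L / a L * Real.exp (-L)) + 8 * (L * a L * Real.exp (-L))) * Z)
      with hΦ
    have e : Φ * (Real.exp L / L ^ 2) * B = Real.pi * δ L / 4 * Real.exp L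
        - (1 + δ L) * a L * Real.exp L - (4 / a L + 8 * a L) * Z := by
      have : 1 + δ L ≠ 0 := by positivity
      rw [hΦ, hB, Real.exp_neg]
      generalize δ L = d at *
      generalize a L = b at *
      field_simp
    have h1 : (Real.pi ^ 2 / 8 * (C - c - 1) - ε) * (Real.exp L / L ^ 2) * B
        ≤ Φ * (Real.exp L / L ^ 2) * B := by
      refine mul_le_mul_of_nonneg_right (mul_le_mul_of_nonneg_right hmain.le ?_) hB0.le
      positivity
    have h2 : (1 + δ L) * a L * (4 * Real.exp (Real.pi / a L / 2)
        + 4 * Real.exp (-(Real.pi / a L / 2)) - 8) ≤ (1 + δ L) * a L * Real.exp L := hpole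
    linarith

end Parameters

end LowZeros

end

section

open Complex Metric Filter Topology MeasureTheory

namespace LowZeros

/-! ### The lowest zero and the number of low zeros -/

theorem exists_lowest_zero_le (hGRH : GRH) : ∃ K : ℝ,
    ∀ (N : ℕ) [NeZero N] (χ : DirichletCharacter ℂ N), 1 < N → χ.IsPrimitive →
      IsLeast (zeroHeights χ) (sInf (zeroHeights χ)) ∧
      sInf (zeroHeights χ) ≤ Real.pi / (2 * Real.log (Real.log N))
        + Real.pi * (Real.log 4 + 1) / (2 * Real.log (Real.log N) ^ 2)
        + K / Real.log (Real.log N) ^ 3 := by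
  obtain ⟨Z, hZ, hmain⟩ := exists_forall_log_le_zeroCount hGRH
  obtain ⟨L₀, hL₀, hlarge⟩ := exists_parameters_lowest Z hZ
  obtain ⟨a₀, δ₀, ha₀, hδ₀, hsmall⟩ := exists_parameters_uniform Z hZ
  have hπ := Real.pi_pos
  have hc := log_four_pos
  set t₀ := a₀ * Real.sqrt (1 + δ₀) with ht₀
  have ht₀0 : 0 ≤ t₀ := by positivity
  -- `28π` serves for `L ≥ L₀`. For `0 < L ≤ L₀` the height `t₀`, valid for every conductor, is at
  -- most `t₀ L₀³/L³`.
  refine ⟨max (28 * Real.pi) (t₀ * L₀ ^ 3), fun N _ χ hN hχ => ?_⟩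
  have hlog := one_lt_log_of_two_lt (two_lt_of_isPrimitive hN hχ)
  set L := Real.log (Real.log N) with hL
  have hLpos : 0 < L := Real.log_pos hlog
  have hexp : Real.exp L = Real.log N := Real.exp_log (by linarith)
  have exists_le : ∀ a δ : ℝ, 0 < a → 0 ≤ δ →
      (1 + δ) * a * (4 * Real.exp (Real.pi / a / 2) + 4 * Real.exp (-(Real.pi / a / 2)) - 8)
        + (4 / a + 8 * a) * Z < Real.pi * δ / 4 * Real.log N →
      ∃ x ∈ zeroHeights χ, x ≤ a * Real.sqrt (1 + δ) := by
    intro a δ ha hδ h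
    refine exists_mem_zeroHeights_le_of_zeroCount_ne_zero fun h0 => ?_
    have := hmain N χ hN hχ a δ ha hδ
    rw [h0] at this
    push_cast at this
    linarith
  -- Since `log N > 1`, the uniform parameters yield a zero for every conductor. This makes the set
  -- of heights nonempty, so its infimum is a genuine minimum.
  obtain ⟨x, hx, hxt⟩ := exists_le a₀ δ₀ ha₀ hδ₀ (hsmall.trans_le
    (le_mul_of_one_le_right (by positivity) hlog.le))
  have hleast := isLeast_sInf_of_finite_inter_Iic
    (finite_zeroHeights_inter_Iic hGRH hN hχ t₀) hx hxt
  refine ⟨hleast, ?_⟩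
  rcases le_total L₀ L with h | h
  · obtain ⟨a, δ, ha, hδ, h1, h2⟩ := hlarge L h
    rw [hexp] at h1
    obtain ⟨y, hy, hyt⟩ := exists_le a δ ha hδ h1
    refine (hleast.2 hy).trans (hyt.trans (h2.trans ?_))
    gcongr
    exact le_max_left _ _
  · refine (hleast.2 hx).trans (hxt.trans ?_)
    have h1 : t₀ ≤ max (28 * Real.pi) (t₀ * L₀ ^ 3) / L ^ 3 := by
      rw [le_div_iff₀ (by positivity)]
      refine le_trans ?_ (le_max_right _ _)
      gcongr
    have h2 : 0 ≤ Real.pi / (2 * L) + Real.pi * (Real.log 4 + 1) / (2 * L ^ 2) := by positivity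
    linarith

theorem exists_le_zeroCount (hGRH : GRH) {C ε : ℝ} (hC : Real.log 4 + 1 < C) (hε : 0 < ε) :
    ∃ q₀ : ℕ, ∀ (N : ℕ) [NeZero N] (χ : DirichletCharacter ℂ N), 1 < N → χ.IsPrimitive → q₀ ≤ N →
      (Real.pi ^ 2 / 8 * (C - Real.log 4 - 1) - ε)
          * (Real.log N / Real.log (Real.log N) ^ 2) ≤
        (zeroCount χ (Real.pi / (2 * Real.log (Real.log N))
          + Real.pi * C / (2 * Real.log (Real.log N) ^ 2)) : ℝ) := by
  obtain ⟨Z, hZ, hmain⟩ := exists_forall_log_le_zeroCount hGRH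
  obtain ⟨L₀, hL₀⟩ := exists_parameters_count Z hC hε
  have hlim : Tendsto (fun n : ℕ => Real.log (Real.log n)) atTop atTop :=
    Real.tendsto_log_atTop.comp (Real.tendsto_log_atTop.comp tendsto_natCast_atTop_atTop)
  obtain ⟨q₀, hq₀⟩ := eventually_atTop.1 (hlim.eventually_ge_atTop L₀)
  refine ⟨q₀, fun N _ χ hN hχ hq => ?_⟩
  have hlog := one_lt_log_of_two_lt (two_lt_of_isPrimitive hN hχ)
  have hexp : Real.exp (Real.log (Real.log N)) = Real.log N := Real.exp_log (by linarith)
  obtain ⟨a, δ, ha, hδ, ht, h⟩ := hL₀ _ (hq₀ N hq)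
  have h1 := hmain N χ hN hχ a δ ha hδ
  rw [ht] at h1
  rw [hexp] at h
  have hB : 0 < 2 * (1 + δ) / a := by positivity
  refine le_of_mul_le_mul_right ?_ hB
  linarith

end LowZeros

end

theorem theorem1 (hGRH : LowZeros.GRH) :
    (∃ K : ℝ, ∀ (N : ℕ) [NeZero N] (χ : DirichletCharacter ℂ N), 1 < χ.conductor →
      IsLeast (LowZeros.zeroHeights χ) (LowZeros.lowestHeight χ) ∧
      LowZeros.lowestHeight χ ≤
        Real.pi / (2 * LowZeros.logLogConductor χ)
          + Real.pi * (Real.log 4 + 1) / (2 * LowZeros.logLogConductor χ ^ 2)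
          + K / LowZeros.logLogConductor χ ^ 3) ∧
    (∀ C : ℝ, Real.log 4 + 1 < C → ∀ ε : ℝ, 0 < ε → ∃ q₀ : ℕ,
      ∀ (N : ℕ) [NeZero N] (χ : DirichletCharacter ℂ N), 1 < χ.conductor → q₀ ≤ χ.conductor →
        (Real.pi ^ 2 / 8 * (C - Real.log 4 - 1) - ε)
            * (Real.log (χ.conductor : ℝ) / LowZeros.logLogConductor χ ^ 2) ≤
          (LowZeros.zeroCount χ
            (Real.pi / (2 * LowZeros.logLogConductor χ)
              + Real.pi * C / (2 * LowZeros.logLogConductor χ ^ 2)) : ℝ)) := by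
  refine ⟨?_, fun C hC ε hε => ?_⟩
  · obtain ⟨K, hK⟩ := LowZeros.exists_lowest_zero_le hGRH
    refine ⟨K, fun N _ χ hχ => ?_⟩
    exact LowZeros.of_primitive (p := fun N S _ => IsLeast S (sInf S) ∧
      sInf S ≤ Real.pi / (2 * Real.log (Real.log N))
        + Real.pi * (Real.log 4 + 1) / (2 * Real.log (Real.log N) ^ 2)
        + K / Real.log (Real.log N) ^ 3) hK χ hχ
  · obtain ⟨q₀, hq₀⟩ := LowZeros.exists_le_zeroCount hGRH hC hε
    refine ⟨q₀, fun N _ χ hχ hq => ?_⟩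
    exact LowZeros.of_primitive (p := fun N _ n => q₀ ≤ N →
      (Real.pi ^ 2 / 8 * (C - Real.log 4 - 1) - ε)
          * (Real.log N / Real.log (Real.log N) ^ 2) ≤
        (n (Real.pi / (2 * Real.log (Real.log N))
          + Real.pi * C / (2 * Real.log (Real.log N) ^ 2)) : ℝ)) hq₀ χ hχ hq
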